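/- Let $n\ge 1$, let $1<q<p<\infty$, let $\frac1r=\frac1q-\frac1p$, and let $b\in L^r(\mathbb R^n)$. Let $\Omega:\mathbb R^n\to\mathbb C$ be homogeneous of degree zero, that is, $\Omega(\mu x)=\Omega(x)$ for all $\mu\in(0,\infty)$ and $x\in\mathbb S^{n-1}$. Suppose that $\Omega\in L^v(\mathbb S^{n-1})$ for some $v\in(1,\infty]$ and that $\int_{\mathbb S^{n-1}}\Omega\,d\sigma=0$, where $\sigma$ is the surface measure on $\mathbb S^{n-1}$. For $f\in C_c^\infty(\mathbb R^n)$ and almost every $x\in\mathbb R^n$ let $$T_\Omega f(x)=\lim_{\varepsilon\to0^+}\int_{\varepsilon<|x-y|<1/\varepsilon}\frac{\Omega(x-y)}{|x-y|^n}f(y)\,dy .$$ Then this limit exists for almost every $x$, and $T_\Omega$ extends (uniquely, since $C_c^\infty$ is dense) to a bounded linear operator on $L^p(\mathbb R^n)$ and to a bounded linear operator on $L^q(\mathbb R^n)$, both again denoted by $T_\Omega$. The commutator $$[b,T_\Omega]f=b\,T_\Omega f-T_\Omega(bf),\qquad f\in L^p(\mathbb R^n),$$ where $bf\in L^q(\mathbb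 R^n)$ by Hölder's inequality, is a compact operator from $L^p(\mathbb R^n)$ to $L^q(\mathbb R^n)$. All functions are complex-valued. -/

import Mathlib

open MeasureTheory Filter Topology
open scoped ENNReal ContDiff

noncomputable section

namespace RoughCommutator

/-- The truncated singular integral
`∫_{ε < |x - y| < 1/ε} Ω(x - y) / |x - y| ^ n * f(y) dy`. -/
def truncatedIntegral {n : ℕ} (Ω f : EuclideanSpace ℝ (Fin n) → ℂ) (ε : ℝ)
    (x : EuclideanSpace ℝ (Fin n)) : ℂ :=
  ∫ y in {y | ε < ‖x - y‖ ∧ ‖x - y‖ < 1 / ε}, Ω (x - y) / ((‖x - y‖ ^ n : ℝ) : ℂ) * f y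

/-- The principal value integral defining `T_Ω f` at `x` exists and is equal to `z`. -/
def HasPrincipalValue {n : ℕ} (Ω f : EuclideanSpace ℝ (Fin n) → ℂ)
    (x : EuclideanSpace ℝ (Fin n)) (z : ℂ) : Prop :=
  Tendsto (fun ε : ℝ => truncatedIntegral Ω f ε x) (𝓝[>] 0) (𝓝 z)

/-- `T` is the singular integral operator `T_Ω` on `L^s`: a bounded linear operator on `L^s` that
is given on smooth compactly supported functions by the principal value integral. As those
functions are dense in `L^s` for finite `s`, there is at most one such `T`. -/
def IsSingularIntegral {n : ℕ} (Ω : EuclideanSpace ℝ (Fin n) → ℂ) (s : ℝ≥0∞) [Fact (1 ≤ s)]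
    (T : Lp ℂ s (volume : Measure (EuclideanSpace ℝ (Fin n))) →L[ℂ]
      Lp ℂ s (volume : Measure (EuclideanSpace ℝ (Fin n)))) : Prop :=
  ∀ (g : EuclideanSpace ℝ (Fin n) → ℂ)
    (f : Lp ℂ s (volume : Measure (EuclideanSpace ℝ (Fin n)))),
    ContDiff ℝ ∞ g → HasCompactSupport g → f =ᵐ[volume] g →
      ∀ᵐ x, HasPrincipalValue Ω g x (T f x)

/-- The commutator `[b, T] f = b T f - T (b f)` as a map from `L^p` to `L^q`, where `b ∈ L^r` and
`1/r + 1/p = 1/q`. The operator `T` acts on `f ∈ L^p` through `Tp` and on `b f ∈ L^q`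
through `Tq`; the products are those of `L^r` and `L^p` functions. -/
def commutator {n : ℕ} {p q r : ℝ≥0∞} [Fact (1 ≤ p)] [Fact (1 ≤ q)] [ENNReal.HolderTriple r p q]
    (b : Lp ℂ r (volume : Measure (EuclideanSpace ℝ (Fin n))))
    (Tp : Lp ℂ p (volume : Measure (EuclideanSpace ℝ (Fin n))) →L[ℂ]
      Lp ℂ p (volume : Measure (EuclideanSpace ℝ (Fin n))))
    (Tq : Lp ℂ q (volume : Measure (EuclideanSpace ℝ (Fin n))) →L[ℂ]
      Lp ℂ q (volume : Measure (EuclideanSpace ℝ (Fin n)))) :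
    Lp ℂ p (volume : Measure (EuclideanSpace ℝ (Fin n))) →ₗ[ℂ]
      Lp ℂ q (volume : Measure (EuclideanSpace ℝ (Fin n))) where
  toFun f := (b • Tp f : Lp ℂ q volume) - Tq (b • f : Lp ℂ q volume)
  map_add' f g := by
    rw [map_add, Lp.add_smul, Lp.add_smul, map_add]
    abel
  map_smul' c f := by
    rw [map_smul, ← Lp.smul_comm, ← Lp.smul_comm, map_smul, RingHom.id_apply, smul_sub]

end RoughCommutator

end

open MeasureTheory Filter Topology
open scoped ENNReal ContDiff

noncomputable section

set_option linter.unusedSectionVars false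

namespace RoughCommutator

/-! ### Minkowski's inequality for integrals of uniformly bounded families -/

section Minkowski

variable {α β : Type*} [MeasurableSpace α] [MeasurableSpace β] {μ : Measure α} {ν : Measure β}

/-! Compactness. Compact operators are closed in norm and the commutator depends continuously on `b
∈ L^r`, where `r < ∞` because `q < p`; so `b` may be taken smooth with compact support
(`isCompactOperator_comp_sub_comp`). Put `K(z) = Ω(z)/|z|^n`. On test functions the commutator is
then the absolutely convergent integral with kernel `K(x - y) (b x - b y)`. The difference `b x - b
(x - z)` is at most `min (L|z|) B`, and it vanishes unless `x` or `x - z` lies in the support of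
`b`. Therefore `K` may be replaced by a continuous compactly supported `k` at small cost in operator
norm (`Angular.exists_kernel_decomposition`). Near the origin `|z||K(z)|` is integrable. At infinity
`K` belongs to `L^s` for some `s > 1`, and the localization to the support of `b` lets Hölder's and
Young's inequalities absorb the tail. What remains has a continuous compactly supported kernel and
is a norm limit of operators of finite rank (`exists_isCompactOperator_kernel_approx`).

Boundedness. The longer part is the boundedness of the singular integral on `L^p`, `1 < p < ∞`, for
angular parts that are merely in `L^v`, `v > 1`. This is the method of rotations of Calderón and
Zygmund, applied to the averages `sing ε M ψ f = ∫ kap ε M t (ψ_t * f) dt` over `t > 0`, where `ψ_t`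
is the `L^1`-normalized dilate of `ψ` and `kap` is a smooth truncation of `1/t`. All bounds are
uniform in `ε` and `M`, so they pass to the limit by Fatou's lemma.

On the line, the truncated Hilbert transform is bounded by M. Riesz's argument: for `f ≥ 0` with
Cauchy integral `F`, the integral of `F ^ p` along a horizontal line vanishes, and a pointwise
inequality bounds `|Im F|^p` by `(Re F)^p` and `Re (F ^ p)`; duality covers `p ≥ 2`
(`exists_hilbBound`).

If `ψ` is odd, `sing ε M ψ` is an average of directional Hilbert transforms
(`eLpNorm_sing_le_of_odd`). If `ψ` is even with mean zero, insert the identity `∑ R_i² = -1/4` for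
half Riesz transforms `R_i` generated by derivatives of a Gaussian, and move one `R_i` onto `ψ`. The
result is odd, and its `L^1` norm is controlled by the `L^v` norm of `ψ`, which is where `v > 1` is
needed (`exists_lintegral_rieszLim_le`). Rotating twice gives the bound
(`exists_eLpNorm_sing_le_of_profile`), first for smooth `ψ` and then by approximation for rough `ψ`.

Finally `K` is, up to the factor `log 2`, the `dt/t` average of the dilates of its restriction to
the annulus `1 ≤ |z| ≤ 2`, so the principal value is a limit of such averages
(`Angular.exists_eLpNorm_pvInt_le`). -/

theorem lintegral_rpow_lintegral_mul_le [SFinite μ] [SFinite ν] {p : ℝ} (hp : 1 ≤ p)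
    {a : α → ℝ≥0∞} (ha : Measurable a) {G : α → β → ℝ≥0∞} (hG : Measurable (Function.uncurry G))
    {D : ℝ≥0∞} (hD : ∀ s, ∫⁻ x, G s x ^ p ∂ν ≤ D) :
    ∫⁻ x, (∫⁻ s, a s * G s x ∂μ) ^ p ∂ν ≤ (∫⁻ s, a s ∂μ) ^ p * D := by
  have hp0 : 0 < p := by linarith
  have swap : ∫⁻ x, ∫⁻ s, a s * G s x ^ p ∂μ ∂ν ≤ (∫⁻ s, a s ∂μ) * D := by
    rw [lintegral_lintegral_swap]
    · rw [← lintegral_mul_const _ ha]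
      refine lintegral_mono fun s => ?_
      have hm : Measurable fun x => G s x ^ p := (hG.comp measurable_prodMk_left).pow_const p
      rw [lintegral_const_mul _ hm]
      gcongr
      exact hD s
    · exact ((ha.comp measurable_snd).mul
        ((hG.comp measurable_swap).pow_const p)).aemeasurable
  rcases hp.eq_or_lt with rfl | hp1
  · simpa using swap
  have hpq := Real.HolderConjugate.conjExponent hp1
  set q := p.conjExponent
  have hq0 : 0 < q := hpq.symm.pos
  -- Hölder's inequality with `a` split as `a ^ (1/q) * a ^ (1/p)`. This is Jensen's inequality for
  -- the weight `a`, without dividing by its possibly zero or infinite mass.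
  have hpt : ∀ x, (∫⁻ s, a s * G s x ∂μ) ^ p ≤
      (∫⁻ s, a s ∂μ) ^ (p - 1) * ∫⁻ s, a s * G s x ^ p ∂μ := by
    intro x
    have h1 := ENNReal.lintegral_mul_le_Lp_mul_Lq μ hpq.symm (f := fun s => a s ^ (1 / q))
      (g := fun s => a s ^ (1 / p) * G s x) (ha.pow_const _).aemeasurable
      ((ha.pow_const _).mul (hG.comp measurable_prodMk_right)).aemeasurable
    have e1 : ∀ s, ((fun s => a s ^ (1 / q)) * fun s => a s ^ (1 / p) * G s x) s
        = a s * G s x := by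
      intro s
      have : 1 / q + 1 / p = 1 := by simpa using hpq.symm.inv_add_inv_eq_one
      simp only [Pi.mul_apply]
      rw [← mul_assoc, ← ENNReal.rpow_add_of_nonneg _ _ (by positivity) (by positivity), this,
        ENNReal.rpow_one]
    have e2 : ∀ s, (a s ^ (1 / q)) ^ q = a s := by
      intro s
      rw [← ENNReal.rpow_mul, one_div_mul_cancel hq0.ne', ENNReal.rpow_one]
    have e3 : ∀ s, (a s ^ (1 / p) * G s x) ^ p = a s * G s x ^ p := by
      intro s
      rw [ENNReal.mul_rpow_of_nonneg _ _ hp0.le, ← ENNReal.rpow_mul,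
        one_div_mul_cancel hp0.ne', ENNReal.rpow_one]
    simp_rw [e1, e2, e3] at h1
    calc (∫⁻ s, a s * G s x ∂μ) ^ p
        ≤ ((∫⁻ s, a s ∂μ) ^ (1 / q) * (∫⁻ s, a s * G s x ^ p ∂μ) ^ (1 / p)) ^ p := by gcongr
      _ = _ := by
        rw [ENNReal.mul_rpow_of_nonneg _ _ hp0.le, ← ENNReal.rpow_mul, ← ENNReal.rpow_mul,
          one_div_mul_cancel hp0.ne', ENNReal.rpow_one]
        congr 2
        have := hpq.inv_add_inv_eq_one
        field_simp at this ⊢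
        linarith
  calc ∫⁻ x, (∫⁻ s, a s * G s x ∂μ) ^ p ∂ν
      ≤ ∫⁻ x, (∫⁻ s, a s ∂μ) ^ (p - 1) * ∫⁻ s, a s * G s x ^ p ∂μ ∂ν := lintegral_mono hpt
    _ = (∫⁻ s, a s ∂μ) ^ (p - 1) * ∫⁻ x, ∫⁻ s, a s * G s x ^ p ∂μ ∂ν := by
        rw [lintegral_const_mul]
        exact Measurable.lintegral_prod_right' (f := fun z : β × α => a z.2 * G z.2 z.1 ^ p)
          ((ha.comp measurable_snd).mul ((hG.comp measurable_swap).pow_const p))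
    _ ≤ (∫⁻ s, a s ∂μ) ^ (p - 1) * ((∫⁻ s, a s ∂μ) * D) := by gcongr
    _ = (∫⁻ s, a s ∂μ) ^ p * D := by
        rw [← mul_assoc]
        congr 1
        nth_rewrite 2 [← ENNReal.rpow_one (∫⁻ s, a s ∂μ)]
        rw [← ENNReal.rpow_add_of_nonneg _ _ (by linarith) zero_le_one, sub_add_cancel]

/-- Minkowski's inequality for a nonnegative integral of functions bounded in `L^p`. -/
theorem eLpNorm_lintegral_mul_le [SFinite μ] [SFinite ν] {p : ℝ≥0∞} (hp : 1 ≤ p) (hp' : p ≠ ⊤)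
    {a : α → ℝ≥0∞} (ha : Measurable a) {G : α → β → ℝ≥0∞} (hG : Measurable (Function.uncurry G))
    {D : ℝ≥0∞} (hD : ∀ s, eLpNorm (G s) p ν ≤ D) :
    eLpNorm (fun x => ∫⁻ s, a s * G s x ∂μ) p ν ≤ (∫⁻ s, a s ∂μ) * D := by
  have hp0 : p ≠ 0 := (zero_lt_one.trans_le hp).ne'
  have hpr : 1 ≤ p.toReal := by
    rw [← ENNReal.toReal_one]
    exact (ENNReal.toReal_le_toReal (by simp) hp').2 hp
  have hpr0 : 0 < p.toReal := by linarith
  have key := lintegral_rpow_lintegral_mul_le (μ := μ) (ν := ν) hpr ha hG (D := D ^ p.toReal)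
    (fun s => by
      have := hD s
      rw [eLpNorm_eq_lintegral_rpow_enorm_toReal hp0 hp', one_div,
        ENNReal.rpow_inv_le_iff hpr0] at this
      simpa using this)
  rw [eLpNorm_eq_lintegral_rpow_enorm_toReal hp0 hp', one_div, ENNReal.rpow_inv_le_iff hpr0,
    ENNReal.mul_rpow_of_nonneg _ _ hpr0.le]
  simpa using key

/-- Minkowski's inequality for an integral of functions bounded in `L^p`. -/
theorem eLpNorm_integral_mul_le [SFinite μ] [SFinite ν] {p : ℝ≥0∞} (hp : 1 ≤ p) (hp' : p ≠ ⊤)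
    {a : α → ℂ} (ha : Measurable a) {G : α → β → ℂ} (hG : Measurable (Function.uncurry G))
    {D : ℝ≥0∞} (hD : ∀ s, eLpNorm (G s) p ν ≤ D) :
    eLpNorm (fun x => ∫ s, a s * G s x ∂μ) p ν ≤ (∫⁻ s, ‖a s‖ₑ ∂μ) * D := by
  refine le_trans ?_ (eLpNorm_lintegral_mul_le hp hp' ha.enorm (G := fun s x => ‖G s x‖ₑ)
    hG.enorm (D := D) (μ := μ) (ν := ν) fun s => ?_)
  · refine eLpNorm_mono_enorm fun x => ?_
    simp only [enorm_eq_self]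
    refine (enorm_integral_le_lintegral_enorm _).trans_eq ?_
    simp [enorm_mul]
  · simpa using hD s

end Minkowski

/-! ### Shift averages -/

section Shift

variable {E : Type*} [NormedAddCommGroup E] [MeasureSpace E] [BorelSpace E]
  [SecondCountableTopology E]
  [(volume : Measure E).IsAddLeftInvariant] [SFinite (volume : Measure E)]
  {α : Type*} [MeasurableSpace α] {μ : Measure α}

theorem eLpNorm_comp_sub_right {f : E → ℂ} (hf : Measurable f) (p : ℝ≥0∞) (h : E) :
    eLpNorm (fun x => f (x - h)) p volume = eLpNorm f p volume :=
  eLpNorm_comp_measurePreserving hf.aestronglyMeasurable (measurePreserving_sub_right volume h)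

/-- Translations preserve the `L^p` norm, so Minkowski applies. The shift `φ` is arbitrary in this
section because it will be the identity on the line, `t ↦ t • y` along a direction, and `(t, y) ↦ t
• y` for dilation averages. -/
theorem eLpNorm_integral_shift_le [SFinite μ] {p : ℝ≥0∞} (hp : 1 ≤ p)
    (hp' : p ≠ ⊤) {a : α → ℂ} (ha : Measurable a) {φ : α → E} (hφ : Measurable φ) {f : E → ℂ}
    (hf : Measurable f) :
    eLpNorm (fun x => ∫ s, a s * f (x - φ s) ∂μ) p volume ≤
      (∫⁻ s, ‖a s‖ₑ ∂μ) * eLpNorm f p volume := by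
  refine eLpNorm_integral_mul_le (G := fun s x => f (x - φ s)) hp hp' ha ?_ fun s => ?_
  · exact hf.comp (measurable_snd.sub (hφ.comp measurable_fst))
  · exact (eLpNorm_comp_sub_right hf p _).le

theorem measurable_integral_shift [SFinite μ] {a : α → ℂ} (ha : Measurable a) {φ : α → E}
    (hφ : Measurable φ) {f : E → ℂ} (hf : Measurable f) :
    Measurable fun x => ∫ s, a s * f (x - φ s) ∂μ := by
  have h : Measurable fun z : E × α => a z.2 * f (z.1 - φ z.2) :=
    (ha.comp measurable_snd).mul (hf.comp (measurable_fst.sub (hφ.comp measurable_snd)))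
  exact h.stronglyMeasurable.integral_prod_right.measurable

theorem integrable_mul_shift {a : α → ℂ} (ha : Integrable a μ) {φ : α → E} (hφ : Measurable φ)
    {f : E → ℂ} (hf : Measurable f) {B : ℝ} (hB : ∀ x, ‖f x‖ ≤ B) (x : E) :
    Integrable (fun s => a s * f (x - φ s)) μ :=
  ha.mul_bdd (hf.comp (hφ.const_sub x)).aestronglyMeasurable (ae_of_all _ fun _ => hB _)

theorem norm_integral_shift_le {a : α → ℂ} (ha : Integrable a μ) {φ : α → E}
    {f : E → ℂ} {B : ℝ} (hB : ∀ x, ‖f x‖ ≤ B) (x : E) :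
    ‖∫ s, a s * f (x - φ s) ∂μ‖ ≤ (∫ s, ‖a s‖ ∂μ) * B := by
  rw [← integral_mul_const]
  refine norm_integral_le_of_norm_le (ha.norm.mul_const B) (ae_of_all _ fun s => ?_)
  rw [norm_mul]
  gcongr
  exact hB _

end Shift

/-! ### The truncated Hilbert kernel -/

/-- The difference of two conjugate Poisson kernels. -/
def kap (ε M t : ℝ) : ℝ := t / (t ^ 2 + ε ^ 2) - t / (t ^ 2 + M ^ 2)

theorem kap_neg (ε M t : ℝ) : kap ε M (-t) = -kap ε M t := by
  simp only [kap]; ring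

/-- Over a common denominator one sees the sign for `t > 0` and the decay `|t|⁻³` at infinity. The
decay makes `kap` integrable, which neither of its two terms is. -/
theorem kap_eq {ε M : ℝ} (hε : 0 < ε) (hM : 0 < M) (t : ℝ) :
    kap ε M t = t * (M ^ 2 - ε ^ 2) / ((t ^ 2 + ε ^ 2) * (t ^ 2 + M ^ 2)) := by
  have h1 : 0 < t ^ 2 + ε ^ 2 := by positivity
  have h2 : 0 < t ^ 2 + M ^ 2 := by positivity
  rw [kap]; field_simp; ring

theorem kap_nonneg {ε M t : ℝ} (hε : 0 < ε) (hM : ε ≤ M) (ht : 0 ≤ t) : 0 ≤ kap ε M t := by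
  have hM0 : 0 < M := hε.trans_le hM
  rw [kap_eq hε hM0]
  have : 0 ≤ M ^ 2 - ε ^ 2 := by nlinarith
  positivity

theorem kap_le_inv {ε M t : ℝ} (ht : 0 < t) : kap ε M t ≤ t⁻¹ := by
  have h1 : t / (t ^ 2 + ε ^ 2) ≤ t⁻¹ := by
    rw [inv_eq_one_div, div_le_div_iff₀ (by positivity) ht]
    nlinarith [sq_nonneg ε]
  have h2 : 0 ≤ t / (t ^ 2 + M ^ 2) := by positivity
  rw [kap]; linarith

/-- Dilations keep the family of kernels and only change the truncation parameters. This is why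
bounds uniform in both parameters suffice when two dilation averages are composed. -/
theorem kap_scale {ε M t : ℝ} (ht : 0 < t) (s : ℝ) :
    kap ε M (t * s) * t = kap (ε / t) (M / t) s := by
  have h (c : ℝ) : t * s / ((t * s) ^ 2 + c ^ 2) * t = s / (s ^ 2 + (c / t) ^ 2) := by
    have : (t * s) ^ 2 + c ^ 2 = t ^ 2 * (s ^ 2 + (c / t) ^ 2) := by field_simp
    rw [this, pow_two t]
    by_cases h0 : s ^ 2 + (c / t) ^ 2 = 0
    · simp [h0]
    field_simp
  rw [kap, sub_mul, h, h, kap]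

theorem continuous_kap {ε M : ℝ} (hε : 0 < ε) (hM : 0 < M) : Continuous (kap ε M) := by
  unfold kap
  refine (continuous_id.div (by fun_prop) fun t => ?_).sub
    (continuous_id.div (by fun_prop) fun t => ?_)
  · positivity
  · positivity

theorem integrable_kap {ε M : ℝ} (hε : 0 < ε) (hM : 0 < M) : Integrable (kap ε M) := by
  have h : Integrable (fun t : ℝ => |M ^ 2 - ε ^ 2| / (2 * M) * (1 + 1 / ε ^ 2) *
      (1 + t ^ 2)⁻¹) := integrable_inv_one_add_sq.const_mul _
  refine h.mono' (continuous_kap hε hM).aestronglyMeasurable (ae_of_all _ fun t => ?_)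
  rw [kap_eq hε hM, Real.norm_eq_abs, abs_div, abs_mul, abs_of_pos (a := (t ^ 2 + ε ^ 2) * _)
    (by positivity)]
  have h1 : |t| / (t ^ 2 + M ^ 2) ≤ 1 / (2 * M) := by
    rw [div_le_div_iff₀ (by positivity) (by positivity)]
    nlinarith [sq_nonneg (|t| - M), sq_abs t]
  have h2 : 1 / (t ^ 2 + ε ^ 2) ≤ (1 + 1 / ε ^ 2) * (1 + t ^ 2)⁻¹ := by
    rw [← div_eq_mul_inv, div_le_div_iff₀ (by positivity) (by positivity)]
    have : (1 + 1 / ε ^ 2) * (t ^ 2 + ε ^ 2) = 1 + t ^ 2 + ε ^ 2 + t ^ 2 / ε ^ 2 := by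
      field_simp; ring
    rw [this]
    have : 0 ≤ t ^ 2 / ε ^ 2 := by positivity
    nlinarith [sq_nonneg ε]
  calc |t| * |M ^ 2 - ε ^ 2| / ((t ^ 2 + ε ^ 2) * (t ^ 2 + M ^ 2))
      = |M ^ 2 - ε ^ 2| * (|t| / (t ^ 2 + M ^ 2)) * (1 / (t ^ 2 + ε ^ 2)) := by
        field_simp
    _ ≤ |M ^ 2 - ε ^ 2| * (1 / (2 * M)) * ((1 + 1 / ε ^ 2) * (1 + t ^ 2)⁻¹) := by gcongr
    _ = _ := by ring

theorem tendsto_kap {t : ℝ} (ht : 0 < t) :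
    Tendsto (fun N : ℕ => kap (1 / (N + 1)) (N + 1) t) atTop (𝓝 t⁻¹) := by
  have hA : Tendsto (fun N : ℕ => ((N : ℝ) + 1)) atTop atTop :=
    tendsto_atTop_add_const_right _ _ tendsto_natCast_atTop_atTop
  have h1 : Tendsto (fun N : ℕ => t / (t ^ 2 + (1 / ((N : ℝ) + 1)) ^ 2)) atTop
      (𝓝 (t / (t ^ 2 + 0 ^ 2))) := by
    refine Tendsto.div tendsto_const_nhds ?_ (by positivity)
    exact tendsto_const_nhds.add ((tendsto_const_nhds.div_atTop hA).pow 2)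
  have h2 : Tendsto (fun N : ℕ => t / (t ^ 2 + ((N : ℝ) + 1) ^ 2)) atTop (𝓝 0) := by
    refine Tendsto.div_atTop tendsto_const_nhds (tendsto_atTop_add_const_left _ _ ?_)
    exact (tendsto_pow_atTop two_ne_zero).comp hA
  have h3 : t⁻¹ = t / (t ^ 2 + 0 ^ 2) - 0 := by field_simp; ring
  rw [h3]
  exact h1.sub h2

end RoughCommutator

namespace RoughCommutator

/-! ### Conjugate Poisson integrals of nonnegative functions -/

/-- With `α = arg w`, `|α| < π/2`, the real part of `w ^ p` is `|w|^p cos (pα)`. For `|α|` close to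
`π/2` the angle `p|α|` lies between `π/2` and `π`, so this is negative and the second term wins; for
the other `α`, `Re w` is comparable to `|w|` and the first term wins. -/
theorem exists_abs_im_rpow_le {p : ℝ} (hp : 1 < p) (hp2 : p ≤ 2) :
    ∃ A B : ℝ, 0 ≤ A ∧ 0 ≤ B ∧ ∀ w : ℂ, 0 < w.re →
      |w.im| ^ p ≤ A * w.re ^ p - B * (w ^ (p : ℂ)).re := by
  have hp0 : 0 < p := by linarith
  have hπ := Real.pi_pos
  obtain ⟨θ, h1, h2⟩ : ∃ θ, Real.pi / (2 * p) < θ ∧ θ < Real.pi / 2 := by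
    refine exists_between ?_
    rw [div_lt_div_iff₀ (by positivity) (by positivity)]
    nlinarith
  have hθ0 : 0 < θ := lt_trans (by positivity) h1
  have hpθ : Real.pi / 2 < p * θ := by
    have := (div_lt_iff₀ (by positivity)).1 h1
    linarith
  have hpθ' : p * θ ≤ Real.pi := by nlinarith
  have hc : Real.cos (p * θ) < 0 :=
    Real.cos_neg_of_pi_div_two_lt_of_lt hpθ (by linarith)
  have hcθ : 0 < Real.cos θ := Real.cos_pos_of_mem_Ioo ⟨by linarith, h2⟩
  -- `B cos (pθ) = -1` settles arguments beyond `θ`, where `|sin|^p ≤ 1` is all that is needed.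
  -- Below `θ`, `A cos θ ^ p = 1 + B` leaves `1` after the loss of at most `B`.
  set B := -1 / Real.cos (p * θ) with hB
  have hB0 : 0 ≤ B := div_nonneg_of_nonpos (by norm_num) hc.le
  set A := (1 + B) / Real.cos θ ^ p with hA
  have hA0 : 0 ≤ A := by positivity
  refine ⟨A, B, hA0, hB0, fun w hw => ?_⟩
  have hw0 : w ≠ 0 := by rintro rfl; simp at hw
  have hn : 0 < ‖w‖ := norm_pos_iff.2 hw0
  have harg : |w.arg| < Real.pi / 2 := Complex.abs_arg_lt_pi_div_two_iff.2 (Or.inl hw)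
  have hre : (w ^ (p : ℂ)).re = ‖w‖ ^ p * Real.cos (p * |w.arg|) := by
    rw [Complex.cpow_def_of_ne_zero hw0, Complex.exp_re]
    have e1 : (Complex.log w * p).re = Real.log ‖w‖ * p := by simp [Complex.log_re]
    have e2 : (Complex.log w * p).im = w.arg * p := by simp [Complex.log_im]
    rw [e1, e2, Real.rpow_def_of_pos hn, mul_comm w.arg p, ← Real.cos_abs (p * w.arg), abs_mul,
      abs_of_pos hp0]
  have hcos : w.re = ‖w‖ * Real.cos |w.arg| := by
    rw [Real.cos_abs, Complex.norm_mul_cos_arg]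
  have him : |w.im| = ‖w‖ * |Real.sin w.arg| := by
    rw [← Complex.norm_mul_sin_arg w, abs_mul, abs_of_pos hn]
  have hcw : 0 < Real.cos |w.arg| := Real.cos_pos_of_mem_Ioo ⟨by linarith [abs_nonneg w.arg], harg⟩
  rw [hre, hcos, him, Real.mul_rpow hn.le (abs_nonneg _), Real.mul_rpow hn.le hcw.le]
  have key : |Real.sin w.arg| ^ p ≤
      A * Real.cos |w.arg| ^ p - B * Real.cos (p * |w.arg|) := by
    have hs : |Real.sin w.arg| ^ p ≤ 1 :=
      Real.rpow_le_one (abs_nonneg _) (Real.abs_sin_le_one _) hp0.le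
    rcases le_total |w.arg| θ with h | h
    · have hcle : Real.cos θ ≤ Real.cos |w.arg| :=
        Real.cos_le_cos_of_nonneg_of_le_pi (abs_nonneg _) (by linarith) h
      have h3 : 1 + B ≤ A * Real.cos |w.arg| ^ p := by
        rw [hA, div_mul_eq_mul_div, le_div_iff₀ (by positivity)]
        gcongr
      nlinarith [Real.cos_le_one (p * |w.arg|)]
    · have hcle : Real.cos (p * |w.arg|) ≤ Real.cos (p * θ) := by
        apply Real.cos_le_cos_of_nonneg_of_le_pi (by positivity)
        · nlinarith
        · gcongr
      have h3 : 1 ≤ -(B * Real.cos (p * |w.arg|)) := by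
        have : B * Real.cos (p * θ) = -1 := by rw [hB]; field_simp [hc.ne]
        nlinarith
      have : 0 ≤ A * Real.cos |w.arg| ^ p := by positivity
      linarith
  calc ‖w‖ ^ p * |Real.sin w.arg| ^ p
      ≤ ‖w‖ ^ p * (A * Real.cos |w.arg| ^ p - B * Real.cos (p * |w.arg|)) := by gcongr
    _ = _ := by ring

/-- The Cauchy integral of a function on the line. -/
def cauchyInt (f : ℝ → ℝ) (z : ℂ) : ℂ := ∫ t, (f t : ℂ) * (Complex.I / (z - t))

theorem im_le_norm_sub_ofReal (z : ℂ) (t : ℝ) : z.im ≤ ‖z - t‖ := by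
  have := Complex.abs_im_le_norm (z - t)
  simp only [Complex.sub_im, Complex.ofReal_im, sub_zero] at this
  exact (le_abs_self _).trans this

theorem sub_ofReal_ne_zero {z : ℂ} (hz : 0 < z.im) (t : ℝ) : z - t ≠ 0 := by
  rw [← norm_pos_iff]
  exact hz.trans_le (im_le_norm_sub_ofReal z t)

theorem continuous_cauchy_integrand {f : ℝ → ℝ} (hf : Continuous f) {z : ℂ} (hz : 0 < z.im) :
    Continuous fun t : ℝ => (f t : ℂ) * (Complex.I / (z - t)) :=
  (Complex.continuous_ofReal.comp hf).mul
    (continuous_const.div (by fun_prop) fun t => sub_ofReal_ne_zero hz t)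

theorem integrable_cauchy_integrand {f : ℝ → ℝ} (hf : Continuous f) (hs : HasCompactSupport f)
    {z : ℂ} (hz : 0 < z.im) : Integrable fun t : ℝ => (f t : ℂ) * (Complex.I / (z - t)) := by
  refine (continuous_cauchy_integrand hf hz).integrable_of_hasCompactSupport ?_
  exact (hs.comp_left (g := fun x : ℝ => (x : ℂ)) (by simp)).mul_right

theorem differentiableAt_cauchyInt {f : ℝ → ℝ} (hf : Continuous f) (hs : HasCompactSupport f)
    {z : ℂ} (hz : 0 < z.im) : DifferentiableAt ℂ (cauchyInt f) z := by
  have hfi : Integrable f := hf.integrable_of_hasCompactSupport hs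
  have hball : ∀ w ∈ Metric.ball z (z.im / 2), z.im / 2 < w.im := by
    intro w hw
    rw [Metric.mem_ball, dist_eq_norm] at hw
    have := (Complex.abs_im_le_norm (w - z)).trans_lt hw
    rw [Complex.sub_im, abs_lt] at this
    linarith
  refine (hasDerivAt_integral_of_dominated_loc_of_deriv_le
    (F' := fun w t => (f t : ℂ) * (-Complex.I / (w - t) ^ 2))
    (bound := fun t => ‖f t‖ * (1 / (z.im / 2) ^ 2))
    (Metric.ball_mem_nhds z (half_pos hz)) ?_ (integrable_cauchy_integrand hf hs hz) ?_ ?_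
    (hfi.norm.mul_const _) ?_).2.differentiableAt
  · filter_upwards [Metric.ball_mem_nhds z (half_pos hz)] with w hw
    exact (continuous_cauchy_integrand hf ((half_pos hz).trans (hball w hw))).aestronglyMeasurable
  · refine Continuous.aestronglyMeasurable ((Complex.continuous_ofReal.comp hf).mul
      (continuous_const.div (by fun_prop) fun t => ?_))
    exact pow_ne_zero _ (sub_ofReal_ne_zero hz t)
  · refine ae_of_all _ fun t w hw => ?_
    have h1 := (hball w hw).le.trans (im_le_norm_sub_ofReal w t)
    rw [norm_mul, norm_div, norm_neg, Complex.norm_I, norm_pow, Complex.norm_real]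
    gcongr
  · refine ae_of_all _ fun t w hw => ?_
    have h0 := sub_ofReal_ne_zero ((half_pos hz).trans (hball w hw)) t
    have := ((hasDerivAt_const w Complex.I).div ((hasDerivAt_id w).sub_const (t : ℂ)) h0).const_mul
      (f t : ℂ)
    simpa using this

theorem cauchy_kernel_re (z : ℂ) (t : ℝ) :
    (Complex.I / (z - t)).re = z.im / ((z.re - t) ^ 2 + z.im ^ 2) := by
  rw [Complex.div_re]
  simp [Complex.normSq_apply, sq]

theorem cauchy_kernel_im (z : ℂ) (t : ℝ) :
    (Complex.I / (z - t)).im = (z.re - t) / ((z.re - t) ^ 2 + z.im ^ 2) := by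
  rw [Complex.div_im]
  simp [Complex.normSq_apply, sq]

theorem cauchyInt_re {f : ℝ → ℝ} (hf : Continuous f) (hs : HasCompactSupport f)
    {z : ℂ} (hz : 0 < z.im) :
    (cauchyInt f z).re = ∫ t, f t * (z.im / ((z.re - t) ^ 2 + z.im ^ 2)) := by
  rw [cauchyInt, ← RCLike.re_eq_complex_re, ← integral_re (integrable_cauchy_integrand hf hs hz)]
  refine integral_congr_ae (ae_of_all _ fun t => ?_)
  simp only [RCLike.re_eq_complex_re, Complex.re_ofReal_mul, cauchy_kernel_re]

theorem cauchyInt_im {f : ℝ → ℝ} (hf : Continuous f) (hs : HasCompactSupport f)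
    {z : ℂ} (hz : 0 < z.im) :
    (cauchyInt f z).im = ∫ t, f t * ((z.re - t) / ((z.re - t) ^ 2 + z.im ^ 2)) := by
  rw [cauchyInt, ← RCLike.im_eq_complex_im, ← integral_im (integrable_cauchy_integrand hf hs hz)]
  refine integral_congr_ae (ae_of_all _ fun t => ?_)
  simp only [RCLike.im_eq_complex_im, Complex.im_ofReal_mul, cauchy_kernel_im]

/-- The real part is an integral of `f ≥ 0` against a positive multiple of the Poisson kernel. It
keeps `cauchyInt f` in the right half-plane, where `w ↦ w ^ p` is holomorphic. -/
theorem cauchyInt_re_pos {f : ℝ → ℝ} (hf : Continuous f) (hs : HasCompactSupport f)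
    (h0 : ∀ t, 0 ≤ f t) (hne : f ≠ 0) {z : ℂ} (hz : 0 < z.im) : 0 < (cauchyInt f z).re := by
  rw [cauchyInt_re hf hs hz]
  have hk : ∀ t : ℝ, 0 < z.im / ((z.re - t) ^ 2 + z.im ^ 2) := fun t => by positivity
  obtain ⟨t, ht⟩ := Function.ne_iff.1 hne
  refine Continuous.integral_pos_of_hasCompactSupport_nonneg_nonzero (x := t) ?_ hs.mul_right
    (fun t => mul_nonneg (h0 t) (hk t).le) (mul_ne_zero ht (hk t).ne')
  exact hf.mul (continuous_const.div (by fun_prop) fun t => by positivity)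

/-- Far from the support of `f`, `|z - t| ≥ L/2`. The free lower bound `L` lets one estimate serve
on all far sides of a rectangle. -/
theorem exists_norm_cauchyInt_le {f : ℝ → ℝ} (hf : Continuous f) (hs : HasCompactSupport f) :
    ∃ R c : ℝ, 0 < R ∧ 0 ≤ c ∧ ∀ z : ℂ, 0 < z.im → ∀ L, R ≤ L → L ≤ ‖z‖ →
      ‖cauchyInt f z‖ ≤ c / L := by
  obtain ⟨r, hr⟩ := hs.isCompact.isBounded.exists_norm_le
  have hfi : Integrable f := hf.integrable_of_hasCompactSupport hs
  refine ⟨2 * (|r| + 1), 2 * ∫ t, ‖f t‖, by positivity, by positivity, fun z hz L hL hz' => ?_⟩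
  have hL0 : 0 < L := lt_of_lt_of_le (by positivity) hL
  have hb : ∀ t : ℝ, ‖(f t : ℂ) * (Complex.I / (z - t))‖ ≤ ‖f t‖ * (2 / L) := by
    intro t
    by_cases ht : f t = 0
    · simp [ht]
    have ht' := hr t (subset_tsupport f ht)
    have h1 : L / 2 ≤ ‖z - t‖ := by
      have := norm_sub_norm_le z (t : ℂ)
      rw [Complex.norm_real] at this
      linarith [le_abs_self r]
    rw [norm_mul, norm_div, Complex.norm_I, Complex.norm_real]
    have : 1 / ‖z - t‖ ≤ 2 / L := by
      rw [div_le_div_iff₀ (by linarith) hL0]; linarith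
    gcongr
  calc ‖cauchyInt f z‖ ≤ ∫ t, ‖f t‖ * (2 / L) :=
        norm_integral_le_of_norm_le (hfi.norm.mul_const _) (ae_of_all _ hb)
    _ = _ := by rw [integral_mul_const]; ring

/-- Cauchy's theorem for `F ^ p` on the rectangle with corners `-L + iε` and `L + iL`. On the other
three sides, of total length at most `4L`, the integrand is `O(L^(-p))`, so they contribute
`O(L^(1-p))`, and `p > 1`. -/
theorem tendsto_integral_cauchyInt_cpow {f : ℝ → ℝ} (hf : Continuous f) (hs : HasCompactSupport f)
    (h0 : ∀ t, 0 ≤ f t) (hne : f ≠ 0) {p ε : ℝ} (hp : 1 < p) (hε : 0 < ε) :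
    Tendsto (fun L : ℝ => ∫ x in (-L)..L, cauchyInt f (x + ε * Complex.I) ^ (p : ℂ)) atTop
      (𝓝 0) := by
  obtain ⟨R, c, hR, hc, hdec⟩ := exists_norm_cauchyInt_le hf hs
  have hlim : Tendsto (fun L : ℝ => 4 * c ^ p * L ^ (-(p - 1))) atTop (𝓝 0) := by
    simpa using (tendsto_rpow_neg_atTop (y := p - 1) (by linarith)).const_mul (4 * c ^ p)
  refine squeeze_zero_norm' ?_ hlim
  filter_upwards [eventually_ge_atTop R, eventually_ge_atTop ε] with L hL hLε
  have hL0 : 0 < L := hR.trans_le hL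
  set G : ℂ → ℂ := fun z => cauchyInt f z ^ (p : ℂ) with hG
  have hGb : ∀ z : ℂ, 0 < z.im → L ≤ ‖z‖ → ‖G z‖ ≤ (c / L) ^ p := by
    intro z hz hz'
    rw [hG]
    simp only [Complex.norm_cpow_real]
    exact Real.rpow_le_rpow (norm_nonneg _) (hdec z hz L hL hz') (by linarith)
  have hrect := Complex.integral_boundary_rect_eq_zero_of_differentiableOn G
    (⟨-L, ε⟩ : ℂ) (⟨L, L⟩ : ℂ) (by
      intro z hz
      have hzi : 0 < z.im := by
        have h2 := hz.2
        simp only [Set.mem_preimage, Set.uIcc_of_le hLε, Set.mem_Icc] at h2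
        linarith
      exact ((differentiableAt_cauchyInt hf hs hzi).cpow_const
        (Or.inl (cauchyInt_re_pos hf hs h0 hne hzi))).differentiableWithinAt)
  simp only at hrect
  have b1 : ‖∫ x in (-L)..L, G (x + L * Complex.I)‖ ≤ (c / L) ^ p * |L - -L| := by
    refine intervalIntegral.norm_integral_le_of_norm_le_const fun x _ => hGb _ (by simpa) ?_
    have := Complex.abs_im_le_norm ((x : ℂ) + L * Complex.I)
    simp only [Complex.add_im, Complex.ofReal_im, Complex.mul_im, Complex.ofReal_re,
      Complex.I_im, Complex.I_re] at this
    simpa [abs_of_pos hL0] using this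
  have b2 : ∀ s : ℝ, |s| = L →
      ‖∫ y in ε..L, G ((s : ℂ) + y * Complex.I)‖ ≤ (c / L) ^ p * |L - ε| := by
    intro s hs'
    refine intervalIntegral.norm_integral_le_of_norm_le_const fun y hy => hGb _ ?_ ?_
    · rw [Set.uIoc_of_le hLε] at hy
      simpa using hε.trans hy.1
    · have := Complex.abs_re_le_norm ((s : ℂ) + y * Complex.I)
      simp at this
      rwa [hs'] at this
  have e : ∫ x in (-L)..L, G (x + ε * Complex.I) = (∫ x in (-L)..L, G (x + L * Complex.I))
      - Complex.I • (∫ y in ε..L, G ((L : ℂ) + y * Complex.I))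
      + Complex.I • ∫ y in ε..L, G (((-L : ℝ) : ℂ) + y * Complex.I) := by
    linear_combination hrect
  have habs : |L - ε| ≤ L := by rw [abs_of_nonneg (by linarith)]; linarith
  have hcp : 0 ≤ (c / L) ^ p := by positivity
  calc ‖∫ x in (-L)..L, G (x + ε * Complex.I)‖
      ≤ (c / L) ^ p * |L - -L| + (c / L) ^ p * |L - ε| + (c / L) ^ p * |L - ε| := by
        rw [e]
        refine (norm_add_le _ _).trans (add_le_add ((norm_sub_le _ _).trans
          (add_le_add b1 ?_)) ?_)
        · rw [norm_smul, Complex.norm_I, one_mul]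
          exact b2 L (abs_of_pos hL0)
        · rw [norm_smul, Complex.norm_I, one_mul]
          exact b2 (-L) (by rw [abs_neg, abs_of_pos hL0])
    _ ≤ (c / L) ^ p * (4 * L) := by
        rw [show L - -L = 2 * L by ring, abs_of_pos (by linarith : 0 < 2 * L)]
        nlinarith
    _ = 4 * c ^ p * L ^ (-(p - 1)) := by
        rw [Real.div_rpow hc hL0.le, show -(p - 1) = 1 - p by ring, Real.rpow_sub hL0,
          Real.rpow_one]
        ring

end RoughCommutator

/-! ### M. Riesz's inequality for conjugate Poisson integrals. -/

namespace RoughCommutator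

theorem lintegral_poisson {ε : ℝ} (hε : 0 < ε) :
    ∫⁻ t : ℝ, ENNReal.ofReal (ε / (t ^ 2 + ε ^ 2)) = ENNReal.ofReal Real.pi := by
  have h : (fun t : ℝ => ε / (t ^ 2 + ε ^ 2)) = fun t => ε⁻¹ * (1 + (t * ε⁻¹) ^ 2)⁻¹ := by
    ext t; field_simp; ring
  have hi : Integrable fun t : ℝ => ε / (t ^ 2 + ε ^ 2) := by
    rw [h]
    exact ((integrable_inv_one_add_sq).comp_mul_right' (inv_ne_zero hε.ne')).const_mul _
  rw [← ofReal_integral_eq_lintegral_ofReal hi (ae_of_all _ fun t => by positivity), h,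
    integral_const_mul, Measure.integral_comp_mul_right (fun t : ℝ => (1 + t ^ 2)⁻¹),
    integral_univ_inv_one_add_sq]
  simp [abs_of_pos hε]
  field_simp

/-- The kernel of the real part is positive with total mass `π`, so Minkowski's inequality applies.
-/
theorem lintegral_poisson_rpow_le {f : ℝ → ℝ} (hf : Continuous f) (hs : HasCompactSupport f)
    {p ε : ℝ} (hp : 1 ≤ p) (hε : 0 < ε) :
    ∫⁻ x : ℝ, ‖(cauchyInt f (x + ε * Complex.I)).re‖ₑ ^ p ≤
      ENNReal.ofReal Real.pi ^ p * ∫⁻ x, ‖f x‖ₑ ^ p := by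
  have h := lintegral_rpow_lintegral_mul_le (μ := (volume : Measure ℝ))
    (ν := (volume : Measure ℝ)) hp (a := fun t => ENNReal.ofReal (ε / (t ^ 2 + ε ^ 2)))
    (by fun_prop) (G := fun t x => ‖f (x - t)‖ₑ)
    ((hf.measurable.comp (measurable_snd.sub measurable_fst)).enorm)
    (D := ∫⁻ x, ‖f x‖ₑ ^ p)
    (fun t => (lintegral_sub_right_eq_self (fun x => ‖f x‖ₑ ^ p) t).le)
  rw [lintegral_poisson hε] at h
  refine le_trans (lintegral_mono fun x => ?_) h
  gcongr
  rw [cauchyInt_re hf hs (by simpa using hε)]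
  refine (enorm_integral_le_lintegral_enorm _).trans_eq ?_
  rw [← lintegral_sub_left_eq_self _ x]
  refine lintegral_congr fun t => ?_
  rw [enorm_mul, mul_comm]
  congr 1
  simp only [Complex.add_re, Complex.ofReal_re, Complex.mul_re, Complex.I_re, Complex.I_im,
    Complex.ofReal_im, Complex.add_im, Complex.mul_im]
  rw [Real.enorm_eq_ofReal (by positivity)]
  congr 1
  ring

/-- Integrate the inequality of `exists_abs_im_rpow_le` along a horizontal line. The term with `Re
(F ^ p)` disappears in the limit by Cauchy's theorem, and the term with `(Re F)^p` is a Poisson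
integral. The function `f = 0` is set apart because `Re F > 0` fails for it. -/
theorem exists_lintegral_conjPoisson_le {p : ℝ} (hp : 1 < p) (hp2 : p ≤ 2) :
    ∃ C : ℝ≥0∞, C ≠ ⊤ ∧ ∀ ε : ℝ, 0 < ε → ∀ f : ℝ → ℝ, Continuous f → HasCompactSupport f →
      (∀ t, 0 ≤ f t) →
      ∫⁻ x : ℝ, ‖(cauchyInt f (x + ε * Complex.I)).im‖ₑ ^ p ≤ C * ∫⁻ x, ‖f x‖ₑ ^ p := by
  obtain ⟨A, B, hA, hB, hAB⟩ := exists_abs_im_rpow_le hp hp2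
  have hp0 : 0 < p := by linarith
  refine ⟨ENNReal.ofReal A * ENNReal.ofReal Real.pi ^ p,
    ENNReal.mul_ne_top (by simp) (by simp [hp0.le]), fun ε hε f hf hs h0 => ?_⟩
  by_cases hne : f = 0
  · subst hne
    simp [cauchyInt, hp0]
  set F : ℝ → ℂ := fun x => cauchyInt f (x + ε * Complex.I) with hF
  have him : ∀ x : ℝ, 0 < ((x : ℂ) + ε * Complex.I).im := fun x => by simpa using hε
  have hpos : ∀ x, 0 < (F x).re := fun x => cauchyInt_re_pos hf hs h0 hne (him x)
  have hFc : Continuous F := by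
    rw [continuous_iff_continuousAt]
    intro x
    exact (ContinuousAt.comp (f := fun x : ℝ => (x : ℂ) + ε * Complex.I) (g := cauchyInt f)
      (differentiableAt_cauchyInt hf hs (him x)).continuousAt (by fun_prop))
  have hFp : Continuous fun x => F x ^ (p : ℂ) := by
    rw [continuous_iff_continuousAt]
    exact fun x => hFc.continuousAt.cpow continuousAt_const (Or.inl (hpos x))
  have hlim : Tendsto (fun L : ℝ => ENNReal.ofReal A * (∫⁻ x : ℝ, ‖(F x).re‖ₑ ^ p) +
      ENNReal.ofReal (B * ‖∫ x in (-L)..L, F x ^ (p : ℂ)‖)) atTop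
      (𝓝 (ENNReal.ofReal A * (∫⁻ x : ℝ, ‖(F x).re‖ₑ ^ p) + ENNReal.ofReal (B * 0))) := by
    refine tendsto_const_nhds.add (ENNReal.tendsto_ofReal (Tendsto.const_mul _ ?_))
    exact tendsto_zero_iff_norm_tendsto_zero.1
      (tendsto_integral_cauchyInt_cpow hf hs h0 hne hp hε)
  have hcov : Tendsto (fun L : ℝ => ∫⁻ x in Set.Ioc (-L) L, ‖(F x).im‖ₑ ^ p) atTop
      (𝓝 (∫⁻ x : ℝ, ‖(F x).im‖ₑ ^ p)) := by
    refine (aecover_Ioc tendsto_neg_atTop_atBot tendsto_id).lintegral_tendsto_of_countably_generated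
      (μ := volume) ?_
    exact ((Complex.continuous_im.comp hFc).measurable.enorm.pow_const p).aemeasurable
  have hmain : ∫⁻ x : ℝ, ‖(F x).im‖ₑ ^ p ≤ ENNReal.ofReal A * ∫⁻ x : ℝ, ‖(F x).re‖ₑ ^ p := by
    have h1 := le_of_tendsto_of_tendsto hcov hlim ?_
    · simpa using h1
    filter_upwards [eventually_ge_atTop 0] with L hL
    have hLL : -L ≤ L := by linarith
    have cim : Continuous fun x => |(F x).im| ^ p :=
      (Complex.continuous_im.comp hFc).abs.rpow_const fun _ => Or.inr hp0.le
    have cre : Continuous fun x => (F x).re ^ p :=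
      (Complex.continuous_re.comp hFc).rpow_const fun _ => Or.inr hp0.le
    have e1 : ∫⁻ x in Set.Ioc (-L) L, ‖(F x).im‖ₑ ^ p =
        ENNReal.ofReal (∫ x in (-L)..L, |(F x).im| ^ p) := by
      rw [intervalIntegral.integral_of_le hLL, ofReal_integral_eq_lintegral_ofReal
        ((cim.intervalIntegrable _ _).1) (ae_of_all _ fun x => by positivity)]
      refine lintegral_congr fun x => ?_
      rw [← ENNReal.ofReal_rpow_of_nonneg (abs_nonneg _) hp0.le, ← Real.norm_eq_abs,
        ofReal_norm]
    have e2 : ENNReal.ofReal (∫ x in (-L)..L, (F x).re ^ p) ≤ ∫⁻ x : ℝ, ‖(F x).re‖ₑ ^ p := by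
      rw [intervalIntegral.integral_of_le hLL, ofReal_integral_eq_lintegral_ofReal
        ((cre.intervalIntegrable _ _).1)
        (ae_of_all _ fun x => Real.rpow_nonneg (hpos x).le p)]
      refine (setLIntegral_le_lintegral _ _).trans_eq (lintegral_congr fun x => ?_)
      rw [← ENNReal.ofReal_rpow_of_nonneg (hpos x).le hp0.le, Real.enorm_eq_ofReal (hpos x).le]
    have e3 : (∫ x in (-L)..L, |(F x).im| ^ p) ≤
        A * (∫ x in (-L)..L, (F x).re ^ p) + B * ‖∫ x in (-L)..L, F x ^ (p : ℂ)‖ := by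
      have c3 : Continuous fun x => (F x ^ (p : ℂ)).re := Complex.continuous_re.comp hFp
      have cA : Continuous fun x => A * (F x).re ^ p := continuous_const.mul cre
      have cB : Continuous fun x => B * (F x ^ (p : ℂ)).re := continuous_const.mul c3
      have h2 : (∫ x in (-L)..L, |(F x).im| ^ p) ≤
          ∫ x in (-L)..L, (A * (F x).re ^ p - B * (F x ^ (p : ℂ)).re) := by
        refine intervalIntegral.integral_mono_on hLL (cim.intervalIntegrable _ _)
          ((cA.sub cB).intervalIntegrable _ _) ?_
        exact fun x _ => hAB _ (hpos x)
      rw [intervalIntegral.integral_sub (cA.intervalIntegrable _ _) (cB.intervalIntegrable _ _),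
        intervalIntegral.integral_const_mul, intervalIntegral.integral_const_mul] at h2
      have h3 : (∫ x in (-L)..L, (F x ^ (p : ℂ)).re) = (∫ x in (-L)..L, F x ^ (p : ℂ)).re := by
        simpa using Complex.reCLM.intervalIntegral_comp_comm
          (hFp.intervalIntegrable (μ := volume) (-L) L)
      rw [h3] at h2
      have h4 := (abs_le.1 (Complex.abs_re_le_norm (∫ x in (-L)..L, F x ^ (p : ℂ)))).1
      nlinarith
    rw [e1]
    calc ENNReal.ofReal (∫ x in (-L)..L, |(F x).im| ^ p)
        ≤ ENNReal.ofReal (A * (∫ x in (-L)..L, (F x).re ^ p) +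
            B * ‖∫ x in (-L)..L, F x ^ (p : ℂ)‖) := ENNReal.ofReal_le_ofReal e3
      _ ≤ ENNReal.ofReal (A * (∫ x in (-L)..L, (F x).re ^ p)) +
            ENNReal.ofReal (B * ‖∫ x in (-L)..L, F x ^ (p : ℂ)‖) := ENNReal.ofReal_add_le
      _ ≤ _ := by
        rw [ENNReal.ofReal_mul hA]
        gcongr
  calc _ ≤ _ := hmain
    _ ≤ ENNReal.ofReal A * (ENNReal.ofReal Real.pi ^ p * ∫⁻ x, ‖f x‖ₑ ^ p) := by
      gcongr
      exact lintegral_poisson_rpow_le hf hs hp.le hε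
    _ = _ := by rw [mul_assoc]

/-! ### Truncated Hilbert transforms -/

/-- Convolution with the truncated Hilbert kernel. -/
def hilb (ε M : ℝ) (f : ℝ → ℂ) (x : ℝ) : ℂ := ∫ t, (kap ε M t : ℂ) * f (x - t)

theorem integrable_kap_ofReal {ε M : ℝ} (hε : 0 < ε) (hM : 0 < M) :
    Integrable fun t => (kap ε M t : ℂ) := (integrable_kap hε hM).ofReal

theorem measurable_kap_ofReal {ε M : ℝ} : Measurable fun t => (kap ε M t : ℂ) := by
  unfold kap; fun_prop

theorem measurable_hilb {ε M : ℝ} {f : ℝ → ℂ} (hf : Measurable f) : Measurable (hilb ε M f) :=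
  measurable_integral_shift measurable_kap_ofReal measurable_id hf

theorem hilb_add {ε M : ℝ} (hε : 0 < ε) (hM : 0 < M) {f g : ℝ → ℂ} (hf : Measurable f)
    (hg : Measurable g) {A B : ℝ} (hA : ∀ x, ‖f x‖ ≤ A) (hB : ∀ x, ‖g x‖ ≤ B) :
    hilb ε M (f + g) = hilb ε M f + hilb ε M g := by
  ext x
  simp only [hilb, Pi.add_apply, mul_add]
  exact integral_add (integrable_mul_shift (integrable_kap_ofReal hε hM) measurable_id hf hA x)
    (integrable_mul_shift (integrable_kap_ofReal hε hM) measurable_id hg hB x)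

theorem hilb_const_mul {ε M : ℝ} (c : ℂ) (f : ℝ → ℂ) :
    hilb ε M (fun x => c * f x) = fun x => c * hilb ε M f x := by
  ext x
  simp only [hilb]
  rw [← integral_const_mul]
  congr 1
  ext t
  ring

/-- This identity motivates the choice of `kap`: both truncations of `1/t` are conjugate Poisson
integrals, so bounds uniform in `ε` and `M` come at once and no maximal function is needed. -/
theorem hilb_ofReal_eq {ε M : ℝ} (hε : 0 < ε) (hM : 0 < M) {f : ℝ → ℝ} (hf : Continuous f)
    (hs : HasCompactSupport f) (x : ℝ) :
    hilb ε M (fun t => (f t : ℂ)) x =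
      (((cauchyInt f (x + ε * Complex.I)).im - (cauchyInt f (x + M * Complex.I)).im : ℝ) : ℂ) := by
  have key : ∀ c : ℝ, 0 < c →
      Integrable fun t => f t * ((x - t) / ((x - t) ^ 2 + c ^ 2)) := by
    intro c hc
    refine Continuous.integrable_of_hasCompactSupport ?_ hs.mul_right
    exact hf.mul (Continuous.div (by fun_prop) (by fun_prop) fun t => by positivity)
  rw [cauchyInt_im hf hs (by simpa using hε), cauchyInt_im hf hs (by simpa using hM)]
  simp only [Complex.add_re, Complex.ofReal_re, Complex.mul_re, Complex.I_re, Complex.I_im,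
    Complex.ofReal_im, Complex.add_im, Complex.mul_im, mul_zero, mul_one, sub_zero, add_zero,
    zero_add]
  rw [← integral_sub (key ε hε) (key M hM), hilb, ← integral_sub_left_eq_self _ _ x,
    ← integral_complex_ofReal]
  congr 1
  ext t
  simp only [kap, sub_sub_cancel]
  push_cast
  ring

theorem exists_eLpNorm_hilb_ofReal_le {p : ℝ≥0∞} (hp : 1 < p) (hp2 : p ≤ 2) :
    ∃ C : ℝ≥0∞, C ≠ ⊤ ∧ ∀ ε M : ℝ, 0 < ε → 0 < M → ∀ f : ℝ → ℝ, Continuous f →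
      HasCompactSupport f → (∀ t, 0 ≤ f t) →
      eLpNorm (hilb ε M fun t => (f t : ℂ)) p volume ≤ C * eLpNorm f p volume := by
  have hpt : p ≠ ⊤ := (hp2.trans_lt (by simp)).ne
  have hp0 : p ≠ 0 := (zero_lt_one.trans hp).ne'
  have hpr : 1 < p.toReal := by
    rw [← ENNReal.toReal_one]; exact (ENNReal.toReal_lt_toReal (by simp) hpt).2 hp
  have hpr2 : p.toReal ≤ 2 := by
    have := (ENNReal.toReal_le_toReal hpt (by simp)).2 hp2
    simpa using this
  have hpr0 : 0 < p.toReal := by linarith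
  obtain ⟨C, hC, hb⟩ := exists_lintegral_conjPoisson_le hpr hpr2
  have hb' : ∀ ε : ℝ, 0 < ε → ∀ f : ℝ → ℝ, Continuous f → HasCompactSupport f →
      (∀ t, 0 ≤ f t) → eLpNorm (fun x : ℝ => (cauchyInt f (x + ε * Complex.I)).im) p volume ≤
        C ^ (1 / p.toReal) * eLpNorm f p volume := by
    intro ε hε f hf hs h0
    rw [eLpNorm_eq_lintegral_rpow_enorm_toReal hp0 hpt, eLpNorm_eq_lintegral_rpow_enorm_toReal
      hp0 hpt, ← ENNReal.mul_rpow_of_nonneg _ _ (by positivity)]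
    gcongr
    exact hb ε hε f hf hs h0
  refine ⟨C ^ (1 / p.toReal) + C ^ (1 / p.toReal), by simp [hC, hpr0.le], ?_⟩
  intro ε M hε hM f hf hs h0
  have hmeas : ∀ c : ℝ, 0 < c → AEStronglyMeasurable
      (fun x : ℝ => (cauchyInt f (x + c * Complex.I)).im) volume := by
    intro c hc
    refine Continuous.aestronglyMeasurable (Complex.continuous_im.comp ?_)
    rw [continuous_iff_continuousAt]
    intro x
    exact (ContinuousAt.comp (f := fun x : ℝ => (x : ℂ) + c * Complex.I) (g := cauchyInt f)
      (differentiableAt_cauchyInt hf hs (by simpa using hc)).continuousAt (by fun_prop))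
  calc eLpNorm (hilb ε M fun t => (f t : ℂ)) p volume
      = eLpNorm ((fun x : ℝ => (cauchyInt f (x + ε * Complex.I)).im) -
          fun x : ℝ => (cauchyInt f (x + M * Complex.I)).im) p volume := by
        refine eLpNorm_congr_norm_ae (ae_of_all _ fun x => ?_)
        rw [hilb_ofReal_eq hε hM hf hs, Complex.norm_real]
        rfl
    _ ≤ _ := eLpNorm_sub_le (hmeas ε hε) (hmeas M hM) hp.le
    _ ≤ _ := by
        rw [add_mul]
        exact add_le_add (hb' ε hε f hf hs h0) (hb' M hM f hf hs h0)

end RoughCommutator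

/-! ### Uniform bounds for truncated Hilbert transforms: positive and negative parts, density,
duality. -/

namespace RoughCommutator

/-- `C` bounds all truncated Hilbert transforms on `L^p`. -/
def HilbBound (p C : ℝ≥0∞) : Prop :=
  ∀ ε M : ℝ, 0 < ε → 0 < M → ∀ f : ℝ → ℂ, Measurable f → (∃ B, ∀ x, ‖f x‖ ≤ B) →
    eLpNorm (hilb ε M f) p volume ≤ C * eLpNorm f p volume

theorem exists_eLpNorm_hilb_real_le {p : ℝ≥0∞} (hp : 1 < p) (hp2 : p ≤ 2) :
    ∃ C : ℝ≥0∞, C ≠ ⊤ ∧ ∀ ε M : ℝ, 0 < ε → 0 < M → ∀ f : ℝ → ℝ, Continuous f →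
      HasCompactSupport f →
      eLpNorm (hilb ε M fun t => (f t : ℂ)) p volume ≤ C * eLpNorm f p volume := by
  obtain ⟨C, hC, hb⟩ := exists_eLpNorm_hilb_ofReal_le hp hp2
  refine ⟨C + C, by simp [hC], fun ε M hε hM f hf hs => ?_⟩
  have hpos : ∀ g : ℝ → ℝ, Continuous g → HasCompactSupport g →
      eLpNorm (hilb ε M fun t => ((max (g t) 0 : ℝ) : ℂ)) p volume ≤ C * eLpNorm g p volume := by
    intro g hg hgs
    refine (hb ε M hε hM (fun t => max (g t) 0) (hg.max continuous_const)
      (hgs.comp_left (g := fun x : ℝ => max x 0) (by simp)) fun t => le_max_right _ _).trans ?_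
    gcongr
    refine eLpNorm_mono fun x => ?_
    rw [Real.norm_eq_abs, Real.norm_eq_abs, abs_of_nonneg (le_max_right _ _)]
    exact max_le (le_abs_self _) (abs_nonneg _)
  obtain ⟨B, hB⟩ := hs.exists_bound_of_continuous hf
  have hbd : ∀ g : ℝ → ℝ, (∀ x, ‖g x‖ ≤ B) → ∀ x, ‖((max (g x) 0 : ℝ) : ℂ)‖ ≤ B := by
    intro g hg x
    rw [Complex.norm_real, Real.norm_eq_abs, abs_of_nonneg (le_max_right _ _)]
    exact max_le ((le_abs_self _).trans (hg x)) ((norm_nonneg _).trans (hg x))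
  have hm : ∀ g : ℝ → ℝ, Continuous g → Measurable fun t => ((max (g t) 0 : ℝ) : ℂ) :=
    fun g hg => (Complex.continuous_ofReal.comp (hg.max continuous_const)).measurable
  have e : (fun t => (f t : ℂ)) = (fun t => ((max (f t) 0 : ℝ) : ℂ)) +
      fun t => (-1 : ℂ) * ((max (-f t) 0 : ℝ) : ℂ) := by
    ext t
    have h := max_zero_sub_max_neg_zero_eq_self (f t)
    simp only [Pi.add_apply]
    rw [neg_one_mul, ← sub_eq_add_neg, ← Complex.ofReal_sub, h]
  have hm2 : Measurable fun t => (-1 : ℂ) * ((max (-f t) 0 : ℝ) : ℂ) :=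
    (hm _ hf.neg).const_mul _
  rw [e, hilb_add hε hM (hm f hf) hm2 (hbd f hB) (B := B) (fun x => by
    rw [norm_mul, norm_neg, norm_one, one_mul]; exact hbd (fun x => -f x) (by simpa using hB) x),
    add_mul]
  refine (eLpNorm_add_le (measurable_hilb (hm f hf)).aestronglyMeasurable
    (measurable_hilb hm2).aestronglyMeasurable hp.le).trans (add_le_add (hpos f hf hs) ?_)
  rw [hilb_const_mul]
  calc eLpNorm (fun x => -1 * hilb ε M (fun t => ((max (-f t) 0 : ℝ) : ℂ)) x) p volume
      = eLpNorm (hilb ε M (fun t => ((max (-f t) 0 : ℝ) : ℂ))) p volume :=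
        eLpNorm_congr_norm_ae (ae_of_all _ fun x => by simp)
    _ ≤ C * eLpNorm (fun t => -f t) p volume := hpos _ hf.neg hs.neg
    _ = C * eLpNorm f p volume := by
        congr 1
        exact eLpNorm_congr_norm_ae (ae_of_all _ fun x => by simp)

theorem exists_eLpNorm_hilb_le {p : ℝ≥0∞} (hp : 1 < p) (hp2 : p ≤ 2) :
    ∃ C : ℝ≥0∞, C ≠ ⊤ ∧ ∀ ε M : ℝ, 0 < ε → 0 < M → ∀ f : ℝ → ℂ, Continuous f →
      HasCompactSupport f → eLpNorm (hilb ε M f) p volume ≤ C * eLpNorm f p volume := by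
  obtain ⟨C, hC, hb⟩ := exists_eLpNorm_hilb_real_le hp hp2
  refine ⟨C + C, by simp [hC], fun ε M hε hM f hf hs => ?_⟩
  obtain ⟨B, hB⟩ := hs.exists_bound_of_continuous hf
  have cre : Continuous fun t => (f t).re := Complex.continuous_re.comp hf
  have cim : Continuous fun t => (f t).im := Complex.continuous_im.comp hf
  have e : f = (fun t => ((f t).re : ℂ)) + fun t => Complex.I * ((f t).im : ℂ) := by
    ext t
    simp only [Pi.add_apply]
    rw [mul_comm, Complex.re_add_im]
  have m1 : Measurable fun t => ((f t).re : ℂ) :=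
    (Complex.continuous_ofReal.comp cre).measurable
  have m2 : Measurable fun t => Complex.I * ((f t).im : ℂ) :=
    (Complex.continuous_ofReal.comp cim).measurable.const_mul _
  have key : hilb ε M f = hilb ε M (fun t => ((f t).re : ℂ)) +
      hilb ε M (fun t => Complex.I * ((f t).im : ℂ)) := by
    conv_lhs => rw [e]
    refine hilb_add hε hM m1 m2 (A := B) (B := B) (fun x => ?_) (fun x => ?_)
    · rw [Complex.norm_real]; exact (Complex.abs_re_le_norm _).trans (hB x)
    · rw [norm_mul, Complex.norm_I, one_mul, Complex.norm_real]
      exact (Complex.abs_im_le_norm _).trans (hB x)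
  rw [key, add_mul]
  refine (eLpNorm_add_le (measurable_hilb m1).aestronglyMeasurable
    (measurable_hilb m2).aestronglyMeasurable hp.le).trans (add_le_add ?_ ?_)
  · refine (hb ε M hε hM _ cre (hs.comp_left (g := Complex.re) (by simp))).trans ?_
    gcongr
    exact eLpNorm_mono fun x => Complex.abs_re_le_norm _
  · rw [hilb_const_mul]
    calc eLpNorm (fun x => Complex.I * hilb ε M (fun t => ((f t).im : ℂ)) x) p volume
        = eLpNorm (hilb ε M (fun t => ((f t).im : ℂ))) p volume :=
          eLpNorm_congr_norm_ae (ae_of_all _ fun x => by simp)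
      _ ≤ _ := hb ε M hε hM _ cim (hs.comp_left (g := Complex.im) (by simp))
      _ ≤ _ := by
        gcongr
        exact eLpNorm_mono fun x => Complex.abs_im_le_norm _

/-- The mass `K` of the truncated kernel bounds the operator for fixed `ε` and `M`. It depends on
them, but enters only in the choice of the approximation error `δ / (C + K)`. The condition `C ≠ 0`
makes the claim true when the norm of `f` is infinite. -/
theorem hilbBound_of_continuous {p C : ℝ≥0∞} (hp : 1 ≤ p) (hpt : p ≠ ⊤) (hC : C ≠ ⊤) (hC0 : C ≠ 0)
    (hb : ∀ ε M : ℝ, 0 < ε → 0 < M → ∀ f : ℝ → ℂ, Continuous f →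
      HasCompactSupport f → eLpNorm (hilb ε M f) p volume ≤ C * eLpNorm f p volume) :
    HilbBound p C := by
  rintro ε M hε hM f hf ⟨B, hB⟩
  by_cases hfp : eLpNorm f p volume = ⊤
  · simp [hfp, ENNReal.mul_top hC0]
  have hmem : MemLp f p volume := ⟨hf.aestronglyMeasurable, lt_top_iff_ne_top.2 hfp⟩
  set K : ℝ≥0∞ := ∫⁻ t, ‖(kap ε M t : ℂ)‖ₑ with hK
  have hKt : K ≠ ⊤ := (integrable_kap_ofReal hε hM).2.ne
  refine ENNReal.le_of_forall_pos_le_add fun δ hδ _ => ?_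
  obtain ⟨g, hgs, hg1, hgc, -⟩ := hmem.exists_hasCompactSupport_eLpNorm_sub_le hpt
    (ε := δ / (C + K)) (by simp [hδ.ne', hC, hKt])
  obtain ⟨B', hB'⟩ := hgs.exists_bound_of_continuous hgc
  have hfg : Measurable (f - g) := hf.sub hgc.measurable
  have e : hilb ε M f = hilb ε M g + hilb ε M (f - g) := by
    rw [← hilb_add hε hM hgc.measurable hfg hB' (B := B + B') fun x =>
      (norm_sub_le _ _).trans (add_le_add (hB x) (hB' x))]
    congr 1
    ext x; simp
  have h1 : eLpNorm g p volume ≤ eLpNorm f p volume + δ / (C + K) := by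
    have : g = f - (f - g) := by ext x; simp
    rw [this]
    exact (eLpNorm_sub_le hf.aestronglyMeasurable hfg.aestronglyMeasurable hp).trans
      (by gcongr)
  calc eLpNorm (hilb ε M f) p volume
      ≤ eLpNorm (hilb ε M g) p volume + eLpNorm (hilb ε M (f - g)) p volume := by
        rw [e]
        exact eLpNorm_add_le (measurable_hilb hgc.measurable).aestronglyMeasurable
          (measurable_hilb hfg).aestronglyMeasurable hp
    _ ≤ C * (eLpNorm f p volume + δ / (C + K)) + K * (δ / (C + K)) := by
        refine add_le_add ((hb ε M hε hM g hgc hgs).trans (by gcongr)) ?_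
        refine (eLpNorm_integral_shift_le hp hpt measurable_kap_ofReal measurable_id hfg).trans ?_
        gcongr
    _ = C * eLpNorm f p volume + (C + K) * (δ / (C + K)) := by ring
    _ = C * eLpNorm f p volume + δ := by
        rw [ENNReal.mul_div_cancel (by simp [hC0]) (by simp [hC, hKt])]

/-- Since `kap` is odd, the transposed operator is the negative of the operator. -/
theorem integral_hilb_mul {ε M : ℝ} (hε : 0 < ε) (hM : 0 < M) {f φ : ℝ → ℂ} (hf : Integrable f)
    (hφ : Measurable φ) {B : ℝ} (hB : ∀ x, ‖φ x‖ ≤ B) :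
    ∫ x, hilb ε M f x * φ x = -∫ y, f y * hilb ε M φ y := by
  have hk := integrable_kap_ofReal hε hM
  have hint : Integrable (fun z : ℝ × ℝ => (kap ε M (z.1 - z.2) : ℂ) * f z.2 * φ z.1)
      (volume.prod volume) := by
    have h1 := hf.convolution_integrand (ContinuousLinearMap.mul ℂ ℂ) hk
    have h2 : Integrable (fun z : ℝ × ℝ => (kap ε M (z.1 - z.2) : ℂ) * f z.2)
        (volume.prod volume) := by
      refine h1.congr (ae_of_all _ fun z => ?_)
      simp [mul_comm]
    exact h2.mul_bdd (hφ.comp measurable_fst).aestronglyMeasurable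
      (ae_of_all _ fun z => hB z.1)
  have e1 : ∀ x, hilb ε M f x * φ x = ∫ y, (kap ε M (x - y) : ℂ) * f y * φ x := by
    intro x
    rw [hilb, ← integral_mul_const, ← integral_sub_left_eq_self _ _ x]
    simp
  have e2 : ∀ y, ∫ x, (kap ε M (x - y) : ℂ) * f y * φ x = -(f y * hilb ε M φ y) := by
    intro y
    rw [hilb, ← integral_const_mul, ← integral_neg, ← integral_sub_left_eq_self _ _ y]
    congr 1
    ext x
    rw [show y - x - y = -x by ring, kap_neg]
    push_cast
    ring
  simp_rw [e1]
  rw [integral_integral_swap hint, ← integral_neg]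
  simp_rw [e2]

/-- Duality, tested on the extremal function `φ = conj g * |g|^(P-2)` with `g = hilb ε M f`, so that
`g φ = |g|^P` and `|φ|^Q = |g|^P`. Integrability of the truncated kernel makes `g` bounded and its
norm finite beforehand; the first fact allows the hypothesis to be used for `φ`, the second allows
division by `X ^ (1/Q)`. -/
theorem eLpNorm_hilb_le_of_conj {p q C : ℝ≥0∞} (hp : 1 < p) (hpt : p ≠ ⊤)
    (hpq : p.HolderConjugate q) (hq : HilbBound q C) {ε M : ℝ} (hε : 0 < ε) (hM : 0 < M)
    {f : ℝ → ℂ} (hf : Continuous f) (hs : HasCompactSupport f) :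
    eLpNorm (hilb ε M f) p volume ≤ C * eLpNorm f p volume := by
  have hp0 : p ≠ 0 := (zero_lt_one.trans hp).ne'
  have hpr : 1 < p.toReal := by
    rw [← ENNReal.toReal_one]; exact (ENNReal.toReal_lt_toReal (by simp) hpt).2 hp
  have hqt : q ≠ ⊤ := (ENNReal.HolderConjugate.lt_top_iff_one_lt q p).2 hp |>.ne
  have hpqr : p.toReal.HolderConjugate q.toReal := ENNReal.HolderConjugate.toReal hpr
  have hq0 : q ≠ 0 := by
    intro h
    have := hpqr.symm.pos
    simp [h] at this
  set P := p.toReal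
  set Q := q.toReal
  have hP0 : 0 < P := by linarith
  have hQ0 : 0 < Q := hpqr.symm.pos
  set g := hilb ε M f with hg
  have hgm : Measurable g := measurable_hilb hf.measurable
  obtain ⟨B, hB⟩ := hs.exists_bound_of_continuous hf
  have hgb : ∀ x, ‖g x‖ ≤ (∫ s, ‖(kap ε M s : ℂ)‖) * B := fun x =>
    norm_integral_shift_le (integrable_kap_ofReal hε hM) hB x
  have hfm : MemLp f p volume := hf.memLp_of_hasCompactSupport hs
  have hgfin : eLpNorm g p volume < ⊤ :=
    (eLpNorm_integral_shift_le hp.le hpt measurable_kap_ofReal measurable_id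
      hf.measurable).trans_lt (ENNReal.mul_lt_top (integrable_kap_ofReal hε hM).2 hfm.2)
  have hgmem : MemLp g p volume := ⟨hgm.aestronglyMeasurable, hgfin⟩
  set X : ℝ≥0∞ := ∫⁻ x, ‖g x‖ₑ ^ P with hX
  have hXg : eLpNorm g p volume = X ^ (1 / P) := eLpNorm_eq_lintegral_rpow_enorm_toReal hp0 hpt
  have hXt : X ≠ ⊤ := by
    intro h
    rw [hXg, h, ENNReal.top_rpow_of_pos (by positivity)] at hgfin
    exact lt_irrefl _ hgfin
  by_cases hX0 : X = 0
  · rw [hXg, hX0, ENNReal.zero_rpow_of_pos (by positivity)]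
    exact zero_le
  set φ : ℝ → ℂ := fun x => (starRingEnd ℂ) (g x) * ((‖g x‖ ^ (P - 2) : ℝ) : ℂ) with hφ
  have hφm : Measurable φ :=
    (Complex.continuous_conj.measurable.comp hgm).mul
      (Complex.measurable_ofReal.comp (hgm.norm.pow_const _))
  have hφn : ∀ x, ‖φ x‖ = ‖g x‖ ^ (P - 1) := by
    intro x
    rw [hφ]
    simp only [norm_mul, RCLike.norm_conj, Complex.norm_real, Real.norm_eq_abs]
    rw [abs_of_nonneg (by positivity)]
    by_cases h0 : ‖g x‖ = 0
    · rw [h0, zero_mul, Real.zero_rpow (by linarith)]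
    · rw [← Real.rpow_one_add' (norm_nonneg _) (by linarith)]
      ring_nf
  have hφb : ∀ x, ‖φ x‖ ≤ ((∫ s, ‖(kap ε M s : ℂ)‖) * B) ^ (P - 1) := by
    intro x
    rw [hφn]
    exact Real.rpow_le_rpow (norm_nonneg _) (hgb x) (by linarith)
  have hgφ : ∀ x, g x * φ x = ((‖g x‖ ^ P : ℝ) : ℂ) := by
    intro x
    rw [hφ]
    simp only
    rw [← mul_assoc, Complex.mul_conj, ← Complex.ofReal_mul, Complex.normSq_eq_norm_sq]
    congr 1
    by_cases h0 : ‖g x‖ = 0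
    · rw [h0, Real.zero_rpow (x := P) (by linarith)]; simp
    · rw [← Real.rpow_natCast, ← Real.rpow_add (lt_of_le_of_ne (norm_nonneg _) (Ne.symm h0))]
      norm_num
  have hgint : Integrable (fun x => ‖g x‖ ^ P) := hgmem.integrable_norm_rpow hp0 hpt
  have hXeq : ‖∫ x, g x * φ x‖ₑ = X := by
    simp_rw [hgφ]
    rw [integral_complex_ofReal, ← ofReal_norm, Complex.norm_real, Real.norm_eq_abs,
      abs_of_nonneg (integral_nonneg fun x => by positivity),
      ofReal_integral_eq_lintegral_ofReal hgint (ae_of_all _ fun x => by positivity)]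
    refine lintegral_congr fun x => ?_
    rw [← ENNReal.ofReal_rpow_of_nonneg (norm_nonneg _) hP0.le, ofReal_norm]
  have hφq : eLpNorm φ q volume = X ^ (1 / Q) := by
    rw [eLpNorm_eq_lintegral_rpow_enorm_toReal hq0 hqt]
    congr 1
    refine lintegral_congr fun x => ?_
    rw [← ofReal_norm, hφn, ← ofReal_norm,
      ← ENNReal.ofReal_rpow_of_nonneg (norm_nonneg _) (by linarith), ← ENNReal.rpow_mul]
    congr 1
    have := hpqr.inv_add_inv_eq_one
    change (P - 1) * Q = P
    field_simp at this
    linarith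
  have hle : X ≤ eLpNorm f p volume * (C * X ^ (1 / Q)) := by
    calc X = ‖∫ y, f y * hilb ε M φ y‖ₑ := by
          rw [← hXeq, integral_hilb_mul hε hM
            (hf.integrable_of_hasCompactSupport hs) hφm hφb, enorm_neg]
      _ ≤ ∫⁻ y, ‖f y‖ₑ * ‖hilb ε M φ y‖ₑ := by
          refine (enorm_integral_le_lintegral_enorm _).trans_eq ?_
          simp [enorm_mul]
      _ ≤ (∫⁻ y, ‖f y‖ₑ ^ P) ^ (1 / P) * (∫⁻ y, ‖hilb ε M φ y‖ₑ ^ Q) ^ (1 / Q) :=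
          ENNReal.lintegral_mul_le_Lp_mul_Lq volume hpqr hf.measurable.enorm.aemeasurable
            (measurable_hilb hφm).enorm.aemeasurable
      _ ≤ _ := by
          rw [← eLpNorm_eq_lintegral_rpow_enorm_toReal hp0 hpt,
            ← eLpNorm_eq_lintegral_rpow_enorm_toReal hq0 hqt, ← hφq]
          gcongr
          exact hq ε M hε hM φ hφm ⟨_, hφb⟩
  have hsplit : X = X ^ (1 / P) * X ^ (1 / Q) := by
    rw [← ENNReal.rpow_add_of_nonneg _ _ (by positivity) (by positivity)]
    have : 1 / P + 1 / Q = 1 := by simpa using hpqr.inv_add_inv_eq_one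
    rw [this, ENNReal.rpow_one]
  have hQne : X ^ (1 / Q) ≠ 0 := by simp [hX0, hXt]
  have hQnt : X ^ (1 / Q) ≠ ⊤ := by simp [hX0, hXt]
  rw [hXg, ← ENNReal.mul_le_mul_iff_left hQne hQnt, ← hsplit]
  exact hle.trans_eq (by ring)

/-- Truncated Hilbert transforms are uniformly bounded on `L^p`. -/
theorem exists_hilbBound {p : ℝ≥0∞} (hp : 1 < p) (hpt : p ≠ ⊤) :
    ∃ C : ℝ≥0∞, C ≠ ⊤ ∧ HilbBound p C := by
  have small : ∀ q : ℝ≥0∞, 1 < q → q ≤ 2 → ∃ C : ℝ≥0∞, C ≠ ⊤ ∧ C ≠ 0 ∧ HilbBound q C := by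
    intro q hq hq2
    obtain ⟨C, hC, hb⟩ := exists_eLpNorm_hilb_le hq hq2
    -- The constant is enlarged by one because the density argument needs it nonzero.
    refine ⟨C + 1, by simp [hC], by simp, hilbBound_of_continuous hq.le
      (hq2.trans_lt (by simp)).ne (by simp [hC]) (by simp) fun ε M hε hM f hf hs => ?_⟩
    refine (hb ε M hε hM f hf hs).trans ?_
    gcongr
    exact le_self_add
  rcases le_total p 2 with h | h
  · obtain ⟨C, hC, -, hb⟩ := small p hp h
    exact ⟨C, hC, hb⟩
  · have : Fact (1 ≤ p) := ⟨hp.le⟩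
    set q := p.conjExponent with hqdef
    have hpq : p.HolderConjugate q := ENNReal.HolderConjugate.conjExponent hp.le
    have hq1 : 1 < q := (ENNReal.HolderConjugate.lt_top_iff_one_lt p q).1 (lt_top_iff_ne_top.2 hpt)
    have hq2 : q ≤ 2 := by
      have hqt : q ≠ ⊤ := ((ENNReal.HolderConjugate.lt_top_iff_one_lt q p).2 hp).ne
      have h2 : (2 : ℝ) ≤ p.toReal := by
        simpa using (ENNReal.toReal_le_toReal (by simp) hpt).2 h
      have hr : p.toReal.HolderConjugate q.toReal :=
        ENNReal.HolderConjugate.toReal (by linarith)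
      rw [← ENNReal.toReal_le_toReal hqt (by simp)]
      have h3 := hr.sub_one_mul_conj
      have h4 := hr.symm.pos
      simp only [ENNReal.toReal_ofNat]
      nlinarith
    obtain ⟨C, hC, hC0, hb⟩ := small q hq1 hq2
    exact ⟨C, hC, hilbBound_of_continuous hp.le hpt hC hC0
      fun ε M hε hM f hf hs => eLpNorm_hilb_le_of_conj hp hpt hpq hb hε hM hf hs⟩

end RoughCommutator

namespace RoughCommutator

variable {E : Type*} [NormedAddCommGroup E] [InnerProductSpace ℝ E] [FiniteDimensional ℝ E]
  [MeasurableSpace E] [BorelSpace E]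

/-! ### Directional Hilbert transforms -/

/-- A slab transversal to the line spanned by `y`. -/
def slab (y : E) : Set E := {x | inner ℝ x y / ‖y‖ ^ 2 ∈ Set.Ico (0 : ℝ) 1}

theorem measurableSet_slab (y : E) : MeasurableSet (slab y) := by
  have : Measurable fun x : E => inner ℝ x y / ‖y‖ ^ 2 := by
    apply Continuous.measurable
    fun_prop
  exact this measurableSet_Ico

/-- Each line parallel to `y` meets the slab in a parameter interval of length one. Tonelli's
theorem and translation invariance then disintegrate the measure along these lines without choosing
an orthogonal complement. -/
theorem lintegral_eq_lintegral_slab {y : E} (hy : y ≠ 0) {G : E → ℝ≥0∞} (hG : Measurable G) :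
    ∫⁻ x, G x = ∫⁻ x, (slab y).indicator 1 x * ∫⁻ s : ℝ, G (x + s • y) := by
  have hω : Measurable ((slab y).indicator (1 : E → ℝ≥0∞)) :=
    measurable_one.indicator (measurableSet_slab y)
  have hadd : Measurable fun z : E × ℝ => z.1 + z.2 • y := by fun_prop
  have hsub : Measurable fun z : E × ℝ => z.1 - z.2 • y := by fun_prop
  have e1 : ∀ x, (slab y).indicator 1 x * ∫⁻ s : ℝ, G (x + s • y) =
      ∫⁻ s : ℝ, (slab y).indicator 1 x * G (x + s • y) := fun x =>
    (lintegral_const_mul _ (hG.comp (hadd.comp measurable_prodMk_left))).symm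
  simp_rw [e1]
  rw [lintegral_lintegral_swap]
  swap
  · exact ((hω.comp measurable_fst).mul (hG.comp hadd)).aemeasurable
  have e2 : ∀ s : ℝ, ∫⁻ x, (slab y).indicator 1 x * G (x + s • y) =
      ∫⁻ x, (slab y).indicator 1 (x - s • y) * G x := by
    intro s
    rw [← lintegral_sub_right_eq_self _ (s • y)]
    simp
  simp_rw [e2]
  rw [lintegral_lintegral_swap]
  swap
  · exact ((hω.comp (hsub.comp measurable_swap)).mul (hG.comp measurable_snd)).aemeasurable
  refine lintegral_congr fun x => ?_
  have hm : Measurable fun s : ℝ => (slab y).indicator (1 : E → ℝ≥0∞) (x - s • y) :=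
    hω.comp (hsub.comp measurable_prodMk_left)
  rw [lintegral_mul_const _ hm]
  have e3 : ∀ s : ℝ, (slab y).indicator (1 : E → ℝ≥0∞) (x - s • y) =
      (Set.Ico (0 : ℝ) 1).indicator 1 (inner ℝ x y / ‖y‖ ^ 2 - s) := by
    intro s
    have hy' : ‖y‖ ≠ 0 := norm_ne_zero_iff.2 hy
    have : inner ℝ (x - s • y) y / ‖y‖ ^ 2 = inner ℝ x y / ‖y‖ ^ 2 - s := by
      rw [inner_sub_left, real_inner_smul_left, real_inner_self_eq_norm_sq]
      field_simp
    simp only [slab, Set.indicator, Set.mem_ofPred_eq, this, Pi.one_apply]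
  simp_rw [e3]
  rw [lintegral_sub_left_eq_self (fun u => (Set.Ico (0 : ℝ) 1).indicator (1 : ℝ → ℝ≥0∞) u),
    lintegral_indicator_one measurableSet_Ico]
  simp

theorem integral_kap (ε M : ℝ) : ∫ t, (kap ε M t : ℂ) = 0 := by
  have h := integral_neg_eq_self (fun t => (kap ε M t : ℂ)) volume
  simp only [kap_neg, Complex.ofReal_neg, integral_neg] at h
  exact self_eq_neg.1 h.symm

/-- The truncated Hilbert transform in the direction `y`. -/
def dirHilb (ε M : ℝ) (y : E) (f : E → ℂ) (x : E) : ℂ := ∫ t, (kap ε M t : ℂ) * f (x - t • y)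

theorem measurable_dirHilb (ε M : ℝ) (y : E) {f : E → ℂ} (hf : Measurable f) :
    Measurable (dirHilb ε M y f) :=
  measurable_integral_shift measurable_kap_ofReal (φ := fun t : ℝ => t • y) (by fun_prop) hf

theorem measurable_dirHilb_uncurry (ε M : ℝ) {f : E → ℂ} (hf : Measurable f) :
    Measurable (Function.uncurry fun y x => dirHilb ε M y f x) := by
  have h : Measurable fun z : (E × E) × ℝ => (kap ε M z.2 : ℂ) * f (z.1.2 - z.2 • z.1.1) := by
    refine (measurable_kap_ofReal.comp measurable_snd).mul (hf.comp ?_)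
    fun_prop
  exact h.stronglyMeasurable.integral_prod_right.measurable

/-- Along each line `s ↦ x + s • y` the operator is the one-dimensional one, so its bound can be
integrated over the slab; `y` need not be a unit vector. For `y = 0` the operator vanishes because
`kap` has integral zero. -/
theorem eLpNorm_dirHilb_le {p C : ℝ≥0∞} (hp : 1 < p) (hpt : p ≠ ⊤) (hC : HilbBound p C)
    {ε M : ℝ} (hε : 0 < ε) (hM : 0 < M) (y : E) {f : E → ℂ} (hf : Measurable f) {B : ℝ}
    (hB : ∀ x, ‖f x‖ ≤ B) :
    eLpNorm (dirHilb ε M y f) p volume ≤ C * eLpNorm f p volume := by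
  by_cases hy : y = 0
  · have : dirHilb ε M y f = 0 := by
      ext x
      simp [dirHilb, hy, integral_mul_const, integral_kap]
    simp [this]
  have hp0 : p ≠ 0 := (zero_lt_one.trans hp).ne'
  have hP0 : 0 < p.toReal := ENNReal.toReal_pos hp0 hpt
  have hlin : ∀ x, ∫⁻ s : ℝ, ‖dirHilb ε M y f (x + s • y)‖ₑ ^ p.toReal ≤
      C ^ p.toReal * ∫⁻ s : ℝ, ‖f (x + s • y)‖ₑ ^ p.toReal := by
    intro x
    have hm : Measurable fun s : ℝ => f (x + s • y) := hf.comp (by fun_prop)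
    have h := hC ε M hε hM (fun s => f (x + s • y)) hm ⟨B, fun s => hB _⟩
    have e : hilb ε M (fun s => f (x + s • y)) = fun s => dirHilb ε M y f (x + s • y) := by
      ext s
      simp only [hilb, dirHilb]
      congr 1
      ext t
      rw [sub_smul, add_sub_assoc]
    rw [e, eLpNorm_eq_lintegral_rpow_enorm_toReal hp0 hpt,
      eLpNorm_eq_lintegral_rpow_enorm_toReal hp0 hpt, one_div, ENNReal.rpow_inv_le_iff hP0,
      ENNReal.mul_rpow_of_nonneg _ _ hP0.le, ENNReal.rpow_inv_rpow hP0.ne'] at h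
    exact h
  have hG1 : Measurable fun x => ‖dirHilb ε M y f x‖ₑ ^ p.toReal :=
    (measurable_dirHilb ε M y hf).enorm.pow_const _
  have hG2 : Measurable fun x => ‖f x‖ₑ ^ p.toReal := hf.enorm.pow_const _
  rw [eLpNorm_eq_lintegral_rpow_enorm_toReal hp0 hpt,
      eLpNorm_eq_lintegral_rpow_enorm_toReal hp0 hpt, one_div, ENNReal.rpow_inv_le_iff hP0,
      ENNReal.mul_rpow_of_nonneg _ _ hP0.le, ENNReal.rpow_inv_rpow hP0.ne',
      lintegral_eq_lintegral_slab hy hG1, lintegral_eq_lintegral_slab hy hG2,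
      ← lintegral_const_mul]
  · refine lintegral_mono fun x => ?_
    rw [mul_left_comm]
    gcongr
    exact hlin x
  · refine (measurable_one.indicator (measurableSet_slab y)).mul ?_
    have h2 : Measurable fun z : E × ℝ => ‖f (z.1 + z.2 • y)‖ₑ ^ p.toReal :=
      hG2.comp (by fun_prop)
    exact h2.lintegral_prod_right'

/-! ### Dilation averages and the method of rotations -/

/-- The measure on `(0, ∞) × E` over which dilated kernels are averaged. -/
def dilMeasure (E : Type*) [NormedAddCommGroup E] [InnerProductSpace ℝ E]
    [FiniteDimensional ℝ E] [MeasurableSpace E] [BorelSpace E] : Measure (ℝ × E) :=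
  (volume.restrict (Set.Ioi 0)).prod volume

instance : SFinite (dilMeasure E) := by unfold dilMeasure; infer_instance

/-- The average of the dilates of the functions `a t` with respect to `dt`. -/
def dilInt (a : ℝ × E → ℂ) (f : E → ℂ) (x : E) : ℂ :=
  ∫ z, a z * f (x - z.1 • z.2) ∂(dilMeasure E)

theorem measurable_dil : Measurable fun z : ℝ × E => z.1 • z.2 := by fun_prop

theorem measurable_dilInt {a : ℝ × E → ℂ} (ha : Measurable a) {f : E → ℂ} (hf : Measurable f) :
    Measurable (dilInt a f) := measurable_integral_shift ha measurable_dil hf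

theorem eLpNorm_dilInt_le {p : ℝ≥0∞} (hp : 1 ≤ p) (hpt : p ≠ ⊤) {a : ℝ × E → ℂ}
    (ha : Measurable a) {f : E → ℂ} (hf : Measurable f) :
    eLpNorm (dilInt a f) p volume ≤
      (∫⁻ z, ‖a z‖ₑ ∂(dilMeasure E)) * eLpNorm f p volume :=
  eLpNorm_integral_shift_le hp hpt ha measurable_dil hf

/-- The truncated singular integral generated by `η`. -/
def sing (ε M : ℝ) (η : E → ℂ) : (E → ℂ) → E → ℂ := dilInt fun z => (kap ε M z.1 : ℂ) * η z.2

theorem measurable_sing_kernel {ε M : ℝ} {η : E → ℂ} (hη : Measurable η) :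
    Measurable fun z : ℝ × E => (kap ε M z.1 : ℂ) * η z.2 :=
  (measurable_kap_ofReal.comp measurable_fst).mul (hη.comp measurable_snd)

theorem measurable_sing {ε M : ℝ} {η : E → ℂ} (hη : Measurable η) {f : E → ℂ}
    (hf : Measurable f) : Measurable (sing ε M η f) :=
  measurable_dilInt (measurable_sing_kernel hη) hf

theorem integrable_sing_kernel {ε M : ℝ} (hε : 0 < ε) (hM : 0 < M) {η : E → ℂ}
    (hη : Integrable η) :
    Integrable (fun z : ℝ × E => (kap ε M z.1 : ℂ) * η z.2) (dilMeasure E) :=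
  (integrable_kap_ofReal hε hM).integrableOn.mul_prod hη

theorem norm_sing_le {ε M : ℝ} (hε : 0 < ε) (hM : 0 < M) {η : E → ℂ}
    (hη : Integrable η) {f : E → ℂ} {B : ℝ} (hB : ∀ x, ‖f x‖ ≤ B) (x : E) :
    ‖sing ε M η f x‖ ≤ (∫ z : ℝ × E, ‖(kap ε M z.1 : ℂ) * η z.2‖ ∂(dilMeasure E)) * B :=
  norm_integral_shift_le (integrable_sing_kernel hε hM hη) hB x

/-- Both `kap` and `η` are odd, so after integration in `y` the integrand is even in `t`. The
integral over the half-line is half of that over the whole line, and Fubini's theorem produces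
directional Hilbert transforms. -/
theorem sing_eq_of_odd {ε M : ℝ} (hε : 0 < ε) (hM : 0 < M) {η : E → ℂ}
    (hη : Integrable η) (hodd : ∀ y, η (-y) = -η y) {f : E → ℂ} (hf : Measurable f) {B : ℝ}
    (hB : ∀ x, ‖f x‖ ≤ B) (x : E) :
    sing ε M η f x = ∫ y, (η y / 2) * dirHilb ε M y f x := by
  have hint : Integrable (fun z : ℝ × E => (kap ε M z.1 : ℂ) * η z.2 * f (x - z.1 • z.2))
      (volume.prod volume) :=
    integrable_mul_shift ((integrable_kap_ofReal hε hM).mul_prod hη) measurable_dil hf hB x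
  have hint' : Integrable (fun z : ℝ × E => (kap ε M z.1 : ℂ) * η z.2 * f (x - z.1 • z.2))
      ((volume.restrict (Set.Ioi 0)).prod volume) :=
    integrable_mul_shift (integrable_sing_kernel hε hM hη) measurable_dil hf hB x
  set I : ℝ → ℂ := fun t => ∫ y, (kap ε M t : ℂ) * η y * f (x - t • y) with hI
  have hIeven : ∀ t, I (-t) = I t := by
    intro t
    rw [hI]
    simp only
    rw [← integral_neg_eq_self]
    simp [kap_neg, hodd]
  have e1 : sing ε M η f x = ∫ t in Set.Ioi 0, I t := by
    rw [sing, dilInt, dilMeasure, integral_prod _ hint']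
  have hIint : Integrable I := hint.integral_prod_left
  have e2 : ∫ t, I t = 2 * ∫ t in Set.Ioi 0, I t := by
    rw [← intervalIntegral.integral_Iic_add_Ioi (b := (0 : ℝ)) hIint.integrableOn
      hIint.integrableOn, two_mul]
    congr 1
    have := integral_comp_neg_Iic (0 : ℝ) I
    rw [neg_zero] at this
    rw [← this]
    simp_rw [hIeven]
  have e3 : ∫ t, I t = ∫ y, η y * dirHilb ε M y f x := by
    rw [hI, integral_integral_swap hint]
    congr 1
    ext y
    rw [dirHilb, ← integral_const_mul]
    congr 1
    ext t
    ring
  have e4 : ∫ y, (η y / 2) * dirHilb ε M y f x = (∫ y, η y * dirHilb ε M y f x) / 2 := by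
    rw [← integral_div]
    congr 1
    ext y
    ring
  rw [e1, e4, ← e3, e2]
  ring

/-- The method of rotations: an odd integrable function generates a bounded operator. -/
theorem eLpNorm_sing_le_of_odd {p C : ℝ≥0∞} (hp : 1 < p) (hpt : p ≠ ⊤) (hC : HilbBound p C)
    {ε M : ℝ} (hε : 0 < ε) (hM : 0 < M) {η : E → ℂ} (hηm : Measurable η)
    (hη : Integrable η) (hodd : ∀ y, η (-y) = -η y) {f : E → ℂ} (hf : Measurable f) {B : ℝ}
    (hB : ∀ x, ‖f x‖ ≤ B) :
    eLpNorm (sing ε M η f) p volume ≤ (∫⁻ y, ‖η y‖ₑ) * (C * eLpNorm f p volume) := by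
  have e : sing ε M η f = fun x => ∫ y, (η y / 2) * dirHilb ε M y f x := by
    ext x; exact sing_eq_of_odd hε hM hη hodd hf hB x
  rw [e]
  refine (eLpNorm_integral_mul_le (G := fun y x => dirHilb ε M y f x) hp.le hpt
    (hηm.div_const 2) (measurable_dirHilb_uncurry ε M hf)
    fun y => eLpNorm_dirHilb_le hp hpt hC hε hM y hf hB).trans ?_
  gcongr with y
  rw [enorm_le_iff_norm_le, norm_div]
  simp only [Complex.norm_ofNat]
  linarith [norm_nonneg (η y)]

end RoughCommutator

namespace RoughCommutator

variable {E : Type*} [NormedAddCommGroup E] [InnerProductSpace ℝ E] [FiniteDimensional ℝ E]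
  [MeasurableSpace E] [BorelSpace E]

open scoped FourierTransform

/-! ### Gaussian generators of the Riesz transforms -/

/-- The Gaussian fixed by the Fourier transform. -/
def gauss (u : E) : ℝ := Real.exp (-Real.pi * ‖u‖ ^ 2)

/-- A multiple of the derivative of the Gaussian in the direction `e`. -/
def rho (e u : E) : ℂ := ((inner ℝ e u * gauss u : ℝ) : ℂ)

theorem continuous_gauss : Continuous (gauss : E → ℝ) := by unfold gauss; fun_prop

theorem gauss_pos (u : E) : 0 < gauss u := Real.exp_pos _

theorem continuous_rho (e : E) : Continuous (rho e) :=
  Complex.continuous_ofReal.comp ((by fun_prop : Continuous fun u : E => inner ℝ e u).mul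
    continuous_gauss)

theorem rho_neg (e u : E) : rho e (-u) = -rho e u := by
  simp [rho, gauss]

theorem integrable_exp_neg_mul_sq {b : ℝ} (hb : 0 < b) :
    Integrable fun u : E => Real.exp (-b * ‖u‖ ^ 2) := by
  have h := GaussianFourier.integrable_cexp_neg_mul_sq_norm_add (V := E) (b := (b : ℂ))
    (by simpa using hb) 0 0
  refine h.norm.congr (ae_of_all _ fun u => ?_)
  simp only [Complex.norm_exp]
  congr 1
  simp [← Complex.ofReal_pow]

theorem add_sq_mul_gauss_le (u : E) :
    (1 + ‖u‖ + ‖u‖ ^ 2) * gauss u ≤ 2 * Real.exp (-(Real.pi - 1) * ‖u‖ ^ 2) := by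
  have h1 : 1 + ‖u‖ ^ 2 ≤ Real.exp (‖u‖ ^ 2) := by
    linarith [Real.add_one_le_exp (‖u‖ ^ 2)]
  have h2 : 1 + ‖u‖ + ‖u‖ ^ 2 ≤ 2 * Real.exp (‖u‖ ^ 2) := by nlinarith [sq_nonneg (‖u‖ - 1)]
  calc (1 + ‖u‖ + ‖u‖ ^ 2) * gauss u ≤ 2 * Real.exp (‖u‖ ^ 2) * gauss u := by
        gcongr
        exact (gauss_pos u).le
    _ = _ := by
        rw [gauss, mul_assoc, ← Real.exp_add]
        ring_nf

/-- A common majorant, up to constants, for `rho`, its derivative and `‖u‖ * ‖rho e u‖`. -/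
theorem integrable_poly_mul_gauss :
    Integrable fun u : E => (1 + ‖u‖ + ‖u‖ ^ 2) * gauss u := by
  have hπ : 0 < Real.pi - 1 := by linarith [Real.pi_gt_three]
  refine ((integrable_exp_neg_mul_sq (E := E) hπ).const_mul 2).mono'
    (Continuous.aestronglyMeasurable ?_) (ae_of_all _ fun u => ?_)
  · exact (by fun_prop : Continuous fun u : E => 1 + ‖u‖ + ‖u‖ ^ 2).mul continuous_gauss
  · rw [Real.norm_eq_abs, abs_of_nonneg (mul_nonneg (by positivity) (gauss_pos u).le)]
    exact add_sq_mul_gauss_le u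

theorem norm_rho_le {e : E} (he : ‖e‖ = 1) (u : E) : ‖rho e u‖ ≤ ‖u‖ * gauss u := by
  rw [rho, Complex.norm_real, Real.norm_eq_abs, abs_mul, abs_of_pos (gauss_pos u)]
  gcongr
  · exact (gauss_pos u).le
  · simpa [he] using abs_real_inner_le_norm e u

theorem integrable_rho {e : E} (he : ‖e‖ = 1) : Integrable (rho e) := by
  refine integrable_poly_mul_gauss.mono' (continuous_rho e).aestronglyMeasurable
    (ae_of_all _ fun u => (norm_rho_le he u).trans ?_)
  have := gauss_pos u
  nlinarith [sq_nonneg ‖u‖, mul_nonneg (sq_nonneg ‖u‖) this.le]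

theorem hasFDerivAt_gauss (w : E) :
    HasFDerivAt (fun u : E => (gauss u : ℂ))
      (Complex.ofRealCLM.comp ((gauss w * (-Real.pi * 2)) • innerSL ℝ w)) w := by
  have h1 := (hasStrictFDerivAt_norm_sq w).hasFDerivAt
  have h2 := ((h1.const_mul (-Real.pi)).exp)
  have h3 := Complex.ofRealCLM.hasFDerivAt.comp w h2
  have e : (gauss w * (-Real.pi * 2)) • innerSL ℝ w =
      Real.exp (-Real.pi * ‖w‖ ^ 2) • -Real.pi • 2 • innerSL ℝ w := by
    ext v
    simp [gauss]
    ring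
  rw [e]
  exact h3

theorem fourier_gauss : 𝓕 (fun u : E => (gauss u : ℂ)) = fun u => (gauss u : ℂ) := by
  have h : (fun u : E => (gauss u : ℂ)) = fun u => Complex.exp (-(Real.pi : ℂ) * ‖u‖ ^ 2) := by
    ext u; simp [gauss]
  rw [h]
  ext w
  have hpi : (Real.pi : ℂ) ≠ 0 := by simp [Real.pi_ne_zero]
  rw [fourier_gaussian_innerProductSpace (by simpa using Real.pi_pos), div_self hpi,
    Complex.one_cpow, one_mul]
  congr 1
  field_simp

theorem integrable_gauss : Integrable fun u : E => (gauss u : ℂ) :=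
  (integrable_exp_neg_mul_sq Real.pi_pos).ofReal

/-- Differentiate the Fourier transform of the Gaussian in the direction `e` in two ways: under the
integral sign, and as the Gaussian itself, which the transform fixes. Comparison shows that `rho e`
is an eigenfunction with eigenvalue `-i`. -/
theorem integral_exp_mul_rho {e : E} (w : E) :
    ∫ u, Complex.exp (((-2 * Real.pi * inner ℝ u w : ℝ) : ℂ) * Complex.I) * rho e u =
      -Complex.I * rho e w := by
  have hint : Integrable fun v : E => ‖v‖ * ‖(gauss v : ℂ)‖ := by
    refine integrable_poly_mul_gauss.mono' (Continuous.aestronglyMeasurable ?_)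
      (ae_of_all _ fun u => ?_)
    · exact continuous_norm.mul (Complex.continuous_ofReal.comp continuous_gauss).norm
    · have := gauss_pos u
      rw [Complex.norm_real, Real.norm_eq_abs, Real.norm_eq_abs, abs_of_pos this,
        abs_of_nonneg (by positivity)]
      nlinarith [sq_nonneg ‖u‖, mul_nonneg (sq_nonneg ‖u‖) this.le]
  have h1 := Real.hasFDerivAt_fourier (integrable_gauss (E := E)) hint w
  rw [fourier_gauss] at h1
  have h2 := congrArg (fun L : E →L[ℝ] ℂ => L e) (h1.unique (hasFDerivAt_gauss w))
  rw [Real.fourier_eq', ContinuousLinearMap.integral_apply] at h2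
  · simp only [_root_.smul_apply, VectorFourier.fourierSMulRight_apply] at h2
    have e1 : ∀ u : E, Complex.exp (((-2 * Real.pi * inner ℝ u w : ℝ) : ℂ) * Complex.I) •
        (-(2 * (Real.pi : ℂ) * Complex.I)) • ((innerSL ℝ) u) e • (gauss u : ℂ) =
        (-(2 * (Real.pi : ℂ) * Complex.I)) *
        (Complex.exp (((-2 * Real.pi * inner ℝ u w : ℝ) : ℂ) * Complex.I) * rho e u) := by
      intro u
      rw [innerSL_apply_apply, rho, real_inner_comm e u]
      simp only [smul_eq_mul, Complex.real_smul]
      push_cast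
      ring
    simp_rw [e1] at h2
    rw [integral_const_mul] at h2
    have hpi : (2 * (Real.pi : ℂ) * Complex.I) ≠ 0 := by simp [Real.pi_ne_zero]
    have h3 : (Complex.ofRealCLM.comp ((gauss w * (-Real.pi * 2)) • innerSL ℝ w)) e =
        -(2 * (Real.pi : ℂ) * Complex.I) * (-Complex.I * rho e w) := by
      simp only [ContinuousLinearMap.comp_apply, _root_.smul_apply,
        innerSL_apply_apply, Complex.ofRealCLM_apply, rho, smul_eq_mul]
      rw [real_inner_comm]
      push_cast
      linear_combination (-2 * (Real.pi : ℂ) * gauss w * (inner ℝ e w : ℝ)) * Complex.I_sq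
    rw [h3] at h2
    exact mul_left_cancel₀ (neg_ne_zero.2 hpi) h2
  · have hb : Integrable (VectorFourier.fourierSMulRight (innerSL ℝ) fun u : E => (gauss u : ℂ)) := by
      refine ((hint.const_mul (2 * Real.pi * ‖innerSL ℝ (E := E)‖))).mono'
        (integrable_gauss.1.fourierSMulRight) (ae_of_all _ fun u => ?_)
      refine (VectorFourier.norm_fourierSMulRight_le _ _ _).trans_eq (by ring)
    exact (Real.fourierIntegral_convergent_iff w).2 hb |>.congr (ae_of_all _ fun v => by
      simp [Circle.smul_def, Real.fourierChar_apply])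

end RoughCommutator

namespace RoughCommutator

variable {E : Type*} [NormedAddCommGroup E] [InnerProductSpace ℝ E] [FiniteDimensional ℝ E]
  [MeasurableSpace E] [BorelSpace E]

open scoped FourierTransform

/-! ### The multipliers of dilation averages -/

/-- The plane wave of frequency `ξ`. -/
def wave (ξ x : E) : ℂ := Complex.exp (((2 * Real.pi * inner ℝ ξ x : ℝ) : ℂ) * Complex.I)

theorem norm_wave (ξ x : E) : ‖wave ξ x‖ = 1 := Complex.norm_exp_ofReal_mul_I _

theorem wave_add (ξ x y : E) : wave ξ (x + y) = wave ξ x * wave ξ y := by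
  rw [wave, wave, wave, ← Complex.exp_add, inner_add_right]
  congr 1
  push_cast
  ring

theorem continuous_wave : Continuous fun z : E × E => wave z.1 z.2 := by
  unfold wave; fun_prop

/-- The inverse Fourier integral. -/
def invF (Φ : E → ℂ) (x : E) : ℂ := ∫ ξ, wave ξ x * Φ ξ

/-- The Fourier multiplier of a dilation average. -/
def mult (a : ℝ × E → ℂ) (ξ : E) : ℂ := ∫ z, a z * wave ξ (-(z.1 • z.2)) ∂(dilMeasure E)

theorem measurable_mult {a : ℝ × E → ℂ} (ha : Measurable a) : Measurable (mult a) := by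
  have h : Measurable fun z : E × (ℝ × E) => a z.2 * wave z.1 (-(z.2.1 • z.2.2)) := by
    refine (ha.comp measurable_snd).mul (Continuous.measurable ?_)
    exact continuous_wave.comp (by fun_prop : Continuous fun z : E × (ℝ × E) =>
      (z.1, -(z.2.1 • z.2.2)))
  exact h.stronglyMeasurable.integral_prod_right.measurable

theorem norm_mult_le {a : ℝ × E → ℂ} (ξ : E) :
    ‖mult a ξ‖ ≤ ∫ z, ‖a z‖ ∂(dilMeasure E) := by
  refine (norm_integral_le_integral_norm _).trans_eq ?_
  simp [norm_wave]

/-- Plane waves are eigenfunctions of translations. Working with Fourier integrals of integrable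
functions instead of Plancherel's theorem makes the identity hold at every point. -/
theorem dilInt_invF {a : ℝ × E → ℂ} (ha : Integrable a (dilMeasure E)) {Φ : E → ℂ}
    (hΦ : Integrable Φ) (x : E) :
    dilInt a (invF Φ) x = invF (fun ξ => mult a ξ * Φ ξ) x := by
  have hint : Integrable (fun w : (ℝ × E) × E => a w.1 * Φ w.2 * wave w.2 (x - w.1.1 • w.1.2))
      ((dilMeasure E).prod volume) := by
    refine (ha.mul_prod hΦ).mul_bdd (c := 1) ?_ (ae_of_all _ fun w => (norm_wave _ _).le)
    exact (continuous_wave.comp (by fun_prop : Continuous fun w : (ℝ × E) × E =>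
      (w.2, x - w.1.1 • w.1.2))).aestronglyMeasurable
  have e1 : ∀ z : ℝ × E, a z * invF Φ (x - z.1 • z.2) =
      ∫ ξ, a z * Φ ξ * wave ξ (x - z.1 • z.2) := by
    intro z
    rw [invF, ← integral_const_mul]
    congr 1
    ext ξ
    ring
  rw [dilInt]
  simp_rw [e1]
  rw [integral_integral_swap hint, invF]
  congr 1
  ext ξ
  rw [mult, ← integral_mul_const, ← integral_const_mul]
  congr 1
  ext z
  rw [sub_eq_add_neg, wave_add]
  ring

theorem mult_rho {ε M : ℝ} (hε : 0 < ε) (hM : 0 < M) {e : E} (he : ‖e‖ = 1) (ξ : E) :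
    mult (fun z : ℝ × E => (kap ε M z.1 : ℂ) * rho e z.2) ξ =
      ∫ t in Set.Ioi 0, (kap ε M t : ℂ) * (-Complex.I * rho e (t • ξ)) := by
  have hint : Integrable (fun z : ℝ × E => (kap ε M z.1 : ℂ) * rho e z.2 *
      wave ξ (-(z.1 • z.2))) ((volume.restrict (Set.Ioi 0)).prod volume) := by
    refine (integrable_sing_kernel hε hM (integrable_rho he)).mul_bdd (c := 1) ?_
      (ae_of_all _ fun w => (norm_wave _ _).le)
    exact (continuous_wave.comp (by fun_prop : Continuous fun w : ℝ × E =>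
      (ξ, -(w.1 • w.2)))).aestronglyMeasurable
  rw [mult, dilMeasure, integral_prod _ hint]
  congr 1
  ext t
  rw [← integral_exp_mul_rho, ← integral_const_mul]
  congr 1
  ext u
  have : wave ξ (-(t • u)) =
      Complex.exp (((-2 * Real.pi * inner ℝ u (t • ξ) : ℝ) : ℂ) * Complex.I) := by
    rw [wave, inner_neg_right, real_inner_smul_right, real_inner_smul_right, real_inner_comm]
    congr 3
    ring
  rw [this]
  ring

theorem integral_norm_mul_exp {ξ : E} (hξ : ξ ≠ 0) :
    ∫ t in Set.Ioi (0 : ℝ), Real.exp (-(Real.pi * ‖ξ‖ ^ 2) * t ^ 2) = 1 / (2 * ‖ξ‖) := by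
  have h0 : 0 < ‖ξ‖ := norm_pos_iff.2 hξ
  rw [integral_gaussian_Ioi]
  have : Real.pi / (Real.pi * ‖ξ‖ ^ 2) = (1 / ‖ξ‖) ^ 2 := by
    field_simp
  rw [this, Real.sqrt_sq (by positivity)]
  field_simp

theorem rho_smul (e ξ : E) (t : ℝ) :
    rho e (t • ξ) = ((t * inner ℝ e ξ * Real.exp (-(Real.pi * ‖ξ‖ ^ 2) * t ^ 2) : ℝ) : ℂ) := by
  rw [rho, gauss, real_inner_smul_right, norm_smul, mul_pow, Real.norm_eq_abs, sq_abs]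
  congr 3
  ring

theorem integrableOn_exp_mul_sq {ξ : E} (hξ : ξ ≠ 0) :
    IntegrableOn (fun t : ℝ => Real.exp (-(Real.pi * ‖ξ‖ ^ 2) * t ^ 2)) (Set.Ioi 0) := by
  have h0 : 0 < ‖ξ‖ := norm_pos_iff.2 hξ
  exact (_root_.integrable_exp_neg_mul_sq (by have := Real.pi_pos; positivity)).integrableOn

theorem norm_kap_mul_rho_le {ε M : ℝ} (hε : 0 < ε) (hM : ε ≤ M) {e : E} (he : ‖e‖ = 1) (ξ : E)
    {t : ℝ} (ht : 0 < t) :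
    ‖(kap ε M t : ℂ) * (-Complex.I * rho e (t • ξ))‖ ≤
      ‖ξ‖ * Real.exp (-(Real.pi * ‖ξ‖ ^ 2) * t ^ 2) := by
  rw [norm_mul, norm_mul, norm_neg, Complex.norm_I, one_mul, rho_smul, Complex.norm_real,
    Complex.norm_real, Real.norm_eq_abs, Real.norm_eq_abs, abs_of_nonneg (kap_nonneg hε hM ht.le),
    abs_mul, abs_mul, Real.abs_exp, abs_of_pos ht]
  have h1 : |inner ℝ e ξ| ≤ ‖ξ‖ := by simpa [he] using abs_real_inner_le_norm e ξ
  calc kap ε M t * (t * |inner ℝ e ξ| * Real.exp (-(Real.pi * ‖ξ‖ ^ 2) * t ^ 2))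
      ≤ t⁻¹ * (t * ‖ξ‖ * Real.exp (-(Real.pi * ‖ξ‖ ^ 2) * t ^ 2)) := by
        gcongr
        exact kap_le_inv ht
    _ = _ := by field_simp

theorem norm_mult_rho_le {ε M : ℝ} (hε : 0 < ε) (hM : ε ≤ M) {e : E} (he : ‖e‖ = 1) (ξ : E) :
    ‖mult (fun z : ℝ × E => (kap ε M z.1 : ℂ) * rho e z.2) ξ‖ ≤ 1 / 2 := by
  rw [mult_rho hε (hε.trans_le hM) he]
  by_cases hξ : ξ = 0
  · simp [hξ, rho]
  refine (norm_integral_le_of_norm_le ((integrableOn_exp_mul_sq hξ).const_mul ‖ξ‖)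
    ((ae_restrict_mem measurableSet_Ioi).mono fun t ht =>
      norm_kap_mul_rho_le hε hM he ξ ht)).trans_eq ?_
  rw [integral_const_mul, integral_norm_mul_exp hξ]
  have : ‖ξ‖ ≠ 0 := norm_ne_zero_iff.2 hξ
  field_simp

/-- As `kap` tends to `1/t`, it cancels the factor `t` in `rho e (t • ξ)`. The remaining Gaussian
integral is `1/(2‖ξ‖)`, so the limit is half of the usual Riesz multiplier. -/
theorem tendsto_mult_rho {e : E} (he : ‖e‖ = 1) {ξ : E} (hξ : ξ ≠ 0) :
    Tendsto (fun N : ℕ => mult (fun z : ℝ × E =>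
      (kap (1 / (N + 1)) (N + 1) z.1 : ℂ) * rho e z.2) ξ) atTop
      (𝓝 (-Complex.I * ((inner ℝ e ξ / (2 * ‖ξ‖) : ℝ) : ℂ))) := by
  have hN : ∀ N : ℕ, (0 : ℝ) < 1 / (N + 1) := fun N => by positivity
  have hN' : ∀ N : ℕ, (1 : ℝ) / (N + 1) ≤ N + 1 := fun N => by
    rw [div_le_iff₀ (by positivity)]
    nlinarith [(Nat.cast_nonneg N : (0 : ℝ) ≤ N)]
  have hlim : -Complex.I * ((inner ℝ e ξ / (2 * ‖ξ‖) : ℝ) : ℂ) =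
      ∫ t in Set.Ioi (0 : ℝ), ((t⁻¹ : ℝ) : ℂ) * (-Complex.I * rho e (t • ξ)) := by
    have h1 : ∀ t ∈ Set.Ioi (0 : ℝ), ((t⁻¹ : ℝ) : ℂ) * (-Complex.I * rho e (t • ξ)) =
        (-Complex.I * (inner ℝ e ξ : ℝ)) *
          ((Real.exp (-(Real.pi * ‖ξ‖ ^ 2) * t ^ 2) : ℝ) : ℂ) := by
      intro t ht
      have ht0 : (t : ℂ) ≠ 0 := Complex.ofReal_ne_zero.2 (ne_of_gt ht)
      rw [rho_smul]
      push_cast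
      field_simp
    rw [setIntegral_congr_fun measurableSet_Ioi h1, integral_const_mul, integral_complex_ofReal,
      integral_norm_mul_exp hξ]
    push_cast
    ring
  rw [hlim]
  simp_rw [fun N : ℕ => mult_rho (hN N) ((hN N).trans_le (hN' N)) he ξ]
  refine tendsto_integral_of_dominated_convergence _ (fun N => ?_)
    ((integrableOn_exp_mul_sq hξ).const_mul ‖ξ‖)
    (fun N => (ae_restrict_mem measurableSet_Ioi).mono fun t ht =>
      norm_kap_mul_rho_le (hN N) (hN' N) he ξ ht)
    ((ae_restrict_mem measurableSet_Ioi).mono fun t ht => ?_)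
  · refine (measurable_kap_ofReal.mul ?_).aestronglyMeasurable
    exact ((continuous_rho e).comp (by fun_prop)).measurable.const_mul _
  · exact ((Complex.continuous_ofReal.tendsto _).comp (tendsto_kap ht)).mul tendsto_const_nhds

/-! ### Riesz transforms -/

/-- The truncated Riesz transform in the direction `e`, up to a constant. -/
def riesz (N : ℕ) (e : E) : (E → ℂ) → E → ℂ := sing (1 / (N + 1)) (N + 1) (rho e)

theorem exists_invF {f : E → ℂ} (hf : ContDiff ℝ ∞ f) (hs : HasCompactSupport f) :
    ∃ Φ : E → ℂ, Measurable Φ ∧ Integrable Φ ∧ f = invF Φ := by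
  set F : SchwartzMap E ℂ := hs.toSchwartzMap hf
  have hF : (F : E → ℂ) = f := by ext x; rfl
  have hFi : Integrable (𝓕 f) := by
    rw [← hF, ← SchwartzMap.fourier_coe]
    exact (𝓕 F).integrable
  refine ⟨𝓕 f, ?_, hFi, ?_⟩
  · rw [← hF, ← SchwartzMap.fourier_coe]
    exact (𝓕 F).continuous.measurable
  · rw [← hF, ← (F.continuous.fourierInv_fourier_eq F.integrable (by rwa [hF]))]
    ext x
    rw [Real.fourierInv_eq', invF]
    rw [(F.continuous.fourierInv_fourier_eq F.integrable (by rwa [hF]))]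
    rfl

theorem riesz_riesz_invF (N : ℕ) {e : E} (he : ‖e‖ = 1) {Φ : E → ℂ} (hΦ : Integrable Φ)
    (x : E) :
    riesz N e (riesz N e (invF Φ)) x = ∫ ξ, wave ξ x *
      (mult (fun z : ℝ × E => (kap (1 / (N + 1)) (N + 1) z.1 : ℂ) * rho e z.2) ξ ^ 2 * Φ ξ) := by
  have hN : (0 : ℝ) < 1 / (N + 1) := by positivity
  have hN1 : (0 : ℝ) < N + 1 := by positivity
  have ha := integrable_sing_kernel hN hN1 (integrable_rho he)
  have ham : Measurable fun z : ℝ × E => (kap (1 / (N + 1)) (N + 1) z.1 : ℂ) * rho e z.2 :=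
    measurable_sing_kernel (continuous_rho e).measurable
  have h1 : riesz N e (invF Φ) = invF (fun ξ =>
      mult (fun z : ℝ × E => (kap (1 / (N + 1)) (N + 1) z.1 : ℂ) * rho e z.2) ξ * Φ ξ) := by
    ext x; exact dilInt_invF ha hΦ x
  rw [h1, riesz, sing, dilInt_invF ha]
  · rw [invF]
    congr 1
    ext ξ
    ring
  · refine hΦ.bdd_mul (measurable_mult ham).aestronglyMeasurable
      (ae_of_all _ fun ξ => norm_mult_le ξ)

/-- The truncated multipliers are at most `1/2`, so the `L^1` norm of `Φ` bounds each term.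
Uniformity in `N` and `x` is needed since dominated convergence will be applied inside `sing ε M ψ`.
-/
theorem norm_sum_riesz_le {ι : Type*} [Fintype ι] (b : OrthonormalBasis ι ℝ E) {f : E → ℂ}
    (hf : ContDiff ℝ ∞ f) (hs : HasCompactSupport f) :
    ∃ B : ℝ, ∀ (N : ℕ) (x : E), ‖∑ i, riesz N (b i) (riesz N (b i) f) x‖ ≤ B := by
  obtain ⟨Φ, hm, hΦ, rfl⟩ := exists_invF hf hs
  refine ⟨∑ _ : ι, ∫ ξ, ‖Φ ξ‖, fun N x => (norm_sum_le _ _).trans ?_⟩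
  gcongr with i
  have hN : (0 : ℝ) < 1 / (N + 1) := by positivity
  have hN' : (1 : ℝ) / (N + 1) ≤ N + 1 := by
    rw [div_le_iff₀ (by positivity)]
    nlinarith [(Nat.cast_nonneg N : (0 : ℝ) ≤ N)]
  rw [riesz_riesz_invF N (b.norm_eq_one i) hΦ]
  refine norm_integral_le_of_norm_le hΦ.norm (ae_of_all _ fun ξ => ?_)
  rw [norm_mul, norm_wave, one_mul, norm_mul, norm_pow]
  have h := norm_mult_rho_le hN hN' (b.norm_eq_one i) ξ
  have h2 : ‖mult (fun z : ℝ × E => (kap (1 / (N + 1)) (N + 1) z.1 : ℂ) * rho (b i) z.2) ξ‖ ^ 2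
      ≤ 1 := pow_le_one₀ (norm_nonneg _) (h.trans (by norm_num))
  nlinarith [norm_nonneg (Φ ξ)]

/-- The limiting multipliers are `-i ⟨b i, ξ⟩ / (2‖ξ‖)`, and by Parseval's identity in `E` their
squares add up to `-1/4` for `ξ ≠ 0`. -/
theorem tendsto_sum_riesz [Nontrivial E] {ι : Type*} [Fintype ι] (b : OrthonormalBasis ι ℝ E)
    {f : E → ℂ} (hf : ContDiff ℝ ∞ f) (hs : HasCompactSupport f) (x : E) :
    Tendsto (fun N : ℕ => ∑ i, riesz N (b i) (riesz N (b i) f) x) atTop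
      (𝓝 (-(1 / 4) * f x)) := by
  obtain ⟨Φ, hm, hΦ, rfl⟩ := exists_invF hf hs
  have hN : ∀ N : ℕ, (0 : ℝ) < 1 / (N + 1) := fun N => by positivity
  have hN' : ∀ N : ℕ, (1 : ℝ) / (N + 1) ≤ N + 1 := fun N => by
    rw [div_le_iff₀ (by positivity)]
    nlinarith [(Nat.cast_nonneg N : (0 : ℝ) ≤ N)]
  have hw : Measurable fun ξ => wave ξ x :=
    (continuous_wave.comp (by fun_prop : Continuous fun ξ : E => (ξ, x))).measurable
  have hne : ∀ᵐ ξ : E, ξ ≠ 0 := by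
    simp [ae_iff]
  set m : ι → E → ℂ := fun i ξ => -Complex.I * ((inner ℝ (b i) ξ / (2 * ‖ξ‖) : ℝ) : ℂ) with hmdef
  have hmm : ∀ i, Measurable (m i) := fun i => by
    refine (Complex.measurable_ofReal.comp ?_).const_mul _
    exact (by fun_prop : Continuous fun ξ : E => inner ℝ (b i) ξ).measurable.div (by fun_prop)
  have hmb : ∀ i ξ, ‖m i ξ‖ ≤ 1 := by
    intro i ξ
    rw [hmdef]
    simp only [norm_mul, norm_neg, Complex.norm_I, one_mul, Complex.norm_real, Real.norm_eq_abs,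
      abs_div]
    rw [abs_of_nonneg (by positivity : 0 ≤ 2 * ‖ξ‖)]
    refine div_le_one_of_le₀ ?_ (by positivity)
    have := abs_real_inner_le_norm (b i) ξ
    rw [b.norm_eq_one] at this
    nlinarith [norm_nonneg ξ]
  have key : ∀ i, Tendsto (fun N : ℕ => riesz N (b i) (riesz N (b i) (invF Φ)) x) atTop
      (𝓝 (∫ ξ, wave ξ x * (m i ξ ^ 2 * Φ ξ))) := by
    intro i
    simp_rw [fun N : ℕ => riesz_riesz_invF N (b.norm_eq_one i) hΦ x]
    refine tendsto_integral_of_dominated_convergence (fun ξ => ‖Φ ξ‖) (fun N => ?_) hΦ.norm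
      (fun N => ae_of_all _ fun ξ => ?_) (hne.mono fun ξ hξ => ?_)
    · exact (hw.mul (((measurable_mult (measurable_sing_kernel
        (continuous_rho _).measurable)).pow_const 2).mul hm)).aestronglyMeasurable
    · rw [norm_mul, norm_wave, one_mul, norm_mul, norm_pow]
      have h := norm_mult_rho_le (hN N) (hN' N) (b.norm_eq_one i) ξ
      have h2 : ‖mult (fun z : ℝ × E =>
          (kap (1 / (N + 1)) (N + 1) z.1 : ℂ) * rho (b i) z.2) ξ‖ ^ 2 ≤ 1 :=
        pow_le_one₀ (norm_nonneg _) (h.trans (by norm_num))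
      nlinarith [norm_nonneg (Φ ξ)]
    · exact tendsto_const_nhds.mul (((tendsto_mult_rho (b.norm_eq_one i) hξ).pow 2).mul
        tendsto_const_nhds)
  have hsum := tendsto_finsetSum Finset.univ fun i _ => key i
  convert hsum using 2
  rw [← integral_finsetSum]
  · rw [invF, ← integral_const_mul]
    refine integral_congr_ae (hne.mono fun ξ hξ => ?_)
    have h0 : ‖ξ‖ ≠ 0 := norm_ne_zero_iff.2 hξ
    have hs2 : ∑ i, m i ξ ^ 2 = -(1 / 4) := by
      have h1 : ∀ i, m i ξ ^ 2 = ((-(inner ℝ (b i) ξ ^ 2 / (4 * ‖ξ‖ ^ 2)) : ℝ) : ℂ) := by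
        intro i
        rw [hmdef]
        simp only [mul_pow, neg_sq, Complex.I_sq]
        push_cast
        field_simp
        norm_num
      simp_rw [h1]
      rw [← Complex.ofReal_sum, Finset.sum_neg_distrib, ← Finset.sum_div, b.sum_sq_inner_right]
      have : ‖ξ‖ ^ 2 / (4 * ‖ξ‖ ^ 2) = 1 / 4 := by field_simp
      rw [this]
      push_cast
      ring
    simp only
    rw [← Finset.mul_sum, ← Finset.sum_mul, hs2]
    ring
  · intro i _
    refine hΦ.norm.mono' (hw.mul (((hmm i).pow_const 2).mul hm)).aestronglyMeasurable
      (ae_of_all _ fun ξ => ?_)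
    rw [norm_mul, norm_wave, one_mul, norm_mul, norm_pow]
    have h2 : ‖m i ξ‖ ^ 2 ≤ 1 := pow_le_one₀ (norm_nonneg _) (hmb i ξ)
    nlinarith [norm_nonneg (Φ ξ)]

end RoughCommutator

namespace RoughCommutator

variable {E : Type*} [NormedAddCommGroup E] [InnerProductSpace ℝ E] [FiniteDimensional ℝ E]
  [MeasurableSpace E] [BorelSpace E]

/-! ### Moduli of continuity in `L^1` -/

/-- The fundamental theorem of calculus along the segment from `x` to `x - h`, then Tonelli's
theorem and translation invariance. -/
theorem lintegral_enorm_sub_translate_le {g : E → ℂ} (hg : ContDiff ℝ 1 g) (h : E) :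
    ∫⁻ x, ‖g (x - h) - g x‖ₑ ≤ ‖h‖ₑ * ∫⁻ x, ‖fderiv ℝ g x‖ₑ := by
  have hd : Continuous (fderiv ℝ g) := hg.continuous_fderiv one_ne_zero
  have hpt : ∀ x, ‖g (x - h) - g x‖ₑ ≤
      ∫⁻ t in Set.Ioc (0 : ℝ) 1, ‖h‖ₑ * ‖fderiv ℝ g (x - t • h)‖ₑ := by
    intro x
    have hder : ∀ t ∈ Set.uIcc (0 : ℝ) 1, HasDerivAt (fun t : ℝ => g (x - t • h))
        (fderiv ℝ g (x - t • h) (-h)) t := by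
      intro t _
      have h1 : HasDerivAt (fun t : ℝ => x - t • h) (-h) t := by
        simpa using ((hasDerivAt_id t).smul_const h).const_sub x
      exact ((hg.differentiable one_ne_zero) (x - t • h)).hasFDerivAt.comp_hasDerivAt t h1
    have hc : Continuous fun t : ℝ => fderiv ℝ g (x - t • h) (-h) :=
      (hd.comp (by fun_prop : Continuous fun t : ℝ => x - t • h)).clm_apply continuous_const
    have e := intervalIntegral.integral_eq_sub_of_hasDerivAt hder (hc.intervalIntegrable _ _)
    simp only [one_smul, zero_smul, sub_zero] at e
    rw [← e, intervalIntegral.integral_of_le zero_le_one]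
    refine (enorm_integral_le_lintegral_enorm _).trans (lintegral_mono fun t => ?_)
    rw [mul_comm]
    refine (ContinuousLinearMap.le_opENorm _ _).trans ?_
    rw [enorm_neg]
  have hm : Measurable fun z : E × ℝ => ‖h‖ₑ * ‖fderiv ℝ g (z.1 - z.2 • h)‖ₑ := by
    refine Measurable.const_mul ?_ _
    exact (hd.comp (by fun_prop : Continuous fun z : E × ℝ => z.1 - z.2 • h)).measurable.enorm
  calc ∫⁻ x, ‖g (x - h) - g x‖ₑ
      ≤ ∫⁻ x, ∫⁻ t in Set.Ioc (0 : ℝ) 1, ‖h‖ₑ * ‖fderiv ℝ g (x - t • h)‖ₑ :=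
        lintegral_mono hpt
    _ = ∫⁻ t in Set.Ioc (0 : ℝ) 1, ∫⁻ x, ‖h‖ₑ * ‖fderiv ℝ g (x - t • h)‖ₑ :=
        lintegral_lintegral_swap hm.aemeasurable
    _ = ∫⁻ t in Set.Ioc (0 : ℝ) 1, ‖h‖ₑ * ∫⁻ x, ‖fderiv ℝ g x‖ₑ := by
        refine lintegral_congr fun t => ?_
        rw [lintegral_sub_right_eq_self (fun x => ‖h‖ₑ * ‖fderiv ℝ g x‖ₑ),
          lintegral_const_mul _ hd.measurable.enorm]
    _ = _ := by simp

theorem contDiff_rho (e : E) : ContDiff ℝ 1 (rho e) := by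
  unfold rho gauss
  refine Complex.ofRealCLM.contDiff.comp ?_
  have h1 : ContDiff ℝ 1 fun u : E => ‖u‖ ^ 2 := contDiff_norm_sq ℝ
  have h2 : ContDiff ℝ 1 fun u : E => inner ℝ e u := contDiff_const.inner ℝ contDiff_id
  exact h2.mul (contDiff_const.mul h1).exp

theorem norm_fderiv_rho_le {e : E} (he : ‖e‖ = 1) (u : E) :
    ‖fderiv ℝ (rho e) u‖ ≤ 7 * ((1 + ‖u‖ + ‖u‖ ^ 2) * gauss u) := by
  have h1 : HasFDerivAt (fun u : E => ((inner ℝ e u : ℝ) : ℂ))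
      (Complex.ofRealCLM.comp (innerSL ℝ e)) u :=
    (Complex.ofRealCLM.comp (innerSL ℝ e)).hasFDerivAt
  have h2 := h1.mul (hasFDerivAt_gauss u)
  have e1 : (rho e) = (fun u => ((inner ℝ e u : ℝ) : ℂ)) * fun u => (gauss u : ℂ) := by
    ext u; simp [rho]
  rw [e1, h2.fderiv]
  have hg := gauss_pos u
  have hn1 : ‖(Complex.ofRealCLM.comp (innerSL ℝ e))‖ ≤ 1 := by
    refine (ContinuousLinearMap.opNorm_comp_le _ _).trans ?_
    rw [Complex.ofRealCLM_norm, innerSL_apply_norm, he, one_mul]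
  have hn2 : ‖(Complex.ofRealCLM.comp ((gauss u * (-Real.pi * 2)) • innerSL ℝ u))‖ ≤
      gauss u * (Real.pi * 2) * ‖u‖ := by
    refine (ContinuousLinearMap.opNorm_comp_le _ _).trans ?_
    rw [Complex.ofRealCLM_norm, one_mul, norm_smul, innerSL_apply_norm, norm_mul, norm_mul, norm_neg,
      Real.norm_eq_abs, Real.norm_eq_abs, abs_of_pos hg, abs_of_pos Real.pi_pos]
    simp
  have hi : ‖((inner ℝ e u : ℝ) : ℂ)‖ ≤ ‖u‖ := by
    rw [Complex.norm_real]
    simpa [he] using abs_real_inner_le_norm e u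
  refine (norm_add_le _ _).trans ?_
  rw [norm_smul, norm_smul, Complex.norm_real (gauss u), Real.norm_eq_abs, abs_of_pos hg]
  calc ‖((inner ℝ e u : ℝ) : ℂ)‖ * ‖(Complex.ofRealCLM.comp ((gauss u * (-Real.pi * 2)) •
        innerSL ℝ u))‖ + gauss u * ‖(Complex.ofRealCLM.comp (innerSL ℝ e))‖
      ≤ ‖u‖ * (gauss u * (Real.pi * 2) * ‖u‖) + gauss u * 1 := by gcongr
    _ ≤ _ := by
      -- The constant `7` is a bound for `2π`.
      have hpi : Real.pi ≤ 7 / 2 := by linarith [Real.pi_lt_d2]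
      have h3 : 0 ≤ ‖u‖ ^ 2 * gauss u := by positivity
      have h4 : 0 ≤ ‖u‖ * gauss u := by positivity
      nlinarith [mul_le_mul_of_nonneg_left hpi h3]

theorem lintegral_fderiv_rho_lt_top {e : E} (he : ‖e‖ = 1) :
    ∫⁻ u, ‖fderiv ℝ (rho e) u‖ₑ < ⊤ := by
  have : Integrable (fderiv ℝ (rho e)) :=
    (integrable_poly_mul_gauss.const_mul 7).mono'
      ((contDiff_rho e).continuous_fderiv one_ne_zero).aestronglyMeasurable
      (ae_of_all _ (norm_fderiv_rho_le he))
  exact this.2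

theorem lintegral_norm_mul_rho_lt_top {e : E} (he : ‖e‖ = 1) :
    ∫⁻ u, ‖u‖ₑ * ‖rho e u‖ₑ < ⊤ := by
  have : Integrable fun u => ‖u‖ * ‖rho e u‖ := by
    refine integrable_poly_mul_gauss.mono'
      (continuous_norm.mul (continuous_rho e).norm).aestronglyMeasurable
      (ae_of_all _ fun u => ?_)
    rw [Real.norm_eq_abs, abs_of_nonneg (by positivity)]
    have hg := gauss_pos u
    have := mul_le_mul_of_nonneg_left (norm_rho_le he u) (norm_nonneg u)
    nlinarith [mul_nonneg (norm_nonneg u) hg.le]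
  have h2 := this.2
  rw [HasFiniteIntegral] at h2
  simpa [enorm_mul] using h2

theorem integral_rho (e : E) : ∫ u, rho e u = 0 := by
  have h := integral_neg_eq_self (rho e) volume
  simp only [rho_neg, integral_neg] at h
  exact self_eq_neg.1 h.symm

/-! ### Riesz transforms of smooth functions -/

/-- The convolution of `ψ` with the dilate of `rho e` by `s`. -/
def rhoConv (e : E) (ψ : E → ℂ) (s : ℝ) (z : E) : ℂ := ∫ u, rho e u * ψ (z - s • u)

theorem measurable_rhoConv (e : E) {ψ : E → ℂ} (hψ : Measurable ψ) :
    Measurable fun w : ℝ × E => rhoConv e ψ w.1 w.2 := by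
  have h : Measurable fun w : (ℝ × E) × E => rho e w.2 * ψ (w.1.2 - w.1.1 • w.2) :=
    ((continuous_rho e).measurable.comp measurable_snd).mul (hψ.comp (by fun_prop))
  exact h.stronglyMeasurable.integral_prod_right.measurable

theorem rhoConv_neg (e : E) {ψ : E → ℂ} (heven : ∀ x, ψ (-x) = ψ x) (s : ℝ) (z : E) :
    rhoConv e ψ s (-z) = -rhoConv e ψ s z := by
  rw [rhoConv, ← integral_neg_eq_self, rhoConv, ← integral_neg]
  congr 1
  ext u
  rw [rho_neg, ← heven (z - s • u)]
  simp only [smul_neg, neg_sub, sub_neg_eq_add, neg_mul]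
  congr 3
  abel

/-- Useful for small `s`: `rho e` has mean zero, so `ψ z` can be subtracted under the integral, and
the `L^1` modulus of continuity of `ψ` gives the factor `s`. -/
theorem lintegral_rhoConv_le_small {e : E} (he : ‖e‖ = 1) {ψ : E → ℂ} (hψ : ContDiff ℝ 1 ψ)
    {B : ℝ} (hB : ∀ x, ‖ψ x‖ ≤ B) {s : ℝ} (hs : 0 < s) :
    ∫⁻ z, ‖rhoConv e ψ s z‖ₑ ≤ ENNReal.ofReal s *
      ((∫⁻ u, ‖u‖ₑ * ‖rho e u‖ₑ) * ∫⁻ x, ‖fderiv ℝ ψ x‖ₑ) := by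
  have hψm := hψ.continuous.measurable
  have hρm := (continuous_rho e).measurable
  have hpt : ∀ z, ‖rhoConv e ψ s z‖ₑ ≤ ∫⁻ u, ‖rho e u‖ₑ * ‖ψ (z - s • u) - ψ z‖ₑ := by
    intro z
    have e1 : rhoConv e ψ s z = ∫ u, rho e u * (ψ (z - s • u) - ψ z) := by
      simp_rw [mul_sub]
      rw [integral_sub (integrable_mul_shift (integrable_rho he) (φ := fun u : E => s • u)
        (by fun_prop) hψm hB z) ((integrable_rho he).mul_const _), integral_mul_const,
        integral_rho, zero_mul, sub_zero]
      rfl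
    rw [e1]
    refine (enorm_integral_le_lintegral_enorm _).trans_eq ?_
    simp [enorm_mul]
  calc ∫⁻ z, ‖rhoConv e ψ s z‖ₑ
      ≤ ∫⁻ z, ∫⁻ u, ‖rho e u‖ₑ * ‖ψ (z - s • u) - ψ z‖ₑ := lintegral_mono hpt
    _ = ∫⁻ u, ∫⁻ z, ‖rho e u‖ₑ * ‖ψ (z - s • u) - ψ z‖ₑ := by
        refine lintegral_lintegral_swap (Measurable.aemeasurable ?_)
        refine (hρm.comp measurable_snd).enorm.mul (Measurable.enorm ?_)
        exact (hψm.comp (by fun_prop)).sub (hψm.comp measurable_fst)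
    _ ≤ ∫⁻ u, ENNReal.ofReal s * (∫⁻ x, ‖fderiv ℝ ψ x‖ₑ) * (‖u‖ₑ * ‖rho e u‖ₑ) := by
        refine lintegral_mono fun u => ?_
        have hm : Measurable fun z => ‖ψ (z - s • u) - ψ z‖ₑ :=
          ((hψm.comp (by fun_prop)).sub hψm).enorm
        rw [lintegral_const_mul _ hm]
        calc ‖rho e u‖ₑ * ∫⁻ z, ‖ψ (z - s • u) - ψ z‖ₑ
            ≤ ‖rho e u‖ₑ * (‖s • u‖ₑ * ∫⁻ x, ‖fderiv ℝ ψ x‖ₑ) := by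
              gcongr
              exact lintegral_enorm_sub_translate_le hψ _
          _ = _ := by
              rw [enorm_smul, Real.enorm_eq_ofReal hs.le]
              ring
    _ = _ := by
        have hm : Measurable fun u : E => ‖u‖ₑ * ‖rho e u‖ₑ := measurable_enorm.mul hρm.enorm
        rw [lintegral_const_mul _ hm]
        ring

theorem lintegral_comp_inv_smul {s : ℝ} (hs : 0 < s) {g : E → ℝ≥0∞} (hg : Measurable g) :
    ∫⁻ z, g (s⁻¹ • z) = ENNReal.ofReal (s ^ Module.finrank ℝ E) * ∫⁻ z, g z := by
  have h := Measure.map_addHaar_smul (volume : Measure E) (inv_ne_zero hs.ne')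
  have h2 : ∫⁻ z, g (s⁻¹ • z) = ∫⁻ w, g w ∂(Measure.map (s⁻¹ • · : E → E) volume) :=
    (lintegral_map hg (by fun_prop)).symm
  rw [h2, h, lintegral_smul_measure]
  simp only [smul_eq_mul, inv_pow, inv_inv]
  rw [abs_of_pos (by positivity)]

theorem rhoConv_eq (e : E) {ψ : E → ℂ} {s : ℝ} (hs : 0 < s) (z : E) :
    rhoConv e ψ s z = (((s ^ Module.finrank ℝ E)⁻¹ : ℝ) : ℂ) *
      ∫ y, ψ y * rho e (s⁻¹ • z - s⁻¹ • y) := by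
  have h := Measure.integral_comp_smul (volume : Measure E)
    (fun y => ψ (z - y) * rho e (s⁻¹ • y)) s
  have h3 : ∀ u : E, ψ (z - s • u) * rho e (s⁻¹ • s • u) = rho e u * ψ (z - s • u) := by
    intro u
    rw [smul_smul, inv_mul_cancel₀ hs.ne', one_smul, mul_comm]
  simp_rw [h3] at h
  rw [rhoConv, h, abs_of_pos (by positivity), Complex.real_smul,
    ← integral_sub_left_eq_self (fun y => ψ (z - y) * rho e (s⁻¹ • y)) volume z]
  simp [smul_sub]

/-- Useful for large `s`, with the roles exchanged: now the dilation sits on `rho e`, and the mean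
zero of `ψ` allows subtraction of `rho e (s⁻¹ • z)`. A shift by `s⁻¹ • y` with `‖y‖ ≤ R` gives the
factor `R/s`, and the Jacobian cancels the normalization of the dilate. No derivative of `ψ`
appears. -/
theorem lintegral_rhoConv_le_large {e : E} (he : ‖e‖ = 1) {ψ : E → ℂ} (hψm : Measurable ψ)
    (hψ : Integrable ψ) (h0 : ∫ x, ψ x = 0) {R : ℝ} (hR : ∀ x, R < ‖x‖ → ψ x = 0) {s : ℝ}
    (hs : 0 < s) :
    ∫⁻ z, ‖rhoConv e ψ s z‖ₑ ≤ ENNReal.ofReal s⁻¹ *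
      ((∫⁻ x, ‖fderiv ℝ (rho e) x‖ₑ) * (ENNReal.ofReal R * ∫⁻ x, ‖ψ x‖ₑ)) := by
  have hρm := (continuous_rho e).measurable
  set c : ℝ≥0∞ := ENNReal.ofReal (s ^ Module.finrank ℝ E)⁻¹ with hc
  have hbρ : ∃ B, ∀ x, ‖rho e x‖ ≤ B := by
    refine ⟨2, fun u => (norm_rho_le he u).trans ?_⟩
    have h1 := add_sq_mul_gauss_le u
    have h2 : Real.exp (-(Real.pi - 1) * ‖u‖ ^ 2) ≤ 1 := by
      rw [Real.exp_le_one_iff]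
      have : 0 < Real.pi - 1 := by linarith [Real.pi_gt_three]
      nlinarith [sq_nonneg ‖u‖, mul_nonneg this.le (sq_nonneg ‖u‖)]
    have hg := gauss_pos u
    nlinarith [mul_nonneg (sq_nonneg ‖u‖) hg.le]
  obtain ⟨B, hB⟩ := hbρ
  have hpt : ∀ z, ‖rhoConv e ψ s z‖ₑ ≤
      c * ∫⁻ y, ‖ψ y‖ₑ * ‖rho e (s⁻¹ • z - s⁻¹ • y) - rho e (s⁻¹ • z)‖ₑ := by
    intro z
    have e1 : ∫ y, ψ y * rho e (s⁻¹ • z - s⁻¹ • y) =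
        ∫ y, ψ y * (rho e (s⁻¹ • z - s⁻¹ • y) - rho e (s⁻¹ • z)) := by
      simp_rw [mul_sub]
      rw [integral_sub (integrable_mul_shift hψ (φ := fun y : E => s⁻¹ • y)
        (by fun_prop) hρm hB (s⁻¹ • z)) (hψ.mul_const _), integral_mul_const,
        h0, zero_mul, sub_zero]
    rw [rhoConv_eq e hs, e1, enorm_mul]
    gcongr
    · rw [hc, ← ofReal_norm, Complex.norm_real, Real.norm_eq_abs, abs_of_pos (by positivity)]
    · refine (enorm_integral_le_lintegral_enorm _).trans_eq ?_
      simp [enorm_mul]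
  have hm2 : Measurable fun w : E × E =>
      ‖ψ w.2‖ₑ * ‖rho e (s⁻¹ • w.1 - s⁻¹ • w.2) - rho e (s⁻¹ • w.1)‖ₑ := by
    refine (hψm.comp measurable_snd).enorm.mul (Measurable.enorm ?_)
    exact (hρm.comp (by fun_prop)).sub (hρm.comp (by fun_prop))
  calc ∫⁻ z, ‖rhoConv e ψ s z‖ₑ
      ≤ ∫⁻ z, c * ∫⁻ y, ‖ψ y‖ₑ * ‖rho e (s⁻¹ • z - s⁻¹ • y) - rho e (s⁻¹ • z)‖ₑ :=
        lintegral_mono hpt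
    _ = c * ∫⁻ y, ∫⁻ z, ‖ψ y‖ₑ * ‖rho e (s⁻¹ • z - s⁻¹ • y) - rho e (s⁻¹ • z)‖ₑ := by
        rw [lintegral_const_mul _ hm2.lintegral_prod_right',
          lintegral_lintegral_swap hm2.aemeasurable]
    _ ≤ c * ∫⁻ y, ENNReal.ofReal (s ^ Module.finrank ℝ E) * ENNReal.ofReal s⁻¹ *
          ENNReal.ofReal R * (∫⁻ x, ‖fderiv ℝ (rho e) x‖ₑ) * ‖ψ y‖ₑ := by
        gcongr with y
        by_cases hy : R < ‖y‖
        · simp [hR y hy]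
        push Not at hy
        have hm3 : Measurable fun w : E => ‖rho e (w - s⁻¹ • y) - rho e w‖ₑ :=
          ((hρm.comp (by fun_prop)).sub hρm).enorm
        have hm4 : Measurable fun z : E => ‖rho e (s⁻¹ • z - s⁻¹ • y) - rho e (s⁻¹ • z)‖ₑ :=
          hm3.comp (by fun_prop)
        rw [lintegral_const_mul _ hm4,
          lintegral_comp_inv_smul hs (g := fun w => ‖rho e (w - s⁻¹ • y) - rho e w‖ₑ) hm3]
        calc ‖ψ y‖ₑ * (ENNReal.ofReal (s ^ Module.finrank ℝ E) *
              ∫⁻ w, ‖rho e (w - s⁻¹ • y) - rho e w‖ₑ)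
            ≤ ‖ψ y‖ₑ * (ENNReal.ofReal (s ^ Module.finrank ℝ E) *
              ((ENNReal.ofReal s⁻¹ * ENNReal.ofReal R) * ∫⁻ x, ‖fderiv ℝ (rho e) x‖ₑ)) := by
              gcongr
              refine (lintegral_enorm_sub_translate_le (contDiff_rho e) _).trans ?_
              gcongr
              rw [enorm_smul, Real.enorm_eq_ofReal (by positivity)]
              gcongr
              rw [← ofReal_norm]
              exact ENNReal.ofReal_le_ofReal hy
          _ = _ := by ring
    _ = _ := by
        rw [lintegral_const_mul _ hψm.enorm]
        have h1 : c * ENNReal.ofReal (s ^ Module.finrank ℝ E) = 1 := by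
          rw [hc, ← ENNReal.ofReal_mul (by positivity), inv_mul_cancel₀ (by positivity),
            ENNReal.ofReal_one]
        calc _ = (c * ENNReal.ofReal (s ^ Module.finrank ℝ E)) * (ENNReal.ofReal s⁻¹ *
              ((∫⁻ x, ‖fderiv ℝ (rho e) x‖ₑ) * (ENNReal.ofReal R * ∫⁻ x, ‖ψ x‖ₑ))) := by ring
          _ = _ := by rw [h1, one_mul]

/-- If `‖z‖ > 2R` and `ψ (z - s • u) ≠ 0`, then `s‖u‖ ≥ R`, so the factor `s‖u‖/R ≥ 1` can be
inserted. Away from the support this replaces the bound for small `s` by one free of derivatives of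
`ψ`. -/
theorem lintegral_rhoConv_le_far {e : E} {ψ : E → ℂ} (hψm : Measurable ψ)
    {R : ℝ} (hR0 : 0 < R) (hR : ∀ x, R < ‖x‖ → ψ x = 0) {s : ℝ} (hs : 0 < s) :
    ∫⁻ z in {z | 2 * R < ‖z‖}, ‖rhoConv e ψ s z‖ₑ ≤ ENNReal.ofReal s *
      ((∫⁻ u, ‖u‖ₑ * ‖rho e u‖ₑ) * (ENNReal.ofReal R⁻¹ * ∫⁻ x, ‖ψ x‖ₑ)) := by
  have hρm := (continuous_rho e).measurable
  have hm2 : Measurable fun w : E × E => ENNReal.ofReal s * ENNReal.ofReal R⁻¹ *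
      (‖w.2‖ₑ * ‖rho e w.2‖ₑ) * ‖ψ (w.1 - s • w.2)‖ₑ := by
    refine Measurable.mul (Measurable.const_mul (measurable_snd.enorm.mul
      (hρm.comp measurable_snd).enorm) _) (hψm.comp (by fun_prop)).enorm
  calc ∫⁻ z in {z | 2 * R < ‖z‖}, ‖rhoConv e ψ s z‖ₑ
      ≤ ∫⁻ z in {z | 2 * R < ‖z‖}, ∫⁻ u, ENNReal.ofReal s * ENNReal.ofReal R⁻¹ *
          (‖u‖ₑ * ‖rho e u‖ₑ) * ‖ψ (z - s • u)‖ₑ := by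
        refine setLIntegral_mono hm2.lintegral_prod_right' fun z hz => ?_
        refine (enorm_integral_le_lintegral_enorm _).trans (lintegral_mono fun u => ?_)
        rw [enorm_mul]
        by_cases hu : R < ‖z - s • u‖
        · simp [hR _ hu]
        push Not at hu
        have h1 : R ≤ s * ‖u‖ := by
          have h2 := norm_sub_norm_le z (s • u)
          rw [norm_smul, Real.norm_eq_abs, abs_of_pos hs] at h2
          have h3 : 2 * R < ‖z‖ := hz
          linarith
        have h2 : (1 : ℝ≥0∞) ≤ ENNReal.ofReal s * ENNReal.ofReal R⁻¹ * ‖u‖ₑ := by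
          rw [← ofReal_norm, ← ENNReal.ofReal_mul hs.le, ← ENNReal.ofReal_mul (by positivity),
            ENNReal.one_le_ofReal]
          calc (1 : ℝ) = R * R⁻¹ := (mul_inv_cancel₀ hR0.ne').symm
            _ ≤ s * ‖u‖ * R⁻¹ := by gcongr
            _ = _ := by ring
        calc ‖rho e u‖ₑ * ‖ψ (z - s • u)‖ₑ
            ≤ (ENNReal.ofReal s * ENNReal.ofReal R⁻¹ * ‖u‖ₑ) * ‖rho e u‖ₑ *
              ‖ψ (z - s • u)‖ₑ := by
              gcongr
              exact le_mul_of_one_le_left zero_le h2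
          _ = _ := by ring
    _ ≤ ∫⁻ z, ∫⁻ u, ENNReal.ofReal s * ENNReal.ofReal R⁻¹ *
          (‖u‖ₑ * ‖rho e u‖ₑ) * ‖ψ (z - s • u)‖ₑ := setLIntegral_le_lintegral _ _
    _ = ∫⁻ u, ∫⁻ z, ENNReal.ofReal s * ENNReal.ofReal R⁻¹ *
          (‖u‖ₑ * ‖rho e u‖ₑ) * ‖ψ (z - s • u)‖ₑ := lintegral_lintegral_swap hm2.aemeasurable
    _ = ∫⁻ u, ENNReal.ofReal s * ENNReal.ofReal R⁻¹ * (∫⁻ x, ‖ψ x‖ₑ) *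
          (‖u‖ₑ * ‖rho e u‖ₑ) := by
        refine lintegral_congr fun u => ?_
        have hm : Measurable fun z => ‖ψ (z - s • u)‖ₑ := (hψm.comp (by fun_prop)).enorm
        rw [lintegral_const_mul _ hm,
          lintegral_sub_right_eq_self (fun x => ‖ψ x‖ₑ)]
        ring
    _ = _ := by
        have hm : Measurable fun u : E => ‖u‖ₑ * ‖rho e u‖ₑ := measurable_enorm.mul hρm.enorm
        rw [lintegral_const_mul _ hm]
        ring

end RoughCommutator

/-! ### Smooth even profiles and the integrability of their Riesz transforms. -/

namespace RoughCommutator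

variable {E : Type*} [NormedAddCommGroup E] [InnerProductSpace ℝ E] [FiniteDimensional ℝ E]
  [MeasurableSpace E] [BorelSpace E]

/-- Smooth even functions with integral zero, supported in the ball of radius `R`. -/
structure Profile (R : ℝ) (ψ : E → ℂ) : Prop where
  smooth : ContDiff ℝ ∞ ψ
  supp : ∀ x, R < ‖x‖ → ψ x = 0
  even : ∀ x, ψ (-x) = ψ x
  mean : ∫ x, ψ x = 0

namespace Profile

variable {R : ℝ} {ψ : E → ℂ} (h : Profile R ψ)
include h

theorem hasCompactSupport : HasCompactSupport ψ :=
  HasCompactSupport.intro (isCompact_closedBall 0 R) fun x hx => h.supp x (by simpa using hx)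

theorem measurable : Measurable ψ := h.smooth.continuous.measurable

theorem integrable : Integrable ψ :=
  h.smooth.continuous.integrable_of_hasCompactSupport h.hasCompactSupport

theorem exists_bound : ∃ B, ∀ x, ‖ψ x‖ ≤ B :=
  h.hasCompactSupport.exists_bound_of_continuous h.smooth.continuous

theorem contDiff_one : ContDiff ℝ 1 ψ := h.smooth.of_le (by simp)

theorem lintegral_fderiv_lt_top : ∫⁻ x, ‖fderiv ℝ ψ x‖ₑ < ⊤ :=
  ((h.contDiff_one.continuous_fderiv one_ne_zero).integrable_of_hasCompactSupport
    (h.hasCompactSupport.fderiv ℝ)).2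

end Profile

/-- Both `∫ ds` over `(0, 1]` and `∫ s⁻² ds` over `(1, ∞)` equal one. -/
theorem lintegral_inv_mul_le {J : ℝ → ℝ≥0∞} {C₁ C₂ : ℝ≥0∞}
    (h₁ : ∀ s, 0 < s → J s ≤ ENNReal.ofReal s * C₁)
    (h₂ : ∀ s, 0 < s → J s ≤ ENNReal.ofReal s⁻¹ * C₂) :
    ∫⁻ s in Set.Ioi (0 : ℝ), ENNReal.ofReal s⁻¹ * J s ≤ C₁ + C₂ := by
  rw [← Set.Ioc_union_Ioi_eq_Ioi zero_le_one]
  refine (lintegral_union_le _ _ _).trans (add_le_add ?_ ?_)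
  · calc ∫⁻ s in Set.Ioc (0 : ℝ) 1, ENNReal.ofReal s⁻¹ * J s
        ≤ ∫⁻ s in Set.Ioc (0 : ℝ) 1, C₁ := by
          refine setLIntegral_mono measurable_const fun s hs => ?_
          calc ENNReal.ofReal s⁻¹ * J s ≤ ENNReal.ofReal s⁻¹ * (ENNReal.ofReal s * C₁) := by
                gcongr; exact h₁ s hs.1
            _ = C₁ := by
                rw [← mul_assoc, ← ENNReal.ofReal_mul (inv_nonneg.2 hs.1.le),
                  inv_mul_cancel₀ hs.1.ne', ENNReal.ofReal_one, one_mul]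
      _ = C₁ := by simp
  · have hi : IntegrableOn (fun s : ℝ => s ^ (-2 : ℝ)) (Set.Ioi 1) :=
      integrableOn_Ioi_rpow_of_lt (by norm_num) zero_lt_one
    calc ∫⁻ s in Set.Ioi (1 : ℝ), ENNReal.ofReal s⁻¹ * J s
        ≤ ∫⁻ s in Set.Ioi (1 : ℝ), ENNReal.ofReal (s ^ (-2 : ℝ)) * C₂ := by
          refine setLIntegral_mono (by fun_prop) fun s hs => ?_
          have hs0 : 0 < s := zero_lt_one.trans hs
          calc ENNReal.ofReal s⁻¹ * J s ≤ ENNReal.ofReal s⁻¹ * (ENNReal.ofReal s⁻¹ * C₂) := by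
                gcongr; exact h₂ s hs0
            _ = _ := by
                rw [← mul_assoc, ← ENNReal.ofReal_mul (inv_nonneg.2 hs0.le),
                  Real.rpow_neg hs0.le, Real.rpow_two, sq, mul_inv]
      _ = (∫⁻ s in Set.Ioi (1 : ℝ), ENNReal.ofReal (s ^ (-2 : ℝ))) * C₂ :=
          lintegral_mul_const _ (by fun_prop)
      _ = C₂ := by
          rw [← ofReal_integral_eq_lintegral_ofReal hi
            ((ae_restrict_mem measurableSet_Ioi).mono fun s hs => by
              have : (0 : ℝ) < s := zero_lt_one.trans hs
              positivity), integral_Ioi_rpow_of_lt (by norm_num) zero_lt_one]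
          norm_num

theorem measurable_rhoConv_apply (e : E) {ψ : E → ℂ} (hψ : Measurable ψ) (s : ℝ) :
    Measurable (rhoConv e ψ s) :=
  Measurable.comp (g := fun w : ℝ × E => rhoConv e ψ w.1 w.2) (f := fun z => (s, z))
    (measurable_rhoConv e hψ) measurable_prodMk_left

theorem measurable_rhoConv_param (e : E) {ψ : E → ℂ} (hψ : Measurable ψ) (z : E) :
    Measurable fun s => rhoConv e ψ s z :=
  Measurable.comp (g := fun w : ℝ × E => rhoConv e ψ w.1 w.2) (f := fun s => (s, z))
    (measurable_rhoConv e hψ) measurable_prodMk_right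

theorem measurable_rhoConv_swap (e : E) {ψ : E → ℂ} (hψ : Measurable ψ) :
    Measurable fun w : E × ℝ => rhoConv e ψ w.2 w.1 :=
  Measurable.comp (g := fun w : ℝ × E => rhoConv e ψ w.1 w.2) (f := fun w : E × ℝ => w.swap)
    (measurable_rhoConv e hψ) measurable_swap

/-- The untruncated Riesz transform of a smooth function, up to a constant. -/
def rieszLim (e : E) (ψ : E → ℂ) (z : E) : ℂ :=
  ∫ s in Set.Ioi (0 : ℝ), ((s⁻¹ : ℝ) : ℂ) * rhoConv e ψ s z

/-- The total `L^1` mass of the pieces of the Riesz transform of `ψ`. -/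
def rieszMass (e : E) (ψ : E → ℂ) : ℝ≥0∞ :=
  ∫⁻ s in Set.Ioi (0 : ℝ), ENNReal.ofReal s⁻¹ * ∫⁻ z, ‖rhoConv e ψ s z‖ₑ

/-- The cancellation of `rho e` serves for `s ≤ 1`, that of `ψ` for `s > 1`. The bound involves the
derivative of `ψ`, so only its finiteness is used; the estimate that survives the limit of rough `ψ`
is `exists_lintegral_rieszLim_le`. -/
theorem rieszMass_lt_top {e : E} (he : ‖e‖ = 1) {R : ℝ} {ψ : E → ℂ} (h : Profile R ψ) :
    rieszMass e ψ < ⊤ := by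
  obtain ⟨B, hB⟩ := h.exists_bound
  refine (lintegral_inv_mul_le (fun s hs => lintegral_rhoConv_le_small he h.contDiff_one hB hs)
    (fun s hs => lintegral_rhoConv_le_large he h.measurable h.integrable h.mean h.supp
      hs)).trans_lt ?_
  have h1 := lintegral_fderiv_rho_lt_top he
  have h2 := lintegral_norm_mul_rho_lt_top he
  exact ENNReal.add_lt_top.2 ⟨ENNReal.mul_lt_top h2 h.lintegral_fderiv_lt_top,
    ENNReal.mul_lt_top h1 (ENNReal.mul_lt_top ENNReal.ofReal_lt_top h.integrable.2)⟩

theorem measurable_rieszLim (e : E) {ψ : E → ℂ} (hψ : Measurable ψ) :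
    Measurable (rieszLim e ψ) := by
  have h : Measurable fun w : E × ℝ => ((w.2⁻¹ : ℝ) : ℂ) * rhoConv e ψ w.2 w.1 :=
    (Complex.measurable_ofReal.comp measurable_snd.inv).mul
      (measurable_rhoConv_swap e hψ)
  exact h.stronglyMeasurable.integral_prod_right.measurable

/-- The parity is reversed because `rho e` is odd. This makes the method of rotations available for
even profiles. -/
theorem rieszLim_neg (e : E) {ψ : E → ℂ} (heven : ∀ x, ψ (-x) = ψ x) (z : E) :
    rieszLim e ψ (-z) = -rieszLim e ψ z := by
  simp only [rieszLim, rhoConv_neg e heven, mul_neg, integral_neg]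

theorem sing_rho_eq {ε M : ℝ} (hε : 0 < ε) (hM : 0 < M) {e : E} (he : ‖e‖ = 1) {ψ : E → ℂ}
    (hψ : Measurable ψ) {B : ℝ} (hB : ∀ x, ‖ψ x‖ ≤ B) (z : E) :
    sing ε M (rho e) ψ z = ∫ s in Set.Ioi (0 : ℝ), (kap ε M s : ℂ) * rhoConv e ψ s z := by
  have hint : Integrable (fun w : ℝ × E => (kap ε M w.1 : ℂ) * rho e w.2 * ψ (z - w.1 • w.2))
      ((volume.restrict (Set.Ioi 0)).prod volume) :=
    integrable_mul_shift (integrable_sing_kernel hε hM (integrable_rho he)) measurable_dil hψ hB z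
  rw [sing, dilInt, dilMeasure, integral_prod _ hint]
  congr 1
  ext s
  rw [rhoConv, ← integral_const_mul]
  congr 1
  ext u
  ring

theorem lintegral_swap_rhoConv (e : E) {ψ : E → ℂ} (hψ : Measurable ψ) {c : ℝ → ℝ≥0∞}
    (hc : Measurable c) (S : Set E) :
    ∫⁻ z in S, ∫⁻ s in Set.Ioi (0 : ℝ), c s * ‖rhoConv e ψ s z‖ₑ =
      ∫⁻ s in Set.Ioi (0 : ℝ), c s * ∫⁻ z in S, ‖rhoConv e ψ s z‖ₑ := by
  rw [lintegral_lintegral_swap]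
  · refine lintegral_congr fun s => ?_
    have hm2 : Measurable fun z => ‖rhoConv e ψ s z‖ₑ := (measurable_rhoConv_apply e hψ s).enorm
    rw [lintegral_const_mul _ hm2]
  · exact ((hc.comp measurable_snd).mul (measurable_rhoConv_swap e hψ).enorm).aemeasurable

theorem enorm_kap_le {ε M s : ℝ} (hε : 0 < ε) (hM : ε ≤ M) (hs : 0 < s) :
    ‖(kap ε M s : ℂ)‖ₑ ≤ ENNReal.ofReal s⁻¹ := by
  rw [← ofReal_norm, Complex.norm_real, Real.norm_eq_abs, abs_of_nonneg (kap_nonneg hε hM hs.le)]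
  exact ENNReal.ofReal_le_ofReal (kap_le_inv hs)

theorem lintegral_sing_rho_le {ε M : ℝ} (hε : 0 < ε) (hM : ε ≤ M) {e : E} (he : ‖e‖ = 1)
    {R : ℝ} {ψ : E → ℂ} (h : Profile R ψ) :
    ∫⁻ z, ‖sing ε M (rho e) ψ z‖ₑ ≤ rieszMass e ψ := by
  obtain ⟨B, hB⟩ := h.exists_bound
  calc ∫⁻ z, ‖sing ε M (rho e) ψ z‖ₑ
      ≤ ∫⁻ z, ∫⁻ s in Set.Ioi (0 : ℝ), ENNReal.ofReal s⁻¹ * ‖rhoConv e ψ s z‖ₑ := by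
        refine lintegral_mono fun z => ?_
        rw [sing_rho_eq hε (hε.trans_le hM) he h.measurable hB]
        refine (enorm_integral_le_lintegral_enorm _).trans (lintegral_mono_ae ?_)
        refine (ae_restrict_mem measurableSet_Ioi).mono fun s hs => ?_
        rw [enorm_mul]
        gcongr
        exact enorm_kap_le hε hM hs
    _ = rieszMass e ψ := by
        have := lintegral_swap_rhoConv e h.measurable
          (c := fun s => ENNReal.ofReal s⁻¹) (by fun_prop) Set.univ
        simpa [rieszMass] using this

theorem lintegral_rieszLim_le (e : E) {ψ : E → ℂ} (hψ : Measurable ψ) (S : Set E) :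
    ∫⁻ z in S, ‖rieszLim e ψ z‖ₑ ≤
      ∫⁻ s in Set.Ioi (0 : ℝ), ENNReal.ofReal s⁻¹ * ∫⁻ z in S, ‖rhoConv e ψ s z‖ₑ := by
  rw [← lintegral_swap_rhoConv e hψ (c := fun s => ENNReal.ofReal s⁻¹) (by fun_prop) S]
  refine lintegral_mono fun z => (enorm_integral_le_lintegral_enorm _).trans
    (lintegral_mono_ae ?_)
  refine (ae_restrict_mem measurableSet_Ioi).mono fun s hs => ?_
  have hs0 : (0 : ℝ) < s := hs
  rw [enorm_mul, ← ofReal_norm ((s⁻¹ : ℝ) : ℂ), Complex.norm_real, Real.norm_eq_abs,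
    abs_of_pos (by positivity)]

theorem integrable_rieszLim {e : E} (he : ‖e‖ = 1) {R : ℝ} {ψ : E → ℂ} (h : Profile R ψ) :
    Integrable (rieszLim e ψ) := by
  refine ⟨(measurable_rieszLim e h.measurable).aestronglyMeasurable, ?_⟩
  have := lintegral_rieszLim_le e h.measurable Set.univ
  simp only [Measure.restrict_univ] at this
  exact this.trans_lt (rieszMass_lt_top he h)

/-- Dominated convergence in the scale `s`, the majorant being the integrand of `rieszMass`.
Arbitrary truncation sequences are admitted because rescaling by `t` will turn `1/(N+1)` and `N+1`
into `1/((N+1)t)` and `(N+1)/t`. -/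
theorem tendsto_lintegral_sing_rho_sub {e : E} (he : ‖e‖ = 1) {R : ℝ} {ψ : E → ℂ}
    (h : Profile R ψ) {ε M : ℕ → ℝ} (hε : ∀ N, 0 < ε N) (hM : ∀ N, ε N ≤ M N)
    (hlim : ∀ s, 0 < s → Tendsto (fun N => kap (ε N) (M N) s) atTop (𝓝 s⁻¹)) :
    Tendsto (fun N => ∫⁻ z, ‖sing (ε N) (M N) (rho e) ψ z - rieszLim e ψ z‖ₑ) atTop (𝓝 0) := by
  obtain ⟨B, hB⟩ := h.exists_bound
  have hm := measurable_rhoConv e h.measurable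
  have hJ : Measurable fun s => ∫⁻ z, ‖rhoConv e ψ s z‖ₑ := hm.enorm.lintegral_prod_right'
  have hfin := (rieszMass_lt_top he h).ne
  have hae : ∀ᵐ z : E, IntegrableOn (fun s : ℝ => ((s⁻¹ : ℝ) : ℂ) * rhoConv e ψ s z)
      (Set.Ioi 0) := by
    have hsw := lintegral_swap_rhoConv e h.measurable
      (c := fun s => ENNReal.ofReal s⁻¹) (by fun_prop) Set.univ
    simp only [Measure.restrict_univ] at hsw
    have hmm : Measurable fun z => ∫⁻ s in Set.Ioi (0 : ℝ),
        ENNReal.ofReal s⁻¹ * ‖rhoConv e ψ s z‖ₑ := by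
      have : Measurable fun w : E × ℝ => ENNReal.ofReal w.2⁻¹ * ‖rhoConv e ψ w.2 w.1‖ₑ :=
        (by fun_prop : Measurable fun w : E × ℝ => ENNReal.ofReal w.2⁻¹).mul
          (measurable_rhoConv_swap e h.measurable).enorm
      exact this.lintegral_prod_right'
    filter_upwards [ae_lt_top hmm (by rw [hsw]; exact hfin)] with z hz
    refine ⟨?_, lt_of_le_of_lt (lintegral_mono_ae ?_) hz⟩
    · exact ((Complex.measurable_ofReal.comp measurable_inv).mul
        (measurable_rhoConv_param e h.measurable z)).aestronglyMeasurable
    · refine (ae_restrict_mem measurableSet_Ioi).mono fun s hs => ?_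
      have hs0 : (0 : ℝ) < s := hs
      rw [enorm_mul, ← ofReal_norm ((s⁻¹ : ℝ) : ℂ), Complex.norm_real, Real.norm_eq_abs,
        abs_of_pos (by positivity)]
  have hcm : ∀ N, Measurable fun s : ℝ => ‖((kap (ε N) (M N) s - s⁻¹ : ℝ) : ℂ)‖ₑ := fun N => by
    unfold kap; fun_prop
  have hbound : ∀ N s, 0 < s → ‖((kap (ε N) (M N) s - s⁻¹ : ℝ) : ℂ)‖ₑ ≤ ENNReal.ofReal s⁻¹ := by
    intro N s hs
    rw [← ofReal_norm, Complex.norm_real, Real.norm_eq_abs]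
    refine ENNReal.ofReal_le_ofReal (abs_le.2 ⟨?_, ?_⟩)
    · linarith [kap_nonneg (hε N) (hM N) hs.le]
    · have : 0 < s⁻¹ := by positivity
      linarith [kap_le_inv (ε := ε N) (M := M N) hs]
  have hle : ∀ N, ∫⁻ z, ‖sing (ε N) (M N) (rho e) ψ z - rieszLim e ψ z‖ₑ ≤
      ∫⁻ s in Set.Ioi (0 : ℝ), ‖((kap (ε N) (M N) s - s⁻¹ : ℝ) : ℂ)‖ₑ *
        ∫⁻ z, ‖rhoConv e ψ s z‖ₑ := by
    intro N
    have hsw := lintegral_swap_rhoConv e h.measurable (hcm N) Set.univ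
    simp only [Measure.restrict_univ] at hsw
    rw [← hsw]
    refine lintegral_mono_ae (hae.mono fun z hz => ?_)
    have hz2 : IntegrableOn (fun s : ℝ => (kap (ε N) (M N) s : ℂ) * rhoConv e ψ s z)
        (Set.Ioi 0) := by
      refine Integrable.mono hz (measurable_kap_ofReal.mul
        (measurable_rhoConv_param e h.measurable z)).aestronglyMeasurable ?_
      refine (ae_restrict_mem measurableSet_Ioi).mono fun s hs => ?_
      have hs0 : (0 : ℝ) < s := hs
      rw [norm_mul, norm_mul, Complex.norm_real, Complex.norm_real, Real.norm_eq_abs,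
        Real.norm_eq_abs, abs_of_nonneg (kap_nonneg (hε N) (hM N) hs0.le),
        abs_of_pos (inv_pos.2 hs0)]
      gcongr
      exact kap_le_inv hs0
    rw [sing_rho_eq (hε N) ((hε N).trans_le (hM N)) he h.measurable hB, rieszLim,
      ← integral_sub hz2 hz]
    refine (enorm_integral_le_lintegral_enorm _).trans_eq (lintegral_congr fun s => ?_)
    rw [← sub_mul, enorm_mul]
    push_cast
    rfl
  refine tendsto_of_tendsto_of_tendsto_of_le_of_le tendsto_const_nhds ?_ (fun N => zero_le) hle
  have h0 : (0 : ℝ≥0∞) = ∫⁻ s in Set.Ioi (0 : ℝ), 0 := by simp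
  rw [h0]
  refine tendsto_lintegral_of_dominated_convergence
    (fun s => ENNReal.ofReal s⁻¹ * ∫⁻ z, ‖rhoConv e ψ s z‖ₑ) (fun N => (hcm N).mul hJ)
    (fun N => (ae_restrict_mem measurableSet_Ioi).mono fun s hs => ?_) hfin ?_
  · simp only
    gcongr
    exact hbound N s hs
  · have hne : ∀ᵐ s ∂(volume.restrict (Set.Ioi (0 : ℝ))),
        ENNReal.ofReal s⁻¹ * ∫⁻ z, ‖rhoConv e ψ s z‖ₑ < ⊤ :=
      ae_lt_top ((by fun_prop : Measurable fun s : ℝ => ENNReal.ofReal s⁻¹).mul hJ) hfin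
    filter_upwards [hne, ae_restrict_mem measurableSet_Ioi] with s hs1 hs2
    have hs0 : (0 : ℝ) < s := hs2
    have hJs : ∫⁻ z, ‖rhoConv e ψ s z‖ₑ ≠ ⊤ := by
      intro ht
      rw [ht, ENNReal.mul_top (by simpa using hs0)] at hs1
      exact lt_irrefl _ hs1
    have h1 : Tendsto (fun N => ‖((kap (ε N) (M N) s - s⁻¹ : ℝ) : ℂ)‖ₑ) atTop (𝓝 0) := by
      have h2 : Tendsto (fun N => ((kap (ε N) (M N) s - s⁻¹ : ℝ) : ℂ)) atTop (𝓝 0) := by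
        have h3 := (hlim s hs0).sub_const s⁻¹
        rw [sub_self] at h3
        have h4 := (Complex.continuous_ofReal.tendsto _).comp h3
        rw [Complex.ofReal_zero] at h4
        exact h4
      have h5 := (continuous_enorm.tendsto _).comp h2
      rw [enorm_zero] at h5
      exact h5
    simpa using ENNReal.Tendsto.mul_const h1 (Or.inr hJs)

end RoughCommutator

/-! ### The `L^1` norm of Riesz transforms of profiles, and composition with Riesz transforms. -/

namespace RoughCommutator

variable {E : Type*} [NormedAddCommGroup E] [InnerProductSpace ℝ E] [FiniteDimensional ℝ E]
  [MeasurableSpace E] [BorelSpace E]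

theorem one_div_pos_nat (N : ℕ) : (0 : ℝ) < 1 / (N + 1) := by positivity

theorem one_div_le_nat (N : ℕ) : (1 : ℝ) / (N + 1) ≤ N + 1 := by
  rw [div_le_iff₀ (by positivity)]
  nlinarith [(Nat.cast_nonneg N : (0 : ℝ) ≤ N)]

/-- The Riesz transforms of profiles are integrable, with control by an `L^v` norm. -/
theorem exists_lintegral_rieszLim_le {e : E} (he : ‖e‖ = 1) {R : ℝ} (hR : 0 < R) {v : ℝ≥0∞}
    (hv : 1 < v) (hvt : v ≠ ⊤) :
    ∃ C : ℝ≥0∞, C ≠ ⊤ ∧ ∀ ψ : E → ℂ, Profile R ψ →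
      ∫⁻ z, ‖rieszLim e ψ z‖ₑ ≤ C * (eLpNorm ψ v volume + eLpNorm ψ 1 volume) := by
  obtain ⟨Cv, hCv, hHb⟩ := exists_hilbBound hv hvt
  set S : Set E := {z | 2 * R < ‖z‖} with hS
  have hSm : MeasurableSet S := measurableSet_lt measurable_const measurable_norm
  have hSc : volume Sᶜ ≠ ⊤ := by
    have : Sᶜ ⊆ Metric.closedBall (0 : E) (2 * R) := by
      intro z hz
      simpa [hS] using hz
    exact ((measure_mono this).trans_lt measure_closedBall_lt_top).ne
  set A₁ : ℝ≥0∞ := ∫⁻ u, ‖u‖ₑ * ‖rho e u‖ₑ with hA₁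
  set A₂ : ℝ≥0∞ := ∫⁻ u, ‖fderiv ℝ (rho e) u‖ₑ with hA₂
  set A₃ : ℝ≥0∞ := ∫⁻ u, ‖rho e u‖ₑ with hA₃
  have hA₁t : A₁ ≠ ⊤ := (lintegral_norm_mul_rho_lt_top he).ne
  have hA₂t : A₂ ≠ ⊤ := (lintegral_fderiv_rho_lt_top he).ne
  have hA₃t : A₃ ≠ ⊤ := (integrable_rho he).2.ne
  have hvr : 1 < v.toReal := by
    rw [← ENNReal.toReal_one]; exact (ENNReal.toReal_lt_toReal (by simp) hvt).2 hv
  set V : ℝ≥0∞ := volume Sᶜ ^ (1 / (1 : ℝ≥0∞).toReal - 1 / v.toReal) with hV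
  have hVt : V ≠ ⊤ := by
    refine ENNReal.rpow_ne_top_of_nonneg ?_ hSc
    simp only [ENNReal.toReal_one, div_one, sub_nonneg]
    exact div_le_one_of_le₀ hvr.le (by linarith)
  set C₁ : ℝ≥0∞ := A₁ * ENNReal.ofReal R⁻¹ + A₂ * ENNReal.ofReal R with hC₁
  set C₂ : ℝ≥0∞ := A₃ * Cv * V with hC₂
  have hC₁t : C₁ ≠ ⊤ := ENNReal.add_ne_top.2 ⟨ENNReal.mul_ne_top hA₁t ENNReal.ofReal_ne_top,
    ENNReal.mul_ne_top hA₂t ENNReal.ofReal_ne_top⟩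
  have hC₂t : C₂ ≠ ⊤ := ENNReal.mul_ne_top (ENNReal.mul_ne_top hA₃t hCv) hVt
  refine ⟨C₂ + C₁, ENNReal.add_ne_top.2 ⟨hC₂t, hC₁t⟩, fun ψ hψ => ?_⟩
  obtain ⟨B, hB⟩ := hψ.exists_bound
  have hψ1 : eLpNorm ψ 1 volume = ∫⁻ x, ‖ψ x‖ₑ := eLpNorm_one_eq_lintegral_enorm
  -- Off the ball, the far bound replaces the one for small `s`, so only the `L^1` norm of `ψ`
  -- enters.
  have hfar : ∫⁻ z in S, ‖rieszLim e ψ z‖ₑ ≤ C₁ * eLpNorm ψ 1 volume := by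
    refine (lintegral_rieszLim_le e hψ.measurable S).trans ((lintegral_inv_mul_le
      (fun s hs => lintegral_rhoConv_le_far hψ.measurable hR hψ.supp hs)
      (fun s hs => (setLIntegral_le_lintegral _ _).trans (lintegral_rhoConv_le_large he
        hψ.measurable hψ.integrable hψ.mean hψ.supp hs))).trans_eq ?_)
    rw [hψ1, hC₁]
    ring
  -- On the ball, Hölder's inequality reduces `L^1` to `L^v`, where the truncated Riesz transforms
  -- are bounded by the method of rotations, `rho e` being odd. Convergence in `L^1` then removes
  -- the truncation.
  have hnear : ∫⁻ z in Sᶜ, ‖rieszLim e ψ z‖ₑ ≤ C₂ * eLpNorm ψ v volume := by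
    have hlim := tendsto_lintegral_sing_rho_sub he hψ one_div_pos_nat one_div_le_nat
      (fun s hs => tendsto_kap hs)
    have hb : ∀ N : ℕ, ∫⁻ z in Sᶜ, ‖rieszLim e ψ z‖ₑ ≤ C₂ * eLpNorm ψ v volume +
        ∫⁻ z, ‖sing (1 / ((N : ℝ) + 1)) (N + 1) (rho e) ψ z - rieszLim e ψ z‖ₑ := by
      intro N
      set g := sing (1 / ((N : ℝ) + 1)) (N + 1) (rho e) ψ with hg
      have hgm : Measurable g := measurable_sing (continuous_rho e).measurable hψ.measurable
      have h1 : ∫⁻ z in Sᶜ, ‖g z‖ₑ ≤ C₂ * eLpNorm ψ v volume := by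
        rw [← eLpNorm_one_eq_lintegral_enorm]
        refine (eLpNorm_le_eLpNorm_mul_rpow_measure_univ hv.le
          hgm.aestronglyMeasurable).trans ?_
        rw [Measure.restrict_apply_univ, ← hV]
        calc eLpNorm g v (volume.restrict Sᶜ) * V ≤ eLpNorm g v volume * V := by
              gcongr
              exact Measure.restrict_le_self
          _ ≤ (A₃ * (Cv * eLpNorm ψ v volume)) * V := by
              gcongr
              exact eLpNorm_sing_le_of_odd hv hvt hHb (one_div_pos_nat N)
                ((one_div_pos_nat N).trans_le (one_div_le_nat N)) (continuous_rho e).measurable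
                (integrable_rho he) (rho_neg e) hψ.measurable hB
          _ = _ := by rw [hC₂]; ring
      calc ∫⁻ z in Sᶜ, ‖rieszLim e ψ z‖ₑ
          ≤ ∫⁻ z in Sᶜ, (‖g z‖ₑ + ‖g z - rieszLim e ψ z‖ₑ) := by
            refine lintegral_mono fun z => ?_
            calc ‖rieszLim e ψ z‖ₑ = ‖g z - (g z - rieszLim e ψ z)‖ₑ := by simp
              _ ≤ _ := enorm_sub_le
        _ = (∫⁻ z in Sᶜ, ‖g z‖ₑ) + ∫⁻ z in Sᶜ, ‖g z - rieszLim e ψ z‖ₑ :=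
            lintegral_add_left hgm.enorm _
        _ ≤ _ := add_le_add h1 (setLIntegral_le_lintegral _ _)
    have hl : Tendsto (fun N : ℕ => C₂ * eLpNorm ψ v volume +
        ∫⁻ z, ‖sing (1 / ((N : ℝ) + 1)) (N + 1) (rho e) ψ z - rieszLim e ψ z‖ₑ) atTop
        (𝓝 (C₂ * eLpNorm ψ v volume)) := by
      simpa using (tendsto_const_nhds (x := C₂ * eLpNorm ψ v volume)).add hlim
    exact ge_of_tendsto' hl hb
  calc ∫⁻ z, ‖rieszLim e ψ z‖ₑ
      = (∫⁻ z in S, ‖rieszLim e ψ z‖ₑ) + ∫⁻ z in Sᶜ, ‖rieszLim e ψ z‖ₑ :=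
        (lintegral_add_compl _ hSm).symm
    _ ≤ C₁ * eLpNorm ψ 1 volume + C₂ * eLpNorm ψ v volume := add_le_add hfar hnear
    _ ≤ (C₂ + C₁) * eLpNorm ψ 1 volume + (C₂ + C₁) * eLpNorm ψ v volume := by
        gcongr
        · exact le_add_self
        · exact le_self_add
    _ = _ := by ring

/-! ### Composition with a truncated Riesz transform -/

theorem integrable_prod_shift {α : Type*} [MeasurableSpace α] {μ : Measure α} [SFinite μ]
    {a : α → ℂ} (ham : Measurable a) (ha : Integrable a μ) {φ : α → E} (hφ : Measurable φ)
    {ψ : E → ℂ} (hψm : Measurable ψ) (hψ : Integrable ψ) :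
    Integrable (fun w : α × E => a w.1 * ψ (w.2 - φ w.1)) (μ.prod volume) := by
  have hm : Measurable fun w : α × E => a w.1 * ψ (w.2 - φ w.1) :=
    (ham.comp measurable_fst).mul (hψm.comp (measurable_snd.sub (hφ.comp measurable_fst)))
  refine ⟨hm.aestronglyMeasurable, ?_⟩
  rw [HasFiniteIntegral, lintegral_prod _ hm.enorm.aemeasurable]
  have h1 : ∀ x, ∫⁻ y, ‖a x * ψ (y - φ x)‖ₑ = ‖a x‖ₑ * ∫⁻ y, ‖ψ y‖ₑ := by
    intro x
    simp_rw [enorm_mul]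
    have hm2 : Measurable fun y => ‖ψ (y - φ x)‖ₑ := (hψm.comp (by fun_prop)).enorm
    rw [lintegral_const_mul _ hm2, lintegral_sub_right_eq_self (fun y => ‖ψ y‖ₑ)]
  simp_rw [h1]
  rw [lintegral_mul_const _ ham.enorm]
  exact ENNReal.mul_lt_top ha.2 hψ.2

theorem sing_rho_rescale {α β : ℝ} (hα : 0 < α) (hβ : 0 < β) {e : E} (he : ‖e‖ = 1) {h : E → ℂ}
    (hm : Measurable h) {B : ℝ} (hB : ∀ x, ‖h x‖ ≤ B) {t : ℝ} (ht : 0 < t) (w : E) :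
    sing α β (rho e) h w = ∫ z, (kap (α / t) (β / t) z.1 : ℂ) * rho e z.2 *
      h (w - (t * z.1) • z.2) ∂(dilMeasure E) := by
  have hint : Integrable (fun z : ℝ × E => (kap (α / t) (β / t) z.1 : ℂ) * rho e z.2 *
      h (w - (t * z.1) • z.2)) ((volume.restrict (Set.Ioi 0)).prod volume) :=
    integrable_mul_shift (integrable_sing_kernel (div_pos hα ht) (div_pos hβ ht)
      (integrable_rho he)) (φ := fun z : ℝ × E => (t * z.1) • z.2) (by fun_prop) hm hB w
  rw [sing_rho_eq hα hβ he hm hB, dilMeasure, integral_prod _ hint]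
  have h1 := integral_comp_mul_left_Ioi (fun s => (kap α β s : ℂ) * rhoConv e h s w) 0 ht
  rw [mul_zero] at h1
  have h2 : ∫ s in Set.Ioi (0 : ℝ), (kap α β s : ℂ) * rhoConv e h s w =
      (t : ℂ) * ∫ s in Set.Ioi (0 : ℝ), (kap α β (t * s) : ℂ) * rhoConv e h (t * s) w := by
    have ht' : (t : ℂ) ≠ 0 := by exact_mod_cast ht.ne'
    rw [h1, Complex.real_smul, ← mul_assoc]
    push_cast
    rw [mul_inv_cancel₀ ht', one_mul]
  rw [h2, ← integral_const_mul]
  congr 1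
  ext s
  dsimp only
  rw [← kap_scale ht, rhoConv, ← mul_assoc, ← integral_const_mul]
  congr 1
  ext u
  push_cast
  ring

/-- Convolutions commute, so the truncated Riesz transform passes from `h` to the dilate of `ψ`.
Undoing the dilation by `t` divides both truncation parameters by `t`. -/
theorem integral_mul_sing_rho {α β : ℝ} (hα : 0 < α) (hβ : 0 < β) {e : E} (he : ‖e‖ = 1)
    {h : E → ℂ} (hm : Measurable h) {B : ℝ} (hB : ∀ x, ‖h x‖ ≤ B) {R : ℝ} {ψ : E → ℂ}
    (hψ : Profile R ψ) {t : ℝ} (ht : 0 < t) (x : E) :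
    ∫ y, ψ y * sing α β (rho e) h (x - t • y) =
      ∫ z, sing (α / t) (β / t) (rho e) ψ z * h (x - t • z) := by
  set a : ℝ × E → ℂ := fun z => (kap (α / t) (β / t) z.1 : ℂ) * rho e z.2 with ha
  have ham : Measurable a := measurable_sing_kernel (continuous_rho e).measurable
  have hai : Integrable a (dilMeasure E) :=
    integrable_sing_kernel (div_pos hα ht) (div_pos hβ ht) (integrable_rho he)
  have e1 : ∀ y, ψ y * sing α β (rho e) h (x - t • y) =
      ∫ z, a z * ψ y * h (x - t • y - (t * z.1) • z.2) ∂(dilMeasure E) := by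
    intro y
    rw [sing_rho_rescale hα hβ he hm hB ht, ← integral_const_mul]
    congr 1
    ext z
    rw [ha]
    ring
  have i1 : Integrable (fun w : E × (ℝ × E) => a w.2 * ψ w.1 *
      h (x - t • w.1 - (t * w.2.1) • w.2.2)) (volume.prod (dilMeasure E)) := by
    have h1 : Integrable (fun w : E × (ℝ × E) => a w.2 * ψ w.1) (volume.prod (dilMeasure E)) := by
      refine (hψ.integrable.mul_prod hai).congr (ae_of_all _ fun w => mul_comm _ _)
    refine h1.mul_bdd (Measurable.aestronglyMeasurable ?_) (ae_of_all _ fun w => hB _)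
    exact hm.comp (by fun_prop)
  simp_rw [e1]
  rw [integral_integral_swap i1]
  have e2 : ∀ z : ℝ × E, ∫ y, a z * ψ y * h (x - t • y - (t * z.1) • z.2) =
      ∫ y, a z * ψ (y - z.1 • z.2) * h (x - t • y) := by
    intro z
    rw [← integral_sub_right_eq_self _ (z.1 • z.2)]
    congr 1
    ext y
    congr 2
    rw [smul_sub, smul_smul]
    abel
  simp_rw [e2]
  have i2 : Integrable (fun w : (ℝ × E) × E => a w.1 * ψ (w.2 - w.1.1 • w.1.2) * h (x - t • w.2))
      ((dilMeasure E).prod volume) := by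
    refine (integrable_prod_shift ham hai measurable_dil hψ.measurable hψ.integrable).mul_bdd
      (Measurable.aestronglyMeasurable ?_) (ae_of_all _ fun w => hB _)
    exact hm.comp (by fun_prop)
  rw [integral_integral_swap i2]
  congr 1
  ext y
  rw [sing, dilInt, ← integral_mul_const]

/-- The kernel of the composition of a singular integral with a truncated Riesz transform. -/
def compKernel (ε M : ℝ) (N : ℕ) (e : E) (ψ : E → ℂ) (z : ℝ × E) : ℂ :=
  (kap ε M z.1 : ℂ) * sing (1 / (N + 1) / z.1) ((N + 1) / z.1) (rho e) ψ z.2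

theorem measurable_compKernel (ε M : ℝ) (N : ℕ) (e : E) {ψ : E → ℂ} (hψ : Measurable ψ) :
    Measurable (compKernel ε M N e ψ) := by
  have hk : Measurable fun w : (ℝ × E) × (ℝ × E) =>
      (kap (1 / (N + 1) / w.1.1) ((N + 1) / w.1.1) w.2.1 : ℂ) := by
    unfold kap; fun_prop
  have h1 : Measurable fun w : (ℝ × E) × (ℝ × E) =>
      (kap (1 / (N + 1) / w.1.1) ((N + 1) / w.1.1) w.2.1 : ℂ) * rho e w.2.2 *
        ψ (w.1.2 - w.2.1 • w.2.2) :=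
    (hk.mul ((continuous_rho e).measurable.comp (by fun_prop))).mul (hψ.comp (by fun_prop))
  exact (measurable_kap_ofReal.comp measurable_fst).mul
    (h1.stronglyMeasurable.integral_prod_right (ν := dilMeasure E)).measurable

theorem lintegral_dilMeasure {g : ℝ × E → ℝ≥0∞} (hg : Measurable g) :
    ∫⁻ z, g z ∂(dilMeasure E) = ∫⁻ t in Set.Ioi (0 : ℝ), ∫⁻ y, g (t, y) :=
  lintegral_prod _ hg.aemeasurable

/-- The inner truncation parameters depend on `t`, but `rieszMass` bounds the inner integral
uniformly in them. -/
theorem integrable_compKernel {ε M : ℝ} (hε : 0 < ε) (hM : 0 < M) (N : ℕ) {e : E}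
    (he : ‖e‖ = 1) {R : ℝ} {ψ : E → ℂ} (hψ : Profile R ψ) :
    Integrable (compKernel ε M N e ψ) (dilMeasure E) := by
  have hm := measurable_compKernel ε M N e hψ.measurable
  refine ⟨hm.aestronglyMeasurable, ?_⟩
  rw [HasFiniteIntegral, lintegral_dilMeasure hm.enorm]
  calc ∫⁻ t in Set.Ioi (0 : ℝ), ∫⁻ y, ‖compKernel ε M N e ψ (t, y)‖ₑ
      ≤ ∫⁻ t in Set.Ioi (0 : ℝ), ‖(kap ε M t : ℂ)‖ₑ * rieszMass e ψ := by
        refine setLIntegral_mono (measurable_kap_ofReal.enorm.mul_const _) fun t ht => ?_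
        have ht0 : (0 : ℝ) < t := ht
        have hm2 : Measurable (sing (1 / ((N : ℝ) + 1) / t) ((N + 1) / t) (rho e) ψ) :=
          measurable_sing (continuous_rho e).measurable hψ.measurable
        simp only [compKernel, enorm_mul]
        rw [lintegral_const_mul _ hm2.enorm]
        gcongr
        refine lintegral_sing_rho_le (div_pos (one_div_pos_nat N) ht0) ?_ he hψ
        gcongr
        exact one_div_le_nat N
    _ ≤ (∫⁻ t, ‖(kap ε M t : ℂ)‖ₑ) * rieszMass e ψ := by
        rw [lintegral_mul_const _ measurable_kap_ofReal.enorm]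
        gcongr
        exact Measure.restrict_le_self
    _ < ⊤ := ENNReal.mul_lt_top (integrable_kap_ofReal hε hM).2 (rieszMass_lt_top he hψ)

theorem sing_riesz_eq {ε M : ℝ} (hε : 0 < ε) (hM : 0 < M) (N : ℕ) {e : E} (he : ‖e‖ = 1)
    {R : ℝ} {ψ : E → ℂ} (hψ : Profile R ψ) {h : E → ℂ} (hm : Measurable h) {B : ℝ}
    (hB : ∀ x, ‖h x‖ ≤ B) (x : E) :
    sing ε M ψ (riesz N e h) x = dilInt (compKernel ε M N e ψ) h x := by
  have hN := one_div_pos_nat N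
  have hN' : (0 : ℝ) < N + 1 := hN.trans_le (one_div_le_nat N)
  have hrm : Measurable (riesz N e h) := measurable_sing (continuous_rho e).measurable hm
  have hrb := norm_sing_le hN hN' (integrable_rho he) hB
  have i1 : Integrable (fun z : ℝ × E => (kap ε M z.1 : ℂ) * ψ z.2 *
      riesz N e h (x - z.1 • z.2)) ((volume.restrict (Set.Ioi 0)).prod volume) :=
    integrable_mul_shift (integrable_sing_kernel hε hM hψ.integrable) measurable_dil hrm hrb x
  have i2 : Integrable (fun z : ℝ × E => compKernel ε M N e ψ z * h (x - z.1 • z.2))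
      ((volume.restrict (Set.Ioi 0)).prod volume) :=
    integrable_mul_shift (integrable_compKernel hε hM N he hψ) measurable_dil hm hB x
  rw [sing, dilInt, dilInt, dilMeasure, integral_prod _ i1, integral_prod _ i2]
  refine setIntegral_congr_fun measurableSet_Ioi fun t ht => ?_
  have ht0 : (0 : ℝ) < t := ht
  simp only [compKernel, mul_assoc]
  rw [integral_const_mul, integral_const_mul, ← integral_mul_sing_rho hN hN' he hm hB hψ ht0]
  rfl

end RoughCommutator

namespace RoughCommutator

variable {E : Type*} [NormedAddCommGroup E] [InnerProductSpace ℝ E] [FiniteDimensional ℝ E]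
  [MeasurableSpace E] [BorelSpace E]

/-! ### Singular integrals with smooth even kernels -/

/-- The difference between the kernel of a composition and its limit. -/
def compError (ε M : ℝ) (e : E) (ψ : E → ℂ) (N : ℕ) : ℝ≥0∞ :=
  ∫⁻ z, ‖compKernel ε M N e ψ z - (kap ε M z.1 : ℂ) * rieszLim e ψ z.2‖ₑ ∂(dilMeasure E)

/-- For fixed `t` the rescaled truncations still exhaust the half-line as `N → ∞`, so the inner
`L^1` distance tends to zero. Twice `rieszMass` times the integrable function `|kap ε M t|`
dominates; here `ε` and `M` stay fixed. -/
theorem tendsto_compError {ε M : ℝ} (hε : 0 < ε) (hM : ε ≤ M) {e : E}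
    (he : ‖e‖ = 1) {R : ℝ} {ψ : E → ℂ} (hψ : Profile R ψ) :
    Tendsto (compError ε M e ψ) atTop (𝓝 0) := by
  have hmr := measurable_rieszLim e hψ.measurable
  have hm : ∀ N : ℕ, Measurable fun z : ℝ × E =>
      ‖compKernel ε M N e ψ z - (kap ε M z.1 : ℂ) * rieszLim e ψ z.2‖ₑ := fun N =>
    ((measurable_compKernel ε M N e hψ.measurable).sub (measurable_sing_kernel hmr)).enorm
  have hkey : ∀ (N : ℕ) (t : ℝ),
      ∫⁻ y, ‖compKernel ε M N e ψ (t, y) - (kap ε M t : ℂ) * rieszLim e ψ y‖ₑ =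
      ‖(kap ε M t : ℂ)‖ₑ *
        ∫⁻ y, ‖sing (1 / ((N : ℝ) + 1) / t) ((N + 1) / t) (rho e) ψ y - rieszLim e ψ y‖ₑ := by
    intro N t
    have hm2 : Measurable fun y =>
        ‖sing (1 / ((N : ℝ) + 1) / t) ((N + 1) / t) (rho e) ψ y - rieszLim e ψ y‖ₑ :=
      ((measurable_sing (continuous_rho e).measurable hψ.measurable).sub hmr).enorm
    rw [← lintegral_const_mul _ hm2]
    simp only [compKernel, ← mul_sub, enorm_mul]
  have hE : compError ε M e ψ = fun N : ℕ => ∫⁻ t in Set.Ioi (0 : ℝ),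
      ∫⁻ y, ‖compKernel ε M N e ψ (t, y) - (kap ε M t : ℂ) * rieszLim e ψ y‖ₑ := by
    ext N
    exact lintegral_dilMeasure (hm N)
  rw [hE]
  have h0 : (0 : ℝ≥0∞) = ∫⁻ s in Set.Ioi (0 : ℝ), 0 := by simp
  rw [h0]
  have hpos : ∀ (N : ℕ) {t : ℝ}, 0 < t → 0 < 1 / ((N : ℝ) + 1) / t := fun N t ht =>
    div_pos (one_div_pos_nat N) ht
  have hle : ∀ (N : ℕ) {t : ℝ}, 0 < t → 1 / ((N : ℝ) + 1) / t ≤ (N + 1) / t := fun N t ht => by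
    gcongr
    exact one_div_le_nat N
  refine tendsto_lintegral_of_dominated_convergence
    (fun t => ‖(kap ε M t : ℂ)‖ₑ * (rieszMass e ψ + rieszMass e ψ))
    (fun N => (hm N).lintegral_prod_right') (fun N =>
      (ae_restrict_mem measurableSet_Ioi).mono fun t ht => ?_) ?_
    ((ae_restrict_mem measurableSet_Ioi).mono fun t ht => ?_)
  · simp only [hkey]
    gcongr
    calc _ ≤ ∫⁻ y, (‖sing (1 / ((N : ℝ) + 1) / t) ((N + 1) / t) (rho e) ψ y‖ₑ +
          ‖rieszLim e ψ y‖ₑ) := lintegral_mono fun y => enorm_sub_le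
      _ = _ := lintegral_add_right _ hmr.enorm
      _ ≤ _ := by
        refine add_le_add (lintegral_sing_rho_le (hpos N ht) (hle N ht) he hψ) ?_
        simpa [rieszMass] using lintegral_rieszLim_le e hψ.measurable Set.univ
  · rw [lintegral_mul_const _ measurable_kap_ofReal.enorm]
    have h1 := (rieszMass_lt_top he hψ)
    exact (ENNReal.mul_lt_top (integrable_kap_ofReal hε (hε.trans_le hM)).integrableOn.2
      (ENNReal.add_lt_top.2 ⟨h1, h1⟩)).ne
  · simp only [hkey]
    have ht0 : (0 : ℝ) < t := ht
    have h1 := tendsto_lintegral_sing_rho_sub he hψ (fun N => hpos N ht0) (fun N => hle N ht0)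
      (fun s hs => by
        have h2 := (tendsto_kap (mul_pos ht0 hs)).mul_const t
        have h3 : (t * s)⁻¹ * t = s⁻¹ := by field_simp
        rw [h3] at h2
        exact h2.congr fun N => kap_scale ht0 s)
    simpa using ENNReal.Tendsto.const_mul h1 (Or.inr (enorm_ne_top (x := (kap ε M t : ℂ))))

/-- The kernel of the composition is that of `sing ε M (rieszLim e ψ)` plus an error. The first is
generated by an odd function and falls under the method of rotations; the error is bounded crudely
by its `L^1` norm. -/
theorem eLpNorm_sing_riesz_le {p C : ℝ≥0∞} (hp : 1 < p) (hpt : p ≠ ⊤) (hC : HilbBound p C)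
    {ε M : ℝ} (hε : 0 < ε) (hM : 0 < M) (N : ℕ) {e : E} (he : ‖e‖ = 1)
    {R : ℝ} {ψ : E → ℂ} (hψ : Profile R ψ) {h : E → ℂ} (hm : Measurable h) {B : ℝ}
    (hB : ∀ x, ‖h x‖ ≤ B) :
    eLpNorm (sing ε M ψ (riesz N e h)) p volume ≤
      ((∫⁻ z, ‖rieszLim e ψ z‖ₑ) * C + compError ε M e ψ N) * eLpNorm h p volume := by
  have hmr := measurable_rieszLim e hψ.measurable
  set d : ℝ × E → ℂ := fun z => compKernel ε M N e ψ z - (kap ε M z.1 : ℂ) * rieszLim e ψ z.2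
    with hd
  have hdm : Measurable d :=
    (measurable_compKernel ε M N e hψ.measurable).sub (measurable_sing_kernel hmr)
  have hk := integrable_sing_kernel hε hM (integrable_rieszLim he hψ)
  have hdi : Integrable d (dilMeasure E) := (integrable_compKernel hε hM N he hψ).sub hk
  have heq : sing ε M ψ (riesz N e h) = sing ε M (rieszLim e ψ) h + dilInt d h := by
    ext x
    rw [sing_riesz_eq hε hM N he hψ hm hB, Pi.add_apply, sing, dilInt, dilInt, dilInt,
      ← integral_add (integrable_mul_shift hk measurable_dil hm hB x)
        (integrable_mul_shift hdi measurable_dil hm hB x)]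
    congr 1
    ext z
    rw [hd]
    ring
  rw [heq]
  refine (eLpNorm_add_le (measurable_sing hmr hm).aestronglyMeasurable
    (measurable_dilInt hdm hm).aestronglyMeasurable hp.le).trans ?_
  rw [add_mul]
  refine add_le_add ?_ (eLpNorm_dilInt_le hp.le hpt hdm hm)
  refine (eLpNorm_sing_le_of_odd hp hpt hC hε hM hmr (integrable_rieszLim he hψ)
    (rieszLim_neg e hψ.even) hm hB).trans_eq (by ring)

theorem dilInt_sum {ι : Type*} (s : Finset ι) {a : ℝ × E → ℂ} (ha : Integrable a (dilMeasure E))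
    {f : ι → E → ℂ} (hf : ∀ i, Measurable (f i)) {B : ι → ℝ} (hB : ∀ i x, ‖f i x‖ ≤ B i) (x : E) :
    dilInt a (fun y => ∑ i ∈ s, f i y) x = ∑ i ∈ s, dilInt a (f i) x := by
  simp only [dilInt]
  rw [← integral_finsetSum s fun i _ =>
    integrable_mul_shift ha measurable_dil (hf i) (hB i) x]
  simp only [Finset.mul_sum]

theorem tendsto_dilInt {a : ℝ × E → ℂ} (ha : Integrable a (dilMeasure E))
    {f : ℕ → E → ℂ} {g : E → ℂ} (hf : ∀ N, Measurable (f N)) {B : ℝ} (hB : ∀ N x, ‖f N x‖ ≤ B)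
    (hlim : ∀ x, Tendsto (fun N => f N x) atTop (𝓝 (g x))) (x : E) :
    Tendsto (fun N => dilInt a (f N) x) atTop (𝓝 (dilInt a g x)) := by
  refine tendsto_integral_of_dominated_convergence (fun z => ‖a z‖ * B) (fun N => ?_)
    (ha.norm.mul_const B) (fun N => ae_of_all _ fun z => ?_)
    (ae_of_all _ fun z => (hlim _).const_mul _)
  · exact (integrable_mul_shift ha measurable_dil (hf N) (hB N) x).aestronglyMeasurable
  · rw [norm_mul]
    gcongr
    exact hB N _

/-- Fatou's lemma, in the form that passes uniform bounds to the limit. -/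
theorem eLpNorm_le_of_tendsto {p : ℝ≥0∞} {F : ℕ → E → ℂ} {G : E → ℂ}
    (hF : ∀ N, AEStronglyMeasurable (F N)) (hlim : ∀ᵐ x, Tendsto (fun N => F N x) atTop (𝓝 (G x)))
    {D : ℕ → ℝ≥0∞} {D₀ : ℝ≥0∞} (hD : ∀ N, eLpNorm (F N) p volume ≤ D N)
    (hD₀ : Tendsto D atTop (𝓝 D₀)) : eLpNorm G p volume ≤ D₀ := by
  refine (Lp.eLpNorm_lim_le_liminf_eLpNorm hF G hlim).trans ?_
  rw [← hD₀.liminf_eq]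
  exact liminf_le_liminf (Eventually.of_forall hD)

/-- Uniform boundedness of the truncated singular integrals generated by smooth even profiles. -/
theorem exists_eLpNorm_sing_le_of_profile [Nontrivial E] {p v : ℝ≥0∞} (hp : 1 < p) (hpt : p ≠ ⊤)
    (hv : 1 < v) (hvt : v ≠ ⊤) {R : ℝ} (hR : 0 < R) :
    ∃ C : ℝ≥0∞, C ≠ ⊤ ∧ ∀ ψ : E → ℂ, Profile R ψ → ∀ ε M : ℝ, 0 < ε → ε ≤ M →
      ∀ f : E → ℂ, ContDiff ℝ ∞ f → HasCompactSupport f →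
      eLpNorm (sing ε M ψ f) p volume ≤
        C * (eLpNorm ψ v volume + eLpNorm ψ 1 volume) * eLpNorm f p volume := by
  obtain ⟨C, hC, hHb⟩ := exists_hilbBound hp hpt
  set b := stdOrthonormalBasis ℝ E with hb
  have hbn : ∀ i, ‖b i‖ = 1 := b.orthonormal.1
  choose D hD hDle using fun i => exists_lintegral_rieszLim_le (hbn i) hR hv hvt
  set A : Fin (Module.finrank ℝ E) → ℝ≥0∞ := fun i => ∫⁻ u, ‖rho (b i) u‖ₑ with hA
  have hAt : ∀ i, A i ≠ ⊤ := fun i => (integrable_rho (hbn i)).2.ne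
  -- In each summand `D i * C` comes from the Riesz transform moved onto `ψ` and `A i * C` from the
  -- one left on `f`; the factor `4` inverts `∑ R_i² = -1/4`.
  refine ⟨4 * ∑ i, D i * C * (A i * C), ?_, fun ψ hψ ε M hε hM f hf hs => ?_⟩
  · refine ENNReal.mul_ne_top (by simp) (ENNReal.sum_ne_top.2 fun i _ => ?_)
    exact ENNReal.mul_ne_top (ENNReal.mul_ne_top (hD i) hC) (ENNReal.mul_ne_top (hAt i) hC)
  have hM0 := hε.trans_le hM
  obtain ⟨Bf, hBf⟩ := hs.exists_bound_of_continuous hf.continuous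
  have hfm := hf.continuous.measurable
  have hmR : ∀ N i, Measurable (riesz N (b i) f) := fun N i =>
    measurable_sing (continuous_rho _).measurable hfm
  have hmRR : ∀ N i, Measurable (riesz N (b i) (riesz N (b i) f)) := fun N i =>
    measurable_sing (continuous_rho _).measurable (hmR N i)
  have hN' : ∀ N : ℕ, (0 : ℝ) < N + 1 := fun N => (one_div_pos_nat N).trans_le (one_div_le_nat N)
  have hbR := fun N i => norm_sing_le (one_div_pos_nat N) (hN' N) (integrable_rho (hbn i)) hBf
  have hbRR := fun N i => norm_sing_le (one_div_pos_nat N) (hN' N) (integrable_rho (hbn i))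
    (hbR N i)
  obtain ⟨BB, hBB⟩ := norm_sum_riesz_le b hf hs
  set F : ℕ → E → ℂ := fun N x => ∑ i, riesz N (b i) (riesz N (b i) f) x with hF
  have hki := integrable_sing_kernel hε hM0 hψ.integrable
  have hlim : ∀ x, Tendsto (fun N => (-4 : ℂ) * sing ε M ψ (F N) x) atTop (𝓝 (sing ε M ψ f x)) := by
    intro x
    have h1 := (tendsto_dilInt hki (fun N => Finset.measurable_sum _ fun i _ => hmRR N i) hBB
      (tendsto_sum_riesz b hf hs) x).const_mul (-4 : ℂ)
    have h2 : (-4 : ℂ) * dilInt (fun z => (kap ε M z.1 : ℂ) * ψ z.2)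
        (fun x => -(1 / 4) * f x) x = sing ε M ψ f x := by
      rw [sing, dilInt, dilInt, ← integral_const_mul]
      congr 1
      ext z
      ring
    rw [h2] at h1
    exact h1
  have hsum : ∀ N x, sing ε M ψ (F N) x =
      ∑ i, sing ε M ψ (riesz N (b i) (riesz N (b i) f)) x := fun N x =>
    dilInt_sum Finset.univ hki (hmRR N) (hbRR N) x
  -- The error need not be uniform in `ε`, `M` or `ψ`, because it vanishes as `N → ∞` before the
  -- bound is recorded.
  set Q : ℕ → ℝ≥0∞ := fun N => 4 * ∑ i, ((∫⁻ z, ‖rieszLim (b i) ψ z‖ₑ) * C +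
    compError ε M (b i) ψ N) * (A i * (C * eLpNorm f p volume)) with hQ
  have hle : ∀ N, eLpNorm (fun x => (-4 : ℂ) * sing ε M ψ (F N) x) p volume ≤ Q N := by
    intro N
    have h4 : (fun x => (-4 : ℂ) * sing ε M ψ (F N) x) =
        (-4 : ℂ) • ∑ i, sing ε M ψ (riesz N (b i) (riesz N (b i) f)) := by
      ext x
      simp [hsum]
    rw [h4, eLpNorm_const_smul]
    have h5 : ‖(-4 : ℂ)‖ₑ = 4 := by
      rw [enorm_neg, ← ofReal_norm]
      simp
    rw [h5, hQ]
    refine mul_le_mul_right ?_ 4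
    refine (eLpNorm_sum_le (fun i _ =>
      (measurable_sing hψ.measurable (hmRR N i)).aestronglyMeasurable) hp.le).trans ?_
    refine Finset.sum_le_sum fun i _ => ?_
    refine (eLpNorm_sing_riesz_le hp hpt hHb hε hM0 N (hbn i) hψ (hmR N i) (hbR N i)).trans ?_
    gcongr
    exact eLpNorm_sing_le_of_odd hp hpt hHb (one_div_pos_nat N) (hN' N)
      (continuous_rho _).measurable (integrable_rho (hbn i)) (rho_neg _) hfm hBf
  have hfin : eLpNorm f p volume ≠ ⊤ :=
    (hf.continuous.memLp_of_hasCompactSupport hs).2.ne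
  have hQlim : Tendsto Q atTop (𝓝 (4 * ∑ i, ((∫⁻ z, ‖rieszLim (b i) ψ z‖ₑ) * C + 0) *
      (A i * (C * eLpNorm f p volume)))) := by
    refine ENNReal.Tendsto.const_mul (tendsto_finsetSum _ fun i _ => ?_) (Or.inr (by simp))
    refine ENNReal.Tendsto.mul_const (tendsto_const_nhds.add
      (tendsto_compError hε hM (hbn i) hψ)) (Or.inr ?_)
    exact ENNReal.mul_ne_top (hAt i) (ENNReal.mul_ne_top hC hfin)
  refine (eLpNorm_le_of_tendsto (fun N => ?_) (ae_of_all _ hlim) hle hQlim).trans ?_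
  · exact ((measurable_sing hψ.measurable
      (Finset.measurable_sum _ fun i _ => hmRR N i)).const_mul _).aestronglyMeasurable
  · rw [mul_assoc, mul_assoc, Finset.sum_mul]
    refine mul_le_mul_right (Finset.sum_le_sum fun i _ => ?_) 4
    rw [add_zero]
    calc _ ≤ D i * (eLpNorm ψ v volume + eLpNorm ψ 1 volume) * C *
          (A i * (C * eLpNorm f p volume)) := by
          gcongr
          exact hDle i ψ hψ
      _ = _ := by ring

end RoughCommutator

namespace RoughCommutator

variable {E : Type*} [NormedAddCommGroup E] [InnerProductSpace ℝ E] [FiniteDimensional ℝ E]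
  [MeasurableSpace E] [BorelSpace E]

/-! ### Singular integrals with rough kernels -/

theorem eLpNorm_comp_neg (p : ℝ≥0∞) {f : E → ℂ} (hf : AEStronglyMeasurable f volume) :
    eLpNorm (fun x => f (-x)) p volume = eLpNorm f p volume :=
  eLpNorm_comp_measurePreserving hf (Measure.measurePreserving_neg volume)

theorem eLpNorm_half_add_comp_neg_le {p : ℝ≥0∞} (hp : 1 ≤ p) {f : E → ℂ}
    (hf : AEStronglyMeasurable f volume) :
    eLpNorm (fun x => (f x + f (-x)) / 2) p volume ≤ eLpNorm f p volume := by
  have hf' : AEStronglyMeasurable (fun x => f (-x)) volume :=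
    hf.comp_measurePreserving (Measure.measurePreserving_neg volume)
  have e : (fun x => (f x + f (-x)) / 2) = (2⁻¹ : ℂ) • (f + fun x => f (-x)) := by
    ext x
    simp only [Pi.smul_apply, Pi.add_apply, smul_eq_mul]
    ring
  rw [e, eLpNorm_const_smul]
  calc ‖(2⁻¹ : ℂ)‖ₑ * eLpNorm (f + fun x => f (-x)) p volume
      ≤ ‖(2⁻¹ : ℂ)‖ₑ * (eLpNorm f p volume + eLpNorm f p volume) := by
        gcongr
        refine (eLpNorm_add_le hf hf' hp).trans_eq ?_
        rw [eLpNorm_comp_neg p hf]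
    _ = eLpNorm f p volume := by
        have h2 : ‖(2⁻¹ : ℂ)‖ₑ = 2⁻¹ := by
          rw [enorm_inv (by norm_num), ← ofReal_norm]
          simp
        rw [h2, ← two_mul, ← mul_assoc, ENNReal.inv_mul_cancel (by simp) (by simp), one_mul]

/-- Hölder's inequality for functions supported in a ball. -/
theorem exists_eLpNorm_one_le_of_supp (R : ℝ) {v : ℝ≥0∞} (hv : 1 ≤ v) :
    ∃ V : ℝ≥0∞, V ≠ ⊤ ∧ ∀ f : E → ℂ, AEStronglyMeasurable f volume →
      (∀ x, R < ‖x‖ → f x = 0) → eLpNorm f 1 volume ≤ eLpNorm f v volume * V := by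
  set S : Set E := Metric.closedBall 0 R with hS
  refine ⟨volume S ^ (1 / (1 : ℝ≥0∞).toReal - 1 / v.toReal), ?_, fun f hf hs => ?_⟩
  · refine ENNReal.rpow_ne_top_of_nonneg ?_ measure_closedBall_lt_top.ne
    rcases eq_or_ne v ⊤ with rfl | hvt
    · simp
    have : 1 ≤ v.toReal := by
      rw [← ENNReal.toReal_one]; exact ENNReal.toReal_mono hvt hv
    simp only [ENNReal.toReal_one, div_one, sub_nonneg]
    exact div_le_one_of_le₀ this (by linarith)
  · have h1 : ∀ q, eLpNorm f q (volume.restrict S) = eLpNorm f q volume := fun q => by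
      refine eLpNorm_restrict_eq_of_support_subset fun x hx => ?_
      by_contra hxS
      exact hx (hs x (by simpa [hS] using hxS))
    have := eLpNorm_le_eLpNorm_mul_rpow_measure_univ hv (hf.restrict (s := S))
    rwa [h1, h1, Measure.restrict_apply_univ] at this

theorem exists_even_bump : ∃ β : E → ℂ, ContDiff ℝ ∞ β ∧ (∀ x, 3 < ‖x‖ → β x = 0) ∧
    (∀ x, β (-x) = β x) ∧ ∫ x, β x = 1 := by
  let φ : ContDiffBump (0 : E) := ⟨1, 2, by norm_num, by norm_num⟩
  refine ⟨fun x => (φ.normed volume x : ℂ), ?_, fun x hx => ?_, fun x => ?_, ?_⟩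
  · exact Complex.ofRealCLM.contDiff.comp φ.contDiff_normed
  · have : x ∉ Function.support (φ.normed volume) := by
      rw [φ.support_normed_eq]
      simp only [Metric.mem_ball, dist_zero_right, not_lt]
      change (2 : ℝ) ≤ ‖x‖
      linarith
    simpa using this
  · simp only [φ.normed_neg]
  · rw [integral_complex_ofReal, φ.integral_normed]
    simp

/-- Even functions in `L^v` with integral zero are approximated by smooth profiles. -/
theorem exists_profile_approx {v : ℝ≥0∞} (hv : 1 ≤ v) (hvt : v ≠ ⊤) {ψ : E → ℂ}
    (hψ : MemLp ψ v volume) (hsupp : ∀ x, 2 < ‖x‖ → ψ x = 0) (heven : ∀ x, ψ (-x) = ψ x)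
    (hmean : ∫ x, ψ x = 0) :
    ∃ K : ℝ≥0∞, K ≠ ⊤ ∧ ∀ δ : ℝ, 0 < δ → ∃ χ : E → ℂ, Profile 3 χ ∧
      eLpNorm (χ - ψ) v volume ≤ K * ENNReal.ofReal δ ∧
      eLpNorm (χ - ψ) 1 volume ≤ K * ENNReal.ofReal δ := by
  obtain ⟨V, hV, hVle⟩ := exists_eLpNorm_one_le_of_supp (E := E) 3 hv
  obtain ⟨β, hβs, hβ0, hβe, hβ1⟩ := exists_even_bump (E := E)
  have hβc : HasCompactSupport β :=
    HasCompactSupport.intro (isCompact_closedBall 0 3) fun x hx => hβ0 x (by simpa using hx)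
  have hβv : MemLp β v volume := hβs.continuous.memLp_of_hasCompactSupport hβc
  have hβi : MemLp β 1 volume := hβs.continuous.memLp_of_hasCompactSupport hβc
  have hKt : 1 + V * eLpNorm β v volume ≠ ⊤ :=
    ENNReal.add_ne_top.2 ⟨by simp, ENNReal.mul_ne_top hV hβv.2.ne⟩
  refine ⟨(1 + V * eLpNorm β v volume) * (1 + V), ENNReal.mul_ne_top hKt (by simp [hV]),
    fun δ hδ => ?_⟩
  obtain ⟨χ₀, hχ₀c, hχ₀s, hχ₀⟩ := MemLp.exist_eLpNorm_sub_le hvt hv hψ hδ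
  -- The cutoff equals one on the ball carrying `ψ` and is at most one elsewhere, so multiplying by
  -- it does not increase the distance to `ψ`.
  let φ : ContDiffBump (0 : E) := ⟨2, 3, by norm_num, by norm_num⟩
  set χ₁ : E → ℂ := fun x => (φ x : ℂ) * χ₀ x with hχ₁
  have hφ0 : ∀ x, 3 < ‖x‖ → φ x = 0 := fun x hx =>
    φ.zero_of_le_dist (by rw [dist_zero_right]; exact hx.le)
  have hφ1 : ∀ x, ‖x‖ ≤ 2 → φ x = 1 := fun x hx =>
    φ.one_of_mem_closedBall (by simpa using hx)
  have hχ₁s : ContDiff ℝ ∞ χ₁ := (Complex.ofRealCLM.contDiff.comp φ.contDiff).mul hχ₀s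
  have hψm := hψ.1
  have h1 : eLpNorm (χ₁ - ψ) v volume ≤ ENNReal.ofReal δ := by
    rw [eLpNorm_sub_comm] at hχ₀
    refine (eLpNorm_mono fun x => ?_).trans hχ₀
    have e1 : (χ₁ - ψ) x = (φ x : ℂ) * (χ₀ - ψ) x := by
      rcases le_or_gt ‖x‖ 2 with hx | hx
      · simp [hχ₁, hφ1 x hx]
      · simp [hχ₁, hsupp x hx]
    rw [e1, norm_mul, Complex.norm_real, Real.norm_eq_abs, abs_of_nonneg φ.nonneg]
    exact mul_le_of_le_one_left (norm_nonneg _) φ.le_one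
  set χ₂ : E → ℂ := fun x => (χ₁ x + χ₁ (-x)) / 2 with hχ₂
  have hχ₂s : ContDiff ℝ ∞ χ₂ := (hχ₁s.add (hχ₁s.comp contDiff_neg)).div_const 2
  have hχ₂0 : ∀ x, 3 < ‖x‖ → χ₂ x = 0 := fun x hx => by
    simp [hχ₂, hχ₁, hφ0 x hx, hφ0 (-x) (by rwa [norm_neg])]
  have hχ₂c : HasCompactSupport χ₂ :=
    HasCompactSupport.intro (isCompact_closedBall 0 3) fun x hx => hχ₂0 x (by simpa using hx)
  have h2 : eLpNorm (χ₂ - ψ) v volume ≤ ENNReal.ofReal δ := by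
    have e2 : χ₂ - ψ = fun x => ((χ₁ - ψ) x + (χ₁ - ψ) (-x)) / 2 := by
      ext x
      simp only [Pi.sub_apply, hχ₂, heven]
      ring
    rw [e2]
    exact (eLpNorm_half_add_comp_neg_le hv
      (hχ₁s.continuous.aestronglyMeasurable.sub hψm)).trans h1
  have hm2 : AEStronglyMeasurable (χ₂ - ψ) volume :=
    hχ₂s.continuous.aestronglyMeasurable.sub hψm
  have hs2 : ∀ x, 3 < ‖x‖ → (χ₂ - ψ) x = 0 := fun x hx => by
    simp [hχ₂0 x hx, hsupp x (by linarith)]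
  have h3 : eLpNorm (χ₂ - ψ) 1 volume ≤ ENNReal.ofReal δ * V :=
    (hVle _ hm2 hs2).trans (by gcongr)
  have hψi : Integrable ψ := by
    refine memLp_one_iff_integrable.1 ⟨hψm, (hVle ψ hψm fun x hx => hsupp x
      (by linarith)).trans_lt (ENNReal.mul_lt_top hψ.2 hV.lt_top)⟩
  have hχ₂i : Integrable χ₂ := hχ₂s.continuous.integrable_of_hasCompactSupport hχ₂c
  set c : ℂ := ∫ x, χ₂ x with hc
  have hcle : ‖c‖ₑ ≤ ENNReal.ofReal δ * V := by
    have : c = ∫ x, (χ₂ - ψ) x := by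
      simp only [Pi.sub_apply]
      rw [integral_sub hχ₂i hψi, hmean, sub_zero]
    rw [this]
    refine (enorm_integral_le_lintegral_enorm _).trans ?_
    rwa [← eLpNorm_one_eq_lintegral_enorm]
  -- A multiple of an even bump restores mean zero; its coefficient is small because `ψ` has mean
  -- zero and `χ₂` is close to `ψ` in `L^1`.
  set χ : E → ℂ := χ₂ - c • β with hχ
  have hχs : ContDiff ℝ ∞ χ := hχ₂s.sub (contDiff_const.smul hβs)
  have hχ0 : ∀ x, 3 < ‖x‖ → χ x = 0 := fun x hx => by simp [hχ, hχ₂0 x hx, hβ0 x hx]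
  have h4 : eLpNorm (χ - ψ) v volume ≤ (1 + V * eLpNorm β v volume) * ENNReal.ofReal δ := by
    have e4 : χ - ψ = (χ₂ - ψ) - c • β := by rw [hχ]; abel
    rw [e4]
    refine (eLpNorm_sub_le hm2 (hβv.1.const_smul c) hv).trans ?_
    rw [eLpNorm_const_smul]
    calc _ ≤ ENNReal.ofReal δ + ENNReal.ofReal δ * V * eLpNorm β v volume := by gcongr
      _ = _ := by ring
  refine ⟨χ, ⟨hχs, hχ0, fun x => ?_, ?_⟩, ?_, ?_⟩
  · simp only [hχ, hχ₂, Pi.sub_apply, Pi.smul_apply, hβe, neg_neg, add_comm]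
  · have hb : Integrable (c • β) := (memLp_one_iff_integrable.1 hβi).smul c
    have e5 : ∫ x, χ x = ∫ x, (χ₂ x - (c • β) x) := rfl
    rw [e5, integral_sub hχ₂i hb]
    simp only [Pi.smul_apply]
    rw [integral_smul, hβ1, hc]
    simp
  · refine h4.trans ?_
    gcongr
    exact le_mul_of_one_le_right zero_le le_self_add
  · refine (hVle _ (hχs.continuous.aestronglyMeasurable.sub hψm) fun x hx => ?_).trans ?_
    · simp [hχ0 x hx, hsupp x (by linarith)]
    · calc _ ≤ (1 + V * eLpNorm β v volume) * ENNReal.ofReal δ * V := by gcongr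
        _ ≤ (1 + V * eLpNorm β v volume) * ENNReal.ofReal δ * (1 + V) := by
          gcongr
          exact le_add_self
        _ = _ := by ring

theorem sing_add_profile {ε M : ℝ} (hε : 0 < ε) (hM : 0 < M) {η₁ η₂ : E → ℂ}
    (h₁ : Integrable η₁) (h₂ : Integrable η₂) {f : E → ℂ} (hf : Measurable f) {B : ℝ}
    (hB : ∀ x, ‖f x‖ ≤ B) (x : E) :
    sing ε M (η₁ + η₂) f x = sing ε M η₁ f x + sing ε M η₂ f x := by
  rw [sing, sing, sing, dilInt, dilInt, dilInt, ← integral_add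
    (integrable_mul_shift (integrable_sing_kernel hε hM h₁) measurable_dil hf hB x)
    (integrable_mul_shift (integrable_sing_kernel hε hM h₂) measurable_dil hf hB x)]
  congr 1
  ext z
  simp only [Pi.add_apply]
  ring

theorem integral_norm_sing_kernel (ε M : ℝ) (η : E → ℂ) :
    ∫ z : ℝ × E, ‖(kap ε M z.1 : ℂ) * η z.2‖ ∂(dilMeasure E) =
      (∫ t in Set.Ioi (0 : ℝ), ‖(kap ε M t : ℂ)‖) * ∫ y, ‖η y‖ := by
  simp only [norm_mul]
  exact integral_prod_mul (μ := volume.restrict (Set.Ioi (0 : ℝ)))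
    (fun t => ‖(kap ε M t : ℂ)‖) (fun y : E => ‖η y‖)

/-- For fixed truncation the kernel is integrable and depends linearly and continuously, in `L^1`,
on its generator; acting on a bounded function this gives pointwise convergence. -/
theorem tendsto_sing_profile {ε M : ℝ} (hε : 0 < ε) (hM : 0 < M) {η : ℕ → E → ℂ} {ψ : E → ℂ}
    (hη : ∀ k, Integrable (η k)) (hψ : Integrable ψ)
    (hlim : Tendsto (fun k => eLpNorm (η k - ψ) 1 volume) atTop (𝓝 0)) {f : E → ℂ}
    (hf : Measurable f) {B : ℝ} (hB : ∀ x, ‖f x‖ ≤ B) (x : E) :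
    Tendsto (fun k => sing ε M (η k) f x) atTop (𝓝 (sing ε M ψ f x)) := by
  rw [tendsto_iff_norm_sub_tendsto_zero]
  have hd : ∀ k, sing ε M (η k) f x - sing ε M ψ f x = sing ε M (η k - ψ) f x := fun k => by
    have := sing_add_profile hε hM ((hη k).sub hψ) hψ hf hB x
    rw [sub_add_cancel] at this
    rw [this, add_sub_cancel_right]
  have hle : ∀ k, ‖sing ε M (η k) f x - sing ε M ψ f x‖ ≤
      (∫ t in Set.Ioi (0 : ℝ), ‖(kap ε M t : ℂ)‖) * (eLpNorm (η k - ψ) 1 volume).toReal * B := by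
    intro k
    rw [hd k]
    refine (norm_sing_le hε hM ((hη k).sub hψ) hB x).trans_eq ?_
    rw [integral_norm_sing_kernel, eLpNorm_one_eq_lintegral_enorm,
      integral_norm_eq_lintegral_enorm ((hη k).sub hψ).1]
  refine squeeze_zero (fun k => norm_nonneg _) hle ?_
  have h1 := (ENNReal.tendsto_toReal (by simp)).comp hlim
  have h2 := (h1.const_mul (∫ t in Set.Ioi (0 : ℝ), ‖(kap ε M t : ℂ)‖)).mul_const B
  simpa using h2

/-- The bound for profiles sees `ψ` only through its `L^v` and `L^1` norms, so it survives
approximation by profiles in these norms and Fatou's lemma. -/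
theorem exists_eLpNorm_sing_le_of_even [Nontrivial E] {p v : ℝ≥0∞} (hp : 1 < p) (hpt : p ≠ ⊤)
    (hv : 1 < v) (hvt : v ≠ ⊤) {ψ : E → ℂ} (hψ : MemLp ψ v volume)
    (hsupp : ∀ x, 2 < ‖x‖ → ψ x = 0) (heven : ∀ x, ψ (-x) = ψ x) (hmean : ∫ x, ψ x = 0) :
    ∃ C : ℝ≥0∞, C ≠ ⊤ ∧ ∀ ε M : ℝ, 0 < ε → ε ≤ M →
      ∀ f : E → ℂ, ContDiff ℝ ∞ f → HasCompactSupport f →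
      eLpNorm (sing ε M ψ f) p volume ≤ C * eLpNorm f p volume := by
  obtain ⟨C, hC, hCle⟩ := exists_eLpNorm_sing_le_of_profile (E := E) hp hpt hv hvt
    (R := 3) (by norm_num)
  obtain ⟨K, hK, happ⟩ := exists_profile_approx hv.le hvt hψ hsupp heven hmean
  choose χ hχ hχv hχ1 using fun k : ℕ => happ (1 / (k + 1)) (one_div_pos_nat k)
  have hδ : Tendsto (fun k : ℕ => K * ENNReal.ofReal (1 / ((k : ℝ) + 1))) atTop (𝓝 0) := by
    have h1 := ENNReal.tendsto_ofReal (tendsto_one_div_add_atTop_nhds_zero_nat (𝕜 := ℝ))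
    simpa using ENNReal.Tendsto.const_mul h1 (Or.inr hK)
  have hψ1 : MemLp ψ 1 volume := hψ.mono_exponent_of_measure_support_ne_top
    (s := Metric.closedBall (0 : E) 2) (fun x hx => hsupp x (by simpa using hx))
    measure_closedBall_lt_top.ne hv.le
  refine ⟨C * (eLpNorm ψ v volume + eLpNorm ψ 1 volume),
    ENNReal.mul_ne_top hC (ENNReal.add_ne_top.2 ⟨hψ.2.ne, hψ1.2.ne⟩),
    fun ε M hε hM f hf hs => ?_⟩
  obtain ⟨B, hB⟩ := hs.exists_bound_of_continuous hf.continuous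
  have hfm := hf.continuous.measurable
  have hfin : eLpNorm f p volume ≠ ⊤ :=
    (hf.continuous.memLp_of_hasCompactSupport hs).2.ne
  refine eLpNorm_le_of_tendsto (F := fun k => sing ε M (χ k) f)
    (D := fun k => C * ((eLpNorm ψ v volume + K * ENNReal.ofReal (1 / ((k : ℝ) + 1))) +
      (eLpNorm ψ 1 volume + K * ENNReal.ofReal (1 / ((k : ℝ) + 1)))) * eLpNorm f p volume)
    (fun k => (measurable_sing (hχ k).measurable hfm).aestronglyMeasurable)
    (ae_of_all _ fun x => tendsto_sing_profile hε (hε.trans_le hM) (fun k => (hχ k).integrable)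
      (memLp_one_iff_integrable.1 hψ1) (tendsto_of_tendsto_of_tendsto_of_le_of_le
        tendsto_const_nhds hδ (fun k => zero_le) hχ1) hfm hB x) (fun k => ?_) ?_
  · refine (hCle (χ k) (hχ k) ε M hε hM f hf hs).trans ?_
    have hkey : ∀ w : ℝ≥0∞, 1 ≤ w → MemLp ψ w volume → eLpNorm (χ k - ψ) w volume ≤
        K * ENNReal.ofReal (1 / ((k : ℝ) + 1)) → eLpNorm (χ k) w volume ≤
        eLpNorm ψ w volume + K * ENNReal.ofReal (1 / ((k : ℝ) + 1)) := by
      intro w hw hψw hle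
      have e : χ k = ψ + (χ k - ψ) := by abel
      calc eLpNorm (χ k) w volume = eLpNorm (ψ + (χ k - ψ)) w volume := by rw [← e]
        _ ≤ _ := (eLpNorm_add_le hψw.1
          ((hχ k).measurable.aestronglyMeasurable.sub hψw.1) hw).trans (by gcongr)
    gcongr
    · exact hkey v hv.le hψ (hχv k)
    · exact hkey 1 le_rfl hψ1 (hχ1 k)
  · refine ENNReal.Tendsto.mul_const (ENNReal.Tendsto.const_mul ?_ (Or.inr hC)) (Or.inr hfin)
    have := (hδ.const_add (eLpNorm ψ v volume)).add (hδ.const_add (eLpNorm ψ 1 volume))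
    simpa using this

/-- Uniform boundedness of the truncated singular integrals generated by a compactly supported
function in `L^v` with integral zero. -/
theorem exists_eLpNorm_sing_le [Nontrivial E] {p v : ℝ≥0∞} (hp : 1 < p) (hpt : p ≠ ⊤)
    (hv : 1 < v) {ψ : E → ℂ} (hψm : Measurable ψ) (hψ : MemLp ψ v volume)
    (hsupp : ∀ x, 2 < ‖x‖ → ψ x = 0) (hmean : ∫ x, ψ x = 0) :
    ∃ C : ℝ≥0∞, C ≠ ⊤ ∧ ∀ ε M : ℝ, 0 < ε → ε ≤ M →
      ∀ f : E → ℂ, ContDiff ℝ ∞ f → HasCompactSupport f →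
      eLpNorm (sing ε M ψ f) p volume ≤ C * eLpNorm f p volume := by
  have hlow : ∀ w : ℝ≥0∞, w ≤ v → MemLp ψ w volume := fun w hw =>
    hψ.mono_exponent_of_measure_support_ne_top
      (s := Metric.closedBall (0 : E) 2) (fun x hx => hsupp x (by simpa using hx))
      measure_closedBall_lt_top.ne hw
  have hψi : Integrable ψ := memLp_one_iff_integrable.1 (hlow 1 hv.le)
  have hneg : ∀ w : ℝ≥0∞, w ≤ v → MemLp (fun x => ψ (-x)) w volume := fun w hw =>
    (hlow w hw).comp_measurePreserving (Measure.measurePreserving_neg volume)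
  have hψi' : Integrable fun x => ψ (-x) := memLp_one_iff_integrable.1 (hneg 1 hv.le)
  -- Smooth approximation needs a finite exponent, whereas `v = ∞` is allowed; the bounded support
  -- makes lowering the exponent free.
  set w : ℝ≥0∞ := min v 2 with hw
  have hw1 : 1 < w := lt_min hv (by norm_num)
  have hwt : w ≠ ⊤ := ((min_le_right v 2).trans_lt (by simp)).ne
  have hwv : w ≤ v := min_le_left _ _
  set ψe : E → ℂ := fun x => (2⁻¹ : ℂ) * (ψ x + ψ (-x)) with hψe
  set ψo : E → ℂ := fun x => (2⁻¹ : ℂ) * (ψ x - ψ (-x)) with hψo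
  have hψei : Integrable ψe := (hψi.add hψi').const_mul _
  have hψoi : Integrable ψo := (hψi.sub hψi').const_mul _
  obtain ⟨C₁, hC₁, h₁⟩ := exists_eLpNorm_sing_le_of_even hp hpt hw1 hwt (ψ := ψe)
    (((hlow w hwv).add (hneg w hwv)).const_mul _)
    (fun x hx => by simp [hψe, hsupp x hx, hsupp (-x) (by rwa [norm_neg])])
    (fun x => by simp [hψe, add_comm])
    (by
      simp only [hψe]
      rw [integral_const_mul, integral_add hψi hψi', integral_neg_eq_self ψ, hmean]
      simp)
  obtain ⟨C₂, hC₂, hHb⟩ := exists_hilbBound hp hpt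
  refine ⟨C₁ + (∫⁻ y, ‖ψo y‖ₑ) * C₂, ENNReal.add_ne_top.2 ⟨hC₁, ENNReal.mul_ne_top hψoi.2.ne hC₂⟩,
    fun ε M hε hM f hf hs => ?_⟩
  obtain ⟨B, hB⟩ := hs.exists_bound_of_continuous hf.continuous
  have hfm := hf.continuous.measurable
  have hM0 := hε.trans_le hM
  have hmneg : Measurable fun x => ψ (-x) := hψm.comp measurable_neg
  have hme : Measurable ψe := (hψm.add hmneg).const_mul _
  have hmo : Measurable ψo := (hψm.sub hmneg).const_mul _
  have heq : sing ε M ψ f = sing ε M ψe f + sing ε M ψo f := by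
    ext x
    rw [Pi.add_apply, ← sing_add_profile hε hM0 hψei hψoi hfm hB]
    congr 1
    ext y
    simp only [hψe, hψo, Pi.add_apply]
    ring
  rw [heq, add_mul]
  refine (eLpNorm_add_le (measurable_sing hme hfm).aestronglyMeasurable
    (measurable_sing hmo hfm).aestronglyMeasurable hp.le).trans
    (add_le_add (h₁ ε M hε hM f hf hs) ?_)
  rw [mul_assoc]
  exact eLpNorm_sing_le_of_odd hp hpt hHb hε hM0 hmo hψoi
    (fun x => by simp only [hψo, neg_neg]; ring) hfm hB

end RoughCommutator

namespace RoughCommutator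

variable {E : Type*} [NormedAddCommGroup E] [InnerProductSpace ℝ E] [FiniteDimensional ℝ E]
  [MeasurableSpace E] [BorelSpace E]

/-! ### Homogeneous functions and polar coordinates -/

open Classical in
/-- The homogeneous extension of degree zero of a function on the unit sphere. -/
def sphereExt {α : Type*} [Zero α] (θ : Metric.sphere (0 : E) 1 → α) (z : E) : α :=
  if h : z ∈ ({0}ᶜ : Set E) then θ (homeomorphUnitSphereProd E ⟨z, h⟩).1 else 0

theorem sphereExt_coe {α : Type*} [Zero α] (θ : Metric.sphere (0 : E) 1 → α)
    (z : ({0}ᶜ : Set E)) : sphereExt θ z = θ (homeomorphUnitSphereProd E z).1 := by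
  rw [sphereExt, dif_pos z.2]

theorem sphereExt_zero {α : Type*} [Zero α] (θ : Metric.sphere (0 : E) 1 → α) :
    sphereExt θ 0 = 0 := by
  rw [sphereExt, dif_neg (by simp)]

theorem measurable_sphereExt {α : Type*} [Zero α] [MeasurableSpace α]
    {θ : Metric.sphere (0 : E) 1 → α} (hθ : Measurable θ) : Measurable (sphereExt θ) := by
  refine measurable_of_restrict_of_restrict_compl (measurableSet_singleton (0 : E)).compl ?_ ?_
  · have : Set.domRestrict ({0}ᶜ : Set E) (sphereExt θ) =
        fun z => θ (homeomorphUnitSphereProd E z).1 := by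
      ext z
      exact sphereExt_coe θ z
    rw [this]
    exact hθ.comp (measurable_fst.comp (homeomorphUnitSphereProd E).measurable)
  · have : Set.domRestrict ({0}ᶜᶜ : Set E) (sphereExt θ) = fun _ => 0 := by
      ext z
      have hz : (z : E) = 0 := by simpa using z.2
      rw [Set.domRestrict_apply, hz, sphereExt_zero]
    rw [this]
    exact measurable_const

theorem sphereExt_smul {α : Type*} [Zero α] (θ : Metric.sphere (0 : E) 1 → α) {t : ℝ}
    (ht : 0 < t) (z : E) : sphereExt θ (t • z) = sphereExt θ z := by
  by_cases hz : z = 0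
  · simp [hz]
  have htz : t • z ≠ 0 := smul_ne_zero ht.ne' hz
  rw [sphereExt, dif_pos (by simpa using htz), sphereExt, dif_pos (by simpa using hz)]
  congr 1
  apply Subtype.ext
  simp only [homeomorphUnitSphereProd_apply_fst_coe]
  rw [norm_smul, Real.norm_of_nonneg ht.le, smul_smul]
  congr 1
  field_simp

/-- Polar coordinates. The product formula for the integral needs no integrability, so the radial
factor may be arbitrary. -/
theorem integral_sphereExt_mul [Nontrivial E] (θ : Metric.sphere (0 : E) 1 → ℂ) (h : ℝ → ℂ) :
    ∫ z : E, sphereExt θ z * h ‖z‖ = (∫ x, θ x ∂(volume : Measure E).toSphere) *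
      ∫ r : Set.Ioi (0 : ℝ), h r ∂(Measure.volumeIoiPow (Module.finrank ℝ E - 1)) := by
  calc ∫ z : E, sphereExt θ z * h ‖z‖
      = ∫ z : ({0}ᶜ : Set E), sphereExt θ z * h ‖(z : E)‖ ∂((volume : Measure E).comap (↑)) := by
        rw [integral_subtype_comap (measurableSet_singleton _).compl
          fun z => sphereExt θ z * h ‖z‖, restrict_compl_singleton]
    _ = ∫ x, θ x.1 * h x.2 ∂(volume : Measure E).toSphere.prod
          (.volumeIoiPow (Module.finrank ℝ E - 1)) := by
        rw [← (volume : Measure E).measurePreserving_homeomorphUnitSphereProd.integral_comp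
          (Homeomorph.measurableEmbedding _)]
        simp [sphereExt_coe]
    _ = _ := integral_prod_mul θ fun r : Set.Ioi (0 : ℝ) => h r

theorem lintegral_sphereExt_mul [Nontrivial E] {θ : Metric.sphere (0 : E) 1 → ℝ≥0∞}
    (hθ : Measurable θ) {h : ℝ → ℝ≥0∞} (hh : Measurable h) :
    ∫⁻ z : E, sphereExt θ z * h ‖z‖ = (∫⁻ x, θ x ∂(volume : Measure E).toSphere) *
      ∫⁻ r in Set.Ioi (0 : ℝ), ENNReal.ofReal (r ^ (Module.finrank ℝ E - 1)) * h r := by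
  have hh' : Measurable fun r : Set.Ioi (0 : ℝ) => h r := hh.comp measurable_subtype_coe
  have hmm : Measurable fun x : Metric.sphere (0 : E) 1 × Set.Ioi (0 : ℝ) => θ x.1 * h x.2 :=
    (hθ.comp measurable_fst).mul (hh'.comp measurable_snd)
  calc ∫⁻ z : E, sphereExt θ z * h ‖z‖
      = ∫⁻ z : ({0}ᶜ : Set E), sphereExt θ z * h ‖(z : E)‖ ∂((volume : Measure E).comap (↑)) := by
        rw [lintegral_subtype_comap (measurableSet_singleton _).compl
          fun z => sphereExt θ z * h ‖z‖, restrict_compl_singleton]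
    _ = ∫⁻ x, θ x.1 * h x.2 ∂(volume : Measure E).toSphere.prod
          (.volumeIoiPow (Module.finrank ℝ E - 1)) := by
        rw [← (volume : Measure E).measurePreserving_homeomorphUnitSphereProd.lintegral_comp hmm]
        simp [sphereExt_coe]
    _ = (∫⁻ x, θ x ∂(volume : Measure E).toSphere) *
          ∫⁻ r : Set.Ioi (0 : ℝ), h r ∂(Measure.volumeIoiPow (Module.finrank ℝ E - 1)) :=
        lintegral_prod_mul hθ.aemeasurable hh'.aemeasurable
    _ = _ := by
        congr 1
        rw [Measure.volumeIoiPow, lintegral_withDensity_eq_lintegral_mul _ (by fun_prop) hh']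
        exact lintegral_subtype_comap measurableSet_Ioi
          fun r : ℝ => ENNReal.ofReal (r ^ (Module.finrank ℝ E - 1)) * h r

/-- A measurable function, homogeneous of degree zero, in `L^v` of the sphere, with mean zero. -/
structure Angular (v : ℝ) (Ω : E → ℂ) : Prop where
  one_lt : 1 < v
  measurable : Measurable Ω
  hom : ∀ t : ℝ, 0 < t → ∀ x, Ω (t • x) = Ω x
  cancel : ∀ h : ℝ → ℂ, ∫ x, Ω x * h ‖x‖ = 0
  bound_one : ∃ A : ℝ≥0∞, A ≠ ⊤ ∧ ∀ h : ℝ → ℝ≥0∞, Measurable h → ∫⁻ x, ‖Ω x‖ₑ * h ‖x‖ ≤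
    A * ∫⁻ r in Set.Ioi (0 : ℝ), ENNReal.ofReal (r ^ (Module.finrank ℝ E - 1)) * h r
  bound : ∃ A : ℝ≥0∞, A ≠ ⊤ ∧ ∀ h : ℝ → ℝ≥0∞, Measurable h → ∫⁻ x, ‖Ω x‖ₑ ^ v * h ‖x‖ ≤
    A * ∫⁻ r in Set.Ioi (0 : ℝ), ENNReal.ofReal (r ^ (Module.finrank ℝ E - 1)) * h r

theorem sphereExt_comp {α β : Type*} [Zero α] [Zero β] (F : α → β) (hF : F 0 = 0)
    (θ : Metric.sphere (0 : E) 1 → α) (z : E) : F (sphereExt θ z) = sphereExt (F ∘ θ) z := by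
  unfold sphereExt
  split_ifs
  · rfl
  · exact hF

/-- In polar coordinates a null set of the sphere spans a null cone, and homogeneity carries
equality along rays. -/
theorem ae_eq_sphereExt {Ω : E → ℂ} [Nontrivial E]
    (hhom : ∀ t : ℝ, 0 < t → ∀ x : E, ‖x‖ = 1 → Ω (t • x) = Ω x)
    {θ : Metric.sphere (0 : E) 1 → ℂ}
    (hθ : (fun x : Metric.sphere (0 : E) 1 => Ω x) =ᵐ[(volume : Measure E).toSphere] θ) :
    Ω =ᵐ[volume] sphereExt θ := by
  have h1 : ∀ᵐ x ∂((volume : Measure E).toSphere.prod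
      (.volumeIoiPow (Module.finrank ℝ E - 1))), Ω x.1 = θ x.1 :=
    Measure.quasiMeasurePreserving_fst.ae hθ
  have h2 : ∀ᵐ z : ({0}ᶜ : Set E) ∂((volume : Measure E).comap (↑)),
      Ω ((homeomorphUnitSphereProd E z).1 : E) = θ (homeomorphUnitSphereProd E z).1 :=
    (volume : Measure E).measurePreserving_homeomorphUnitSphereProd.quasiMeasurePreserving.ae h1
  have h3 : ∀ᵐ z : ({0}ᶜ : Set E) ∂((volume : Measure E).comap (↑)), Ω z = sphereExt θ z := by
    filter_upwards [h2] with z hz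
    have hz0 : (z : E) ≠ 0 := z.2
    have hzn : 0 < ‖(z : E)‖ := norm_pos_iff.2 hz0
    rw [sphereExt_coe, ← hz, homeomorphUnitSphereProd_apply_fst_coe,
      ← hhom ‖(z : E)‖ hzn (‖(z : E)‖⁻¹ • (z : E)) (by
        rw [norm_smul, norm_inv, norm_norm, inv_mul_cancel₀ hzn.ne']),
      smul_smul, mul_inv_cancel₀ hzn.ne', one_smul]
  have h4 := (ae_restrict_iff_subtype (μ := (volume : Measure E))
    (p := fun z => Ω z = sphereExt θ z) (measurableSet_singleton (0 : E)).compl).2 h3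
  rwa [restrict_compl_singleton] at h4

/-- Only the class of `Ω` on the sphere matters, so it may be replaced by a measurable and exactly
homogeneous representative. Testing against all radial profiles encodes the mean value and the norms
without further reference to the sphere; the exponent `min v 2` is finite. -/
theorem exists_angular [Nontrivial E] {v : ℝ≥0∞} (hv : 1 < v) {Ω : E → ℂ}
    (hhom : ∀ t : ℝ, 0 < t → ∀ x : E, ‖x‖ = 1 → Ω (t • x) = Ω x)
    (hmean : ∫ x : Metric.sphere (0 : E) 1, Ω x ∂(volume : Measure E).toSphere = 0)
    (hLv : MemLp (fun x : Metric.sphere (0 : E) 1 => Ω x) v (volume : Measure E).toSphere) :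
    ∃ (w : ℝ) (Ω' : E → ℂ), Angular w Ω' ∧ Ω =ᵐ[volume] Ω' := by
  set u : ℝ≥0∞ := min v 2 with hu
  have hu1 : 1 < u := lt_min hv (by norm_num)
  have hut : u ≠ ⊤ := ((min_le_right v 2).trans_lt (by simp)).ne
  have hu0 : u ≠ 0 := (zero_lt_one.trans hu1).ne'
  have hLu := hLv.mono_exponent (min_le_left v 2)
  have hL1 := hLv.mono_exponent hv.le
  set θ := hLv.1.mk _ with hθd
  have hθm : Measurable θ := hLv.1.stronglyMeasurable_mk.measurable
  have hθ := hLv.1.ae_eq_mk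
  refine ⟨u.toReal, sphereExt θ, ⟨?_, measurable_sphereExt hθm,
    fun t ht x => sphereExt_smul θ ht x, fun h => ?_, ?_, ?_⟩, ae_eq_sphereExt hhom hθ⟩
  · rw [← ENNReal.toReal_one]
    exact (ENNReal.toReal_lt_toReal (by simp) hut).2 hu1
  · rw [integral_sphereExt_mul, ← integral_congr_ae hθ, hmean, zero_mul]
  · refine ⟨∫⁻ x, ‖θ x‖ₑ ∂(volume : Measure E).toSphere, ?_, fun h hh => ?_⟩
    · have := ((memLp_congr_ae hθ).1 hL1).2
      rw [eLpNorm_one_eq_lintegral_enorm] at this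
      exact this.ne
    · have e : ∀ z, ‖sphereExt θ z‖ₑ = sphereExt (enorm ∘ θ) z :=
        sphereExt_comp (enorm : ℂ → ℝ≥0∞) enorm_zero θ
      simp_rw [e]
      exact (lintegral_sphereExt_mul hθm.enorm hh).le
  · refine ⟨∫⁻ x, ‖θ x‖ₑ ^ u.toReal ∂(volume : Measure E).toSphere, ?_, fun h hh => ?_⟩
    · exact (lintegral_rpow_enorm_lt_top_of_eLpNorm_lt_top hu0 hut
        ((memLp_congr_ae hθ).1 hLu).2).ne
    · have e : ∀ z, ‖sphereExt θ z‖ₑ ^ u.toReal = sphereExt ((fun c => ‖c‖ₑ ^ u.toReal) ∘ θ) z :=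
        sphereExt_comp (fun c : ℂ => ‖c‖ₑ ^ u.toReal)
          (by simp [ENNReal.toReal_pos hu0 hut]) θ
      simp_rw [e]
      exact (lintegral_sphereExt_mul (hθm.enorm.pow_const _) hh).le

end RoughCommutator

namespace RoughCommutator

variable {E : Type*} [NormedAddCommGroup E] [InnerProductSpace ℝ E] [FiniteDimensional ℝ E]
  [MeasurableSpace E] [BorelSpace E]

/-! ### Principal values -/

/-- The homogeneous kernel of degree `-d` with angular part `Ω`. -/
def ker (Ω : E → ℂ) (z : E) : ℂ := Ω z / ((‖z‖ ^ Module.finrank ℝ E : ℝ) : ℂ)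

/-- The difference `g (x - z) - g x`, where the second term is only present near the origin. -/
def pvReg (g : E → ℂ) (x z : E) : ℂ := g (x - z) - (Metric.closedBall (0 : E) 1).indicator
  (fun _ => g x) z

/-- The principal value integral, written as an absolutely convergent integral. -/
def pvInt (Ω g : E → ℂ) (x : E) : ℂ := ∫ z, ker Ω z * pvReg g x z

theorem measurable_pvReg {g : E → ℂ} (hg : Measurable g) (x : E) : Measurable (pvReg g x) :=
  (hg.comp (by fun_prop)).sub (measurable_const.indicator Metric.isClosed_closedBall.measurableSet)

/-- One linear bound covers both regimes: the Lipschitz constant inside the unit ball, where `g x`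
is subtracted, and outside it the supremum of `|g|`, since there `‖z‖ > 1`. -/
theorem exists_pvReg_bound {g : E → ℂ} (hg : ContDiff ℝ ∞ g) (hs : HasCompactSupport g) (x : E) :
    ∃ C ρ : ℝ, 0 ≤ C ∧ 0 < ρ ∧ ∀ z, ‖pvReg g x z‖ ≤ C * ‖z‖ ∧ (ρ < ‖z‖ → pvReg g x z = 0) := by
  obtain ⟨L, hL⟩ := ContDiff.lipschitzWith_of_hasCompactSupport hs hg (by simp)
  obtain ⟨B, hB⟩ := hs.exists_bound_of_continuous hg.continuous
  obtain ⟨R, hR⟩ := hs.isCompact.isBounded.subset_closedBall (0 : E)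
  have hB0 : 0 ≤ B := (norm_nonneg _).trans (hB 0)
  refine ⟨L + B, max 1 (R + ‖x‖), by positivity, by positivity, fun z => ⟨?_, fun hz => ?_⟩⟩
  · rcases le_or_gt ‖z‖ 1 with h1 | h1
    · rw [pvReg, Set.indicator_of_mem (by simpa using h1)]
      have := hL.dist_le_mul (x - z) x
      rw [dist_eq_norm, dist_eq_norm, sub_sub_cancel_left, norm_neg] at this
      nlinarith [norm_nonneg z]
    · rw [pvReg, Set.indicator_of_notMem (by simpa using h1), sub_zero]
      have := hB (x - z)
      have h2 : 0 ≤ (L : ℝ) * ‖z‖ := by positivity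
      nlinarith
  · rw [max_lt_iff] at hz
    rw [pvReg, Set.indicator_of_notMem (by simpa using hz.1), sub_zero]
    refine image_eq_zero_of_notMem_tsupport fun hmem => ?_
    have h1 := hR hmem
    rw [mem_closedBall_zero_iff] at h1
    have h2 : ‖z‖ ≤ ‖x - z‖ + ‖x‖ := by
      calc ‖z‖ = ‖x - (x - z)‖ := by simp
        _ ≤ ‖x‖ + ‖x - z‖ := norm_sub_le _ _
        _ = _ := add_comm _ _
    linarith [hz.2]

theorem measurable_ker {Ω : E → ℂ} (hΩ : Measurable Ω) : Measurable (ker Ω) :=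
  hΩ.div (by fun_prop)

theorem enorm_ker (Ω : E → ℂ) (z : E) :
    ‖ker Ω z‖ₑ = ‖Ω z‖ₑ * ENNReal.ofReal ((‖z‖ ^ Module.finrank ℝ E)⁻¹) := by
  rw [ker, div_eq_mul_inv, enorm_mul, ← Complex.ofReal_inv, ← ofReal_norm (((_ : ℝ)) : ℂ),
    Complex.norm_real, Real.norm_of_nonneg (by positivity)]

namespace Angular

variable {v : ℝ} {Ω : E → ℂ}

theorem lintegral_ker_le [Nontrivial E] (hΩ : Angular v Ω) :
    ∃ A : ℝ≥0∞, A ≠ ⊤ ∧ ∀ h : ℝ → ℝ≥0∞, Measurable h →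
      ∫⁻ z, ‖ker Ω z‖ₑ * h ‖z‖ ≤ A * ∫⁻ r in Set.Ioi (0 : ℝ), ENNReal.ofReal r⁻¹ * h r := by
  obtain ⟨A, hA, hle⟩ := hΩ.bound_one
  refine ⟨A, hA, fun h hh => ?_⟩
  have h1 := hle (fun r => ENNReal.ofReal ((r ^ Module.finrank ℝ E)⁻¹) * h r)
    ((by fun_prop : Measurable fun r : ℝ =>
      ENNReal.ofReal ((r ^ Module.finrank ℝ E)⁻¹)).mul hh)
  simp only [enorm_ker, mul_assoc]
  refine h1.trans_eq ?_
  congr 1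
  refine setLIntegral_congr_fun measurableSet_Ioi fun r hr => ?_
  have hr0 : (0 : ℝ) < r := hr
  have hd : 0 < Module.finrank ℝ E := Module.finrank_pos
  obtain ⟨k, hk⟩ : ∃ k, Module.finrank ℝ E = k + 1 := ⟨_, (Nat.succ_pred_eq_of_pos hd).symm⟩
  simp only [hk, Nat.add_sub_cancel]
  rw [← mul_assoc, ← ENNReal.ofReal_mul (by positivity)]
  congr 2
  rw [pow_succ]
  field_simp

/-- In polar coordinates the kernel has radial weight `1/r`, which the linear bound on `pvReg`
cancels on a bounded interval. -/
theorem integrable_ker_mul_pvReg [Nontrivial E] (hΩ : Angular v Ω) {g : E → ℂ}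
    (hg : ContDiff ℝ ∞ g) (hs : HasCompactSupport g) (x : E) :
    Integrable fun z => ker Ω z * pvReg g x z := by
  obtain ⟨C, ρ, hC, hρ, hb⟩ := exists_pvReg_bound hg hs x
  obtain ⟨A, hA, hle⟩ := hΩ.lintegral_ker_le
  refine ⟨((measurable_ker hΩ.measurable).mul
    (measurable_pvReg hg.continuous.measurable x)).aestronglyMeasurable, ?_⟩
  set h : ℝ → ℝ≥0∞ := (Set.Iic ρ).indicator fun r => ENNReal.ofReal (C * r) with hh
  have hhm : Measurable h := (by fun_prop : Measurable fun r : ℝ =>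
    ENNReal.ofReal (C * r)).indicator measurableSet_Iic
  calc ∫⁻ z, ‖ker Ω z * pvReg g x z‖ₑ ≤ ∫⁻ z, ‖ker Ω z‖ₑ * h ‖z‖ := by
        refine lintegral_mono fun z => ?_
        rw [enorm_mul]
        gcongr
        rcases le_or_gt ‖z‖ ρ with hz | hz
        · rw [hh, Set.indicator_of_mem (by simpa using hz), ← ofReal_norm]
          exact ENNReal.ofReal_le_ofReal (hb z).1
        · simp [(hb z).2 hz]
    _ ≤ A * ∫⁻ r in Set.Ioi (0 : ℝ), ENNReal.ofReal r⁻¹ * h r := hle h hhm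
    _ ≤ A * ∫⁻ r in Set.Ioi (0 : ℝ), (Set.Ioc 0 ρ).indicator (fun _ => ENNReal.ofReal C) r := by
        gcongr A * ?_
        refine setLIntegral_mono (measurable_const.indicator measurableSet_Ioc) fun r hr => ?_
        have hr0 : (0 : ℝ) < r := hr
        rcases le_or_gt r ρ with hz | hz
        · rw [hh, Set.indicator_of_mem (by simpa using hz), Set.indicator_of_mem (show r ∈ Set.Ioc 0 ρ from ⟨hr0, hz⟩),
            ← ENNReal.ofReal_mul (by positivity)]
          refine ENNReal.ofReal_le_ofReal (le_of_eq ?_)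
          field_simp
        · simp [hh, hz]
    _ < ⊤ := by
        refine ENNReal.mul_lt_top hA.lt_top ((setLIntegral_le_lintegral _ _).trans_lt ?_)
        rw [lintegral_indicator measurableSet_Ioc]
        simp [ENNReal.mul_lt_top_iff]

theorem integrableOn_ker [Nontrivial E] (hΩ : Angular v Ω) {a b : ℝ} (ha : 0 < a) :
    IntegrableOn (ker Ω) {z | a < ‖z‖ ∧ ‖z‖ < b} := by
  obtain ⟨A, hA, hle⟩ := hΩ.lintegral_ker_le
  have hS : MeasurableSet {z : E | a < ‖z‖ ∧ ‖z‖ < b} :=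
    (measurableSet_lt measurable_const measurable_norm).inter
      (measurableSet_lt measurable_norm measurable_const)
  refine ⟨(measurable_ker hΩ.measurable).aestronglyMeasurable, ?_⟩
  rw [HasFiniteIntegral, ← lintegral_indicator hS]
  set h : ℝ → ℝ≥0∞ := (Set.Ioo a b).indicator 1 with hh
  have hhm : Measurable h := measurable_one.indicator measurableSet_Ioo
  calc ∫⁻ z, Set.indicator {z | a < ‖z‖ ∧ ‖z‖ < b} (fun z => ‖ker Ω z‖ₑ) z
      ≤ ∫⁻ z, ‖ker Ω z‖ₑ * h ‖z‖ := by
        refine lintegral_mono fun z => ?_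
        by_cases hz : a < ‖z‖ ∧ ‖z‖ < b <;> simp [Set.indicator, hh, hz]
    _ ≤ A * ∫⁻ r in Set.Ioi (0 : ℝ), ENNReal.ofReal r⁻¹ * h r := hle h hhm
    _ ≤ A * ∫⁻ r in Set.Ioi (0 : ℝ), (Set.Ioo a b).indicator
          (fun _ => ENNReal.ofReal a⁻¹) r := by
        gcongr A * ?_
        refine lintegral_mono fun r => ?_
        by_cases hr : r ∈ Set.Ioo a b
        · rw [hh, Set.indicator_of_mem hr, Set.indicator_of_mem hr, Pi.one_apply, mul_one]
          refine ENNReal.ofReal_le_ofReal ?_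
          gcongr
          exact hr.1.le
        · simp [hh, hr]
    _ < ⊤ := by
        refine ENNReal.mul_lt_top hA.lt_top ((setLIntegral_le_lintegral _ _).trans_lt ?_)
        rw [lintegral_indicator measurableSet_Ioo]
        simp [ENNReal.mul_lt_top_iff]

theorem cancel_ker (hΩ : Angular v Ω) (h : ℝ → ℂ) : ∫ z, ker Ω z * h ‖z‖ = 0 := by
  have := hΩ.cancel fun r => (((r ^ Module.finrank ℝ E : ℝ) : ℂ))⁻¹ * h r
  rw [← this]
  congr 1
  ext z
  rw [ker]
  ring

/-- The regularizing term is radial, so it is annihilated by the mean zero of `Ω` on each annulus.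
-/
theorem setIntegral_ker_mul [Nontrivial E] (hΩ : Angular v Ω) {g : E → ℂ}
    (hg : ContDiff ℝ ∞ g) (hs : HasCompactSupport g) (x : E) {a b : ℝ} (ha : 0 < a) :
    ∫ z in {z | a < ‖z‖ ∧ ‖z‖ < b}, ker Ω z * g (x - z) =
      ∫ z in {z | a < ‖z‖ ∧ ‖z‖ < b}, ker Ω z * pvReg g x z := by
  have hS : MeasurableSet {z : E | a < ‖z‖ ∧ ‖z‖ < b} :=
    (measurableSet_lt measurable_const measurable_norm).inter
      (measurableSet_lt measurable_norm measurable_const)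
  have i1 : IntegrableOn (fun z => ker Ω z * pvReg g x z) {z | a < ‖z‖ ∧ ‖z‖ < b} :=
    (hΩ.integrable_ker_mul_pvReg hg hs x).integrableOn
  have i2 : IntegrableOn (fun z => ker Ω z * (Metric.closedBall (0 : E) 1).indicator
      (fun _ => g x) z) {z | a < ‖z‖ ∧ ‖z‖ < b} := by
    refine (hΩ.integrableOn_ker ha).mul_bdd (c := ‖g x‖) (measurable_const.indicator
      Metric.isClosed_closedBall.measurableSet).aestronglyMeasurable (ae_of_all _ fun z => ?_)
    exact norm_indicator_le_norm_self (fun _ => g x) z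
  have e0 : ∫ z in {z | a < ‖z‖ ∧ ‖z‖ < b}, ker Ω z *
      (Metric.closedBall (0 : E) 1).indicator (fun _ => g x) z = 0 := by
    rw [← integral_indicator hS]
    have := hΩ.cancel_ker fun r => (Set.Ioo a b).indicator 1 r *
      (Set.Iic (1 : ℝ)).indicator (fun _ => g x) r
    rw [← this]
    congr 1
    ext z
    by_cases h1 : a < ‖z‖ ∧ ‖z‖ < b <;> by_cases h2 : ‖z‖ ≤ 1 <;> simp [Set.indicator, h1, h2]
  have e1 : ∀ z, ker Ω z * g (x - z) = ker Ω z * pvReg g x z +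
      ker Ω z * (Metric.closedBall (0 : E) 1).indicator (fun _ => g x) z := fun z => by
    rw [pvReg]
    ring
  simp_rw [e1]
  rw [integral_add i1 i2, e0, add_zero]

theorem tendsto_setIntegral_ker [Nontrivial E] (hΩ : Angular v Ω) {g : E → ℂ}
    (hg : ContDiff ℝ ∞ g) (hs : HasCompactSupport g) (x : E) :
    Tendsto (fun ε : ℝ => ∫ z in {z | ε < ‖z‖ ∧ ‖z‖ < 1 / ε}, ker Ω z * g (x - z)) (𝓝[>] 0)
      (𝓝 (pvInt Ω g x)) := by
  have hint := hΩ.integrable_ker_mul_pvReg hg hs x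
  have hS : ∀ ε : ℝ, MeasurableSet {z : E | ε < ‖z‖ ∧ ‖z‖ < 1 / ε} := fun ε =>
    (measurableSet_lt measurable_const measurable_norm).inter
      (measurableSet_lt measurable_norm measurable_const)
  have h1 : Tendsto (fun ε : ℝ => ∫ z, Set.indicator {z | ε < ‖z‖ ∧ ‖z‖ < 1 / ε}
      (fun z => ker Ω z * pvReg g x z) z) (𝓝[>] 0) (𝓝 (pvInt Ω g x)) := by
    refine tendsto_integral_filter_of_dominated_convergence
      (fun z => ‖ker Ω z * pvReg g x z‖) (Eventually.of_forall fun ε =>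
        hint.1.indicator (hS ε)) (Eventually.of_forall fun ε => ae_of_all _ fun z =>
        norm_indicator_le_norm_self _ _) hint.norm ?_
    have hne : ∀ᵐ z : E, z ≠ 0 := by simp [ae_iff]
    filter_upwards [hne] with z hz
    have hz0 : 0 < ‖z‖ := norm_pos_iff.2 hz
    refine tendsto_const_nhds.congr' ?_
    have hm : Set.Ioo (0 : ℝ) (min ‖z‖ (‖z‖⁻¹)) ∈ 𝓝[>] (0 : ℝ) :=
      Ioo_mem_nhdsGT (lt_min hz0 (inv_pos.2 hz0))
    filter_upwards [hm] with ε hε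
    rw [Set.indicator_of_mem]
    refine ⟨hε.2.trans_le (min_le_left _ _), ?_⟩
    rw [lt_one_div hz0 hε.1, one_div]
    exact hε.2.trans_le (min_le_right _ _)
  refine h1.congr' ?_
  filter_upwards [self_mem_nhdsWithin] with ε hε
  rw [integral_indicator (hS ε), hΩ.setIntegral_ker_mul hg hs x hε]

end Angular

end RoughCommutator

namespace RoughCommutator

variable {E : Type*} [NormedAddCommGroup E] [InnerProductSpace ℝ E] [FiniteDimensional ℝ E]
  [MeasurableSpace E] [BorelSpace E]

/-! ### Boundedness of the principal value operator -/

theorem ae_dilMeasure_pos : ∀ᵐ z ∂(dilMeasure E), 0 < z.1 :=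
  Measure.quasiMeasurePreserving_fst.ae (ae_restrict_mem measurableSet_Ioi)

/-- The restriction of the kernel to an annulus. -/
def annulusKer (Ω : E → ℂ) : E → ℂ := {z : E | 1 ≤ ‖z‖ ∧ ‖z‖ ≤ 2}.indicator (ker Ω)

theorem measurableSet_annulus (a b : ℝ) : MeasurableSet {z : E | a ≤ ‖z‖ ∧ ‖z‖ ≤ b} :=
  (measurableSet_le measurable_const measurable_norm).inter
    (measurableSet_le measurable_norm measurable_const)

theorem annulusKer_eq_zero (Ω : E → ℂ) (x : E) (hx : 2 < ‖x‖) : annulusKer Ω x = 0 :=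
  Set.indicator_of_notMem (fun h => absurd h.2 (not_le.2 hx)) _

/-- A point `z ≠ 0` lies in the `t`-dilate of the annulus exactly for `t` in `[‖z‖/2, ‖z‖]`, whose
`dt/t` length does not depend on `z`. This is the constant relating the dilation average of
`annulusKer` to the principal value. -/
theorem setIntegral_inv_indicator {s : ℝ} (hs : 0 < s) :
    ∫ t in Set.Ioi (0 : ℝ), (Set.Icc (s / 2) s).indicator (fun t => t⁻¹) t = Real.log 2 := by
  have hsub : Set.Icc (s / 2) s ⊆ Set.Ioi 0 := fun t ht => lt_of_lt_of_le (by positivity) ht.1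
  rw [setIntegral_indicator measurableSet_Icc, Set.inter_eq_self_of_subset_right hsub,
    integral_Icc_eq_integral_Ioc, ← intervalIntegral.integral_of_le (by linarith),
    integral_inv_of_pos (by positivity) hs]
  congr 1
  field_simp

theorem integrableOn_inv_indicator {s : ℝ} (hs : 0 < s) :
    IntegrableOn ((Set.Icc (s / 2) s).indicator fun t : ℝ => t⁻¹) (Set.Ioi 0) := by
  refine IntegrableOn.integrable_indicator ?_ measurableSet_Icc
  have hc : ContinuousOn (fun t : ℝ => t⁻¹) (Set.Icc (s / 2) s) :=
    continuousOn_inv₀.mono fun t ht => (lt_of_lt_of_le (by positivity : 0 < s / 2) ht.1).ne'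
  exact (hc.integrableOn_compact isCompact_Icc).mono_measure Measure.restrict_le_self

namespace Angular

variable {v : ℝ} {Ω : E → ℂ}

theorem measurable_annulusKer (hΩ : Angular v Ω) : Measurable (annulusKer Ω) :=
  (measurable_ker hΩ.measurable).indicator (measurableSet_annulus 1 2)

theorem memLp_annulusKer (hΩ : Angular v Ω) : MemLp (annulusKer Ω) (ENNReal.ofReal v) volume := by
  have hv0 : 0 < v := zero_lt_one.trans hΩ.one_lt
  refine ⟨hΩ.measurable_annulusKer.aestronglyMeasurable, ?_⟩
  rw [eLpNorm_lt_top_iff_lintegral_rpow_enorm_lt_top (by simpa using hv0) (by simp),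
    ENNReal.toReal_ofReal hv0.le]
  obtain ⟨A, hA, hle⟩ := hΩ.bound
  set h : ℝ → ℝ≥0∞ := (Set.Icc (1 : ℝ) 2).indicator 1 with hh
  have hhm : Measurable h := measurable_one.indicator measurableSet_Icc
  calc ∫⁻ z, ‖annulusKer Ω z‖ₑ ^ v ≤ ∫⁻ z, ‖Ω z‖ₑ ^ v * h ‖z‖ := by
        refine lintegral_mono fun z => ?_
        by_cases hz : 1 ≤ ‖z‖ ∧ ‖z‖ ≤ 2
        · rw [annulusKer, Set.indicator_of_mem (by exact hz), hh,
            Set.indicator_of_mem (by exact hz), Pi.one_apply, mul_one, enorm_ker]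
          gcongr
          refine mul_le_of_le_one_right zero_le ?_
          rw [ENNReal.ofReal_le_one]
          exact inv_le_one_of_one_le₀ (one_le_pow₀ hz.1)
        · rw [annulusKer, Set.indicator_of_notMem (by exact hz)]
          simp [hv0]
    _ ≤ A * ∫⁻ r in Set.Ioi (0 : ℝ), ENNReal.ofReal (r ^ (Module.finrank ℝ E - 1)) * h r :=
        hle h hhm
    _ ≤ A * ∫⁻ r in Set.Ioi (0 : ℝ), (Set.Icc (1 : ℝ) 2).indicator
          (fun _ => ENNReal.ofReal (2 ^ (Module.finrank ℝ E - 1))) r := by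
        gcongr A * ?_
        refine lintegral_mono fun r => ?_
        by_cases hr : r ∈ Set.Icc (1 : ℝ) 2
        · rw [hh, Set.indicator_of_mem hr, Set.indicator_of_mem hr, Pi.one_apply, mul_one]
          have := hr.1
          refine ENNReal.ofReal_le_ofReal ?_
          gcongr
          exact hr.2
        · simp [hh, hr]
    _ < ⊤ := by
        refine ENNReal.mul_lt_top hA.lt_top ((setLIntegral_le_lintegral _ _).trans_lt ?_)
        rw [lintegral_indicator measurableSet_Icc]
        simp [ENNReal.mul_lt_top_iff]

theorem integrable_annulusKer (hΩ : Angular v Ω) : Integrable (annulusKer Ω) := by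
  refine memLp_one_iff_integrable.1 (hΩ.memLp_annulusKer.mono_exponent_of_measure_support_ne_top
    (s := Metric.closedBall (0 : E) 2) (fun x hx => annulusKer_eq_zero Ω x (by simpa using hx))
    measure_closedBall_lt_top.ne ?_)
  rw [← ENNReal.ofReal_one]
  exact ENNReal.ofReal_le_ofReal hΩ.one_lt.le

theorem integral_annulusKer_mul (hΩ : Angular v Ω) (h : ℝ → ℂ) : ∫ z, annulusKer Ω z * h ‖z‖ = 0 := by
  rw [← hΩ.cancel_ker fun r => (Set.Icc (1 : ℝ) 2).indicator 1 r * h r]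
  congr 1
  ext z
  by_cases hz : 1 ≤ ‖z‖ ∧ ‖z‖ ≤ 2 <;> simp [annulusKer, Set.indicator, hz]

theorem integral_annulusKer (hΩ : Angular v Ω) : ∫ z, annulusKer Ω z = 0 := by
  simpa using hΩ.integral_annulusKer_mul 1

/-- For each `t` the regularizing term is radial in the remaining variable and integrates to zero.
Inserting it provides an integrable majorant for the limit `kap → 1/t`. -/
theorem sing_annulusKer_eq (hΩ : Angular v Ω) {ε M : ℝ} (hε : 0 < ε) (hM : 0 < M) {g : E → ℂ}
    (hg : Measurable g) {B : ℝ} (hB : ∀ x, ‖g x‖ ≤ B) (x : E) :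
    sing ε M (annulusKer Ω) g x = ∫ z, (kap ε M z.1 : ℂ) * annulusKer Ω z.2 * pvReg g x (z.1 • z.2)
      ∂(dilMeasure E) := by
  have hk := integrable_sing_kernel hε hM hΩ.integrable_annulusKer
  have hS : Measurable fun w => (Metric.closedBall (0 : E) 1).indicator (fun _ => g x) w :=
    measurable_const.indicator Metric.isClosed_closedBall.measurableSet
  have i1 : Integrable (fun z : ℝ × E => (kap ε M z.1 : ℂ) * annulusKer Ω z.2 * g (x - z.1 • z.2))
      (dilMeasure E) := integrable_mul_shift hk measurable_dil hg hB x
  have i2 : Integrable (fun z : ℝ × E => (kap ε M z.1 : ℂ) * annulusKer Ω z.2 *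
      (Metric.closedBall (0 : E) 1).indicator (fun _ => g x) (z.1 • z.2)) (dilMeasure E) := by
    refine hk.mul_bdd (c := ‖g x‖) (hS.comp measurable_dil).aestronglyMeasurable
      (ae_of_all _ fun z => ?_)
    exact norm_indicator_le_norm_self (fun _ => g x) _
  simp only [pvReg, mul_sub]
  rw [integral_sub i1 i2, sing, dilInt]
  have e0 : ∫ z : ℝ × E, (kap ε M z.1 : ℂ) * annulusKer Ω z.2 *
      (Metric.closedBall (0 : E) 1).indicator (fun _ => g x) (z.1 • z.2) ∂(dilMeasure E) = 0 := by
    rw [dilMeasure] at i2 ⊢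
    rw [integral_prod _ i2, ← integral_zero ℝ ℂ (μ := volume.restrict (Set.Ioi 0))]
    refine setIntegral_congr_fun measurableSet_Ioi fun t ht => ?_
    have ht0 : (0 : ℝ) < t := ht
    simp only [mul_assoc]
    rw [integral_const_mul]
    have h1 := hΩ.integral_annulusKer_mul fun r => (Set.Iic (1 : ℝ)).indicator (fun _ => g x) (t * r)
    have h2 : ∫ y, annulusKer Ω y * (Metric.closedBall (0 : E) 1).indicator (fun _ => g x) (t • y) =
        0 := by
      rw [← h1]
      congr 1
      ext y
      congr 1
      simp [Set.indicator, norm_smul, abs_of_pos ht0]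
    rw [h2, mul_zero]
  rw [e0, sub_zero]

theorem integrable_annulusKer_dil (hΩ : Angular v Ω) (C ρ : ℝ) :
    Integrable (fun z : ℝ × E => (Set.Ioc 0 ρ).indicator (fun _ => C) z.1 * ‖annulusKer Ω z.2‖)
      (dilMeasure E) := by
  refine Integrable.mul_prod (f := (Set.Ioc 0 ρ).indicator fun _ => C) ?_ hΩ.integrable_annulusKer.norm
  refine Integrable.mono_measure ?_ Measure.restrict_le_self
  exact (integrable_indicator_iff measurableSet_Ioc).2 (integrableOn_const (by simp))

/-- On the annulus `‖t • y‖` lies between `t` and `2t`: the upper bound compensates the factor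
`1/t`, and the lower bound makes everything vanish for `t > ρ`. -/
theorem norm_annulusKer_mul_pvReg_le {g : E → ℂ} {x : E} {C ρ : ℝ} (hC : 0 ≤ C)
    (hb : ∀ z, ‖pvReg g x z‖ ≤ C * ‖z‖ ∧ (ρ < ‖z‖ → pvReg g x z = 0)) {k : ℝ} {z : ℝ × E}
    (hz : 0 < z.1) (hk : |k| ≤ z.1⁻¹) :
    ‖(k : ℂ) * annulusKer Ω z.2 * pvReg g x (z.1 • z.2)‖ ≤
      (Set.Ioc 0 ρ).indicator (fun _ => C * 2) z.1 * ‖annulusKer Ω z.2‖ := by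
  by_cases hy : 1 ≤ ‖z.2‖ ∧ ‖z.2‖ ≤ 2
  · have hn : ‖z.1 • z.2‖ = z.1 * ‖z.2‖ := by rw [norm_smul, Real.norm_of_nonneg hz.le]
    rcases le_or_gt z.1 ρ with h1 | h1
    · rw [Set.indicator_of_mem (show z.1 ∈ Set.Ioc 0 ρ from ⟨hz, h1⟩), norm_mul, norm_mul,
        Complex.norm_real, Real.norm_eq_abs]
      have h2 := (hb (z.1 • z.2)).1
      rw [hn] at h2
      calc |k| * ‖annulusKer Ω z.2‖ * ‖pvReg g x (z.1 • z.2)‖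
          ≤ z.1⁻¹ * ‖annulusKer Ω z.2‖ * (C * (z.1 * 2)) := by
            gcongr
            refine h2.trans ?_
            gcongr
            exact hy.2
        _ = _ := by field_simp
    · rw [(hb (z.1 • z.2)).2 (by rw [hn]; nlinarith [hy.1])]
      simp only [mul_zero, norm_zero]
      exact mul_nonneg (Set.indicator_nonneg (fun _ _ => by positivity) _) (norm_nonneg _)
  · rw [annulusKer, Set.indicator_of_notMem (by exact hy)]
    simp

theorem integrable_inv_annulusKer_mul_pvReg (hΩ : Angular v Ω) {g : E → ℂ}
    (hg : ContDiff ℝ ∞ g) (hs : HasCompactSupport g) (x : E) :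
    Integrable (fun z : ℝ × E => ((z.1⁻¹ : ℝ) : ℂ) * annulusKer Ω z.2 * pvReg g x (z.1 • z.2))
      (dilMeasure E) := by
  obtain ⟨C, ρ, hC, hρ, hb⟩ := exists_pvReg_bound hg hs x
  refine (hΩ.integrable_annulusKer_dil (C * 2) ρ).mono' ?_ (ae_dilMeasure_pos.mono fun z hz =>
    norm_annulusKer_mul_pvReg_le hC hb hz (abs_of_pos (inv_pos.2 hz)).le)
  exact (((by fun_prop : Measurable fun z : ℝ × E => ((z.1⁻¹ : ℝ) : ℂ)).mul
    (hΩ.measurable_annulusKer.comp measurable_snd)).mul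
    ((measurable_pvReg hg.continuous.measurable x).comp measurable_dil)).aestronglyMeasurable

theorem tendsto_sing_annulusKer (hΩ : Angular v Ω) {g : E → ℂ}
    (hg : ContDiff ℝ ∞ g) (hs : HasCompactSupport g) (x : E) :
    Tendsto (fun N : ℕ => sing (1 / ((N : ℝ) + 1)) (N + 1) (annulusKer Ω) g x) atTop
      (𝓝 (∫ z, ((z.1⁻¹ : ℝ) : ℂ) * annulusKer Ω z.2 * pvReg g x (z.1 • z.2) ∂(dilMeasure E))) := by
  obtain ⟨C, ρ, hC, hρ, hb⟩ := exists_pvReg_bound hg hs x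
  obtain ⟨B, hB⟩ := hs.exists_bound_of_continuous hg.continuous
  have hgm := hg.continuous.measurable
  have hN' : ∀ N : ℕ, (0 : ℝ) < N + 1 := fun N => (one_div_pos_nat N).trans_le (one_div_le_nat N)
  simp_rw [fun N : ℕ => hΩ.sing_annulusKer_eq (one_div_pos_nat N) (hN' N) hgm hB x]
  refine tendsto_integral_of_dominated_convergence _ (fun N => ?_)
    (hΩ.integrable_annulusKer_dil (C * 2) ρ) (fun N => ae_dilMeasure_pos.mono fun z hz =>
      norm_annulusKer_mul_pvReg_le hC hb hz ?_) (ae_dilMeasure_pos.mono fun z hz => ?_)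
  · exact ((measurable_sing_kernel hΩ.measurable_annulusKer).mul
      ((measurable_pvReg hgm x).comp measurable_dil)).aestronglyMeasurable
  · rw [abs_of_nonneg (kap_nonneg (one_div_pos_nat N) (one_div_le_nat N) hz.le)]
    exact kap_le_inv hz
  · refine Tendsto.mul_const _ (Tendsto.mul_const _ ?_)
    exact (Complex.continuous_ofReal.tendsto _).comp (tendsto_kap hz)

theorem annulusKer_inv_smul (hΩ : Angular v Ω) {t : ℝ} (ht : 0 < t) (z : E) :
    annulusKer Ω (t⁻¹ • z) = ((t ^ Module.finrank ℝ E : ℝ) : ℂ) *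
      (ker Ω z * (Set.Icc (‖z‖ / 2) ‖z‖).indicator 1 t) := by
  have hn : ‖t⁻¹ • z‖ = t⁻¹ * ‖z‖ := by rw [norm_smul, Real.norm_of_nonneg (by positivity)]
  have hiff : (1 ≤ ‖t⁻¹ • z‖ ∧ ‖t⁻¹ • z‖ ≤ 2) ↔ t ∈ Set.Icc (‖z‖ / 2) ‖z‖ := by
    rw [hn, Set.mem_Icc, and_comm, inv_mul_le_iff₀ ht, le_inv_mul_iff₀ ht, mul_one,
      div_le_iff₀ (by norm_num)]
  by_cases h : t ∈ Set.Icc (‖z‖ / 2) ‖z‖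
  · rw [annulusKer, Set.indicator_of_mem (by exact hiff.2 h), Set.indicator_of_mem h, Pi.one_apply,
      mul_one, ker, ker, hΩ.hom _ (inv_pos.2 ht), hn, mul_pow, inv_pow]
    have : ((t : ℂ) ^ Module.finrank ℝ E) ≠ 0 := pow_ne_zero _ (by exact_mod_cast ht.ne')
    push_cast
    field_simp
  · rw [annulusKer, Set.indicator_of_notMem (by exact fun h' => h (hiff.1 h')),
      Set.indicator_of_notMem h]
    simp

theorem integral_annulusKer_comp_smul (hΩ : Angular v Ω) (G : E → ℂ) {t : ℝ} (ht : 0 < t) :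
    ∫ y, annulusKer Ω y * G (t • y) =
      ∫ z, ker Ω z * G z * (Set.Icc (‖z‖ / 2) ‖z‖).indicator 1 t := by
  have h1 := Measure.integral_comp_smul (volume : Measure E) (fun z => annulusKer Ω (t⁻¹ • z) * G z) t
  simp only [smul_smul, inv_mul_cancel₀ ht.ne', one_smul] at h1
  rw [h1, abs_of_pos (by positivity), ← integral_smul]
  congr 1
  ext z
  rw [hΩ.annulusKer_inv_smul ht, Complex.real_smul]
  have : ((t : ℂ) ^ Module.finrank ℝ E) ≠ 0 := pow_ne_zero _ (by exact_mod_cast ht.ne')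
  push_cast
  field_simp

/-- Substitute `z = t • y`; the homogeneity of the kernel cancels the Jacobian. After exchanging the
integrals, the one in `t` is `log 2` for every `z ≠ 0`. -/
theorem integral_inv_annulusKer_eq [Nontrivial E] (hΩ : Angular v Ω) {g : E → ℂ}
    (hg : ContDiff ℝ ∞ g) (hs : HasCompactSupport g) (x : E) :
    ∫ z, ((z.1⁻¹ : ℝ) : ℂ) * annulusKer Ω z.2 * pvReg g x (z.1 • z.2) ∂(dilMeasure E) =
      (Real.log 2 : ℂ) * pvInt Ω g x := by
  have hi := hΩ.integrable_inv_annulusKer_mul_pvReg hg hs x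
  have hkG := hΩ.integrable_ker_mul_pvReg hg hs x
  have hGm := measurable_pvReg hg.continuous.measurable x
  rw [dilMeasure] at hi ⊢
  rw [integral_prod _ hi]
  set H : ℝ → E → ℂ := fun t z => ker Ω z * pvReg g x z *
    (((Set.Icc (‖z‖ / 2) ‖z‖).indicator (fun t => t⁻¹) t : ℝ) : ℂ) with hH
  have e1 : ∫ t in Set.Ioi (0 : ℝ), ∫ y, ((t⁻¹ : ℝ) : ℂ) * annulusKer Ω y * pvReg g x (t • y) =
      ∫ t in Set.Ioi (0 : ℝ), ∫ z, H t z := by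
    refine setIntegral_congr_fun measurableSet_Ioi fun t ht => ?_
    simp only [mul_assoc]
    rw [integral_const_mul, hΩ.integral_annulusKer_comp_smul _ ht, ← integral_const_mul]
    congr 1
    ext z
    rw [hH]
    by_cases h : t ∈ Set.Icc (‖z‖ / 2) ‖z‖
    · simp only [Set.indicator_of_mem h, Pi.one_apply]
      ring
    · simp [Set.indicator_of_notMem h]
  have hHm : Measurable (Function.uncurry H) := by
    have hset : MeasurableSet {w : ℝ × E | ‖w.2‖ / 2 ≤ w.1 ∧ w.1 ≤ ‖w.2‖} :=
      (measurableSet_le (by fun_prop) measurable_fst).inter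
        (measurableSet_le measurable_fst (by fun_prop))
    have hind : Measurable fun w : ℝ × E =>
        (Set.Icc (‖w.2‖ / 2) ‖w.2‖).indicator (fun t => t⁻¹) w.1 := by
      have : (fun w : ℝ × E => (Set.Icc (‖w.2‖ / 2) ‖w.2‖).indicator (fun t => t⁻¹) w.1) =
          {w : ℝ × E | ‖w.2‖ / 2 ≤ w.1 ∧ w.1 ≤ ‖w.2‖}.indicator fun w => w.1⁻¹ := by
        ext w
        rfl
      rw [this]
      exact measurable_fst.inv.indicator hset
    exact (((measurable_ker hΩ.measurable).mul hGm).comp measurable_snd).mul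
      (Complex.measurable_ofReal.comp hind)
  have hne : ∀ᵐ z : E, z ≠ 0 := by simp [ae_iff]
  have hHi : Integrable (Function.uncurry H) ((volume.restrict (Set.Ioi 0)).prod volume) := by
    rw [integrable_prod_iff' hHm.aestronglyMeasurable]
    refine ⟨?_, ?_⟩
    · filter_upwards [hne] with z hz
      have h1 : Integrable (fun t : ℝ => (((Set.Icc (‖z‖ / 2) ‖z‖).indicator
          (fun t => t⁻¹) t : ℝ) : ℂ)) (volume.restrict (Set.Ioi 0)) :=
        Integrable.ofReal (integrableOn_inv_indicator (norm_pos_iff.2 hz))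
      exact h1.const_mul (ker Ω z * pvReg g x z)
    · refine (hkG.norm.mul_const (Real.log 2)).congr ?_
      filter_upwards [hne] with z hz
      simp only [Function.uncurry, hH]
      simp_rw [norm_mul (ker Ω z * pvReg g x z)]
      rw [integral_const_mul, ← setIntegral_inv_indicator (norm_pos_iff.2 hz)]
      congr 2
      ext t
      rw [Complex.norm_real, Real.norm_of_nonneg]
      refine Set.indicator_nonneg (fun t ht => ?_) t
      exact inv_nonneg.2 ((by positivity : 0 ≤ ‖z‖ / 2).trans ht.1)
  rw [e1, integral_integral_swap hHi, pvInt, ← integral_const_mul]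
  refine integral_congr_ae ?_
  filter_upwards [hne] with z hz
  simp only [hH]
  rw [integral_const_mul, integral_complex_ofReal,
    setIntegral_inv_indicator (norm_pos_iff.2 hz), mul_comm]

/-- The singular integral operator is bounded in `L^p` on smooth functions. -/
theorem exists_eLpNorm_pvInt_le [Nontrivial E] (hΩ : Angular v Ω) {p : ℝ≥0∞} (hp : 1 < p)
    (hpt : p ≠ ⊤) :
    ∃ C : ℝ≥0∞, C ≠ ⊤ ∧ ∀ g : E → ℂ, ContDiff ℝ ∞ g → HasCompactSupport g →
      Measurable (pvInt Ω g) ∧ eLpNorm (pvInt Ω g) p volume ≤ C * eLpNorm g p volume := by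
  have hv1 : 1 < ENNReal.ofReal v := by
    rw [← ENNReal.ofReal_one]
    exact (ENNReal.ofReal_lt_ofReal_iff (zero_lt_one.trans hΩ.one_lt)).2 hΩ.one_lt
  obtain ⟨C, hC, hle⟩ := exists_eLpNorm_sing_le hp hpt hv1 hΩ.measurable_annulusKer hΩ.memLp_annulusKer
    (annulusKer_eq_zero Ω) hΩ.integral_annulusKer
  have hl : (Real.log 2 : ℂ) ≠ 0 := by
    exact_mod_cast (Real.log_pos one_lt_two).ne'
  set c : ℂ := (Real.log 2 : ℂ)⁻¹ with hc
  refine ⟨‖c‖ₑ * C, ENNReal.mul_ne_top enorm_ne_top hC, fun g hg hs => ?_⟩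
  set F : ℕ → E → ℂ := fun N => c • sing (1 / ((N : ℝ) + 1)) (N + 1) (annulusKer Ω) g with hF
  have hFm : ∀ N, Measurable (F N) := fun N =>
    (measurable_sing hΩ.measurable_annulusKer hg.continuous.measurable).const_smul c
  have hlim : ∀ x, Tendsto (fun N => F N x) atTop (𝓝 (pvInt Ω g x)) := by
    intro x
    have h1 := (hΩ.tendsto_sing_annulusKer hg hs x).const_smul c
    rw [hΩ.integral_inv_annulusKer_eq hg hs x, smul_eq_mul, ← mul_assoc, hc, inv_mul_cancel₀ hl,
      one_mul] at h1
    exact h1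
  refine ⟨measurable_of_tendsto_metrizable hFm (tendsto_pi_nhds.2 hlim), ?_⟩
  refine eLpNorm_le_of_tendsto (F := F) (fun N => (hFm N).aestronglyMeasurable)
    (ae_of_all _ hlim) (D := fun _ => ‖c‖ₑ * C * eLpNorm g p volume) (fun N => ?_)
    tendsto_const_nhds
  rw [hF, eLpNorm_const_smul, mul_assoc]
  gcongr
  exact hle _ _ (one_div_pos_nat N) (one_div_le_nat N) g hg hs

end Angular

end RoughCommutator

namespace RoughCommutator

variable {E : Type*} [NormedAddCommGroup E] [InnerProductSpace ℝ E] [FiniteDimensional ℝ E]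
  [MeasurableSpace E] [BorelSpace E]

/-! ### Extension to Lebesgue spaces -/

theorem exists_clm_extending {D X Y : Type*} [AddCommGroup D] [Module ℂ D]
    [NormedAddCommGroup X] [NormedSpace ℂ X] [NormedAddCommGroup Y] [NormedSpace ℂ Y]
    [CompleteSpace Y] {S : D →ₗ[ℂ] Y} {e : D →ₗ[ℂ] X} (he : DenseRange e) {C : ℝ}
    (hC : ∀ g, ‖S g‖ ≤ C * ‖e g‖) : ∃ T : X →L[ℂ] Y, ∀ g, T (e g) = S g :=
  ⟨S.extendOfNorm e, LinearMap.extendOfNorm_eq he ⟨C, hC⟩⟩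

/-- The space of test functions. -/
def testFun (E : Type*) [NormedAddCommGroup E] [InnerProductSpace ℝ E] :
    Submodule ℂ (E → ℂ) where
  carrier := {g | ContDiff ℝ ∞ g ∧ HasCompactSupport g}
  add_mem' hf hg := ⟨hf.1.add hg.1, hf.2.add hg.2⟩
  zero_mem' := ⟨contDiff_const, HasCompactSupport.zero⟩
  smul_mem' c _ hf := ⟨contDiff_const.smul hf.1, hf.2.smul_left (f := fun _ => c)⟩

theorem memLp_testFun (p : ℝ≥0∞) (g : testFun E) : MemLp (g : E → ℂ) p volume :=
  g.2.1.continuous.memLp_of_hasCompactSupport g.2.2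

/-- The inclusion of the test functions into `L^p`. -/
def testFunToLp (p : ℝ≥0∞) [Fact (1 ≤ p)] : testFun E →ₗ[ℂ] Lp ℂ p (volume : Measure E) where
  toFun g := (memLp_testFun p g).toLp g
  map_add' _ _ := rfl
  map_smul' _ _ := rfl

theorem coeFn_testFunToLp (p : ℝ≥0∞) [Fact (1 ≤ p)] (g : testFun E) :
    testFunToLp p g =ᵐ[volume] (g : E → ℂ) := (memLp_testFun p g).coeFn_toLp

theorem denseRange_testFunToLp {p : ℝ≥0∞} [Fact (1 ≤ p)] (hpt : p ≠ ⊤) :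
    DenseRange (testFunToLp (E := E) p) := by
  refine (Lp.dense_hasCompactSupport_contDiff (F := ℂ) (μ := (volume : Measure E)) hpt).mono ?_
  rintro f ⟨g, hfg, hgc, hgs⟩
  refine ⟨⟨g, hgs, hgc⟩, Lp.ext ?_⟩
  exact (coeFn_testFunToLp p _).trans hfg.symm

theorem testFunToLp_eq {p : ℝ≥0∞} [Fact (1 ≤ p)] {f : Lp ℂ p (volume : Measure E)}
    {g : testFun E} (h : f =ᵐ[volume] (g : E → ℂ)) : testFunToLp p g = f :=
  Lp.ext ((coeFn_testFunToLp p g).trans h.symm)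

theorem pvReg_add (g₁ g₂ : E → ℂ) (x z : E) :
    pvReg (g₁ + g₂) x z = pvReg g₁ x z + pvReg g₂ x z := by
  by_cases h : z ∈ Metric.closedBall (0 : E) 1
  · simp only [pvReg, Set.indicator_of_mem h, Pi.add_apply]
    ring
  · simp [pvReg, Set.indicator_of_notMem h]

theorem pvReg_smul (c : ℂ) (g : E → ℂ) (x z : E) :
    pvReg (c • g) x z = c * pvReg g x z := by
  by_cases h : z ∈ Metric.closedBall (0 : E) 1
  · simp only [pvReg, Set.indicator_of_mem h, Pi.smul_apply, smul_eq_mul]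
    ring
  · simp [pvReg, Set.indicator_of_notMem h]

theorem pvInt_smul (Ω : E → ℂ) (c : ℂ) (g : E → ℂ) : pvInt Ω (c • g) = c • pvInt Ω g := by
  ext x
  simp only [pvInt, pvReg_smul, Pi.smul_apply, smul_eq_mul]
  rw [← integral_const_mul]
  congr 1
  ext z
  ring

namespace Angular

variable {v : ℝ} {Ω : E → ℂ}

theorem pvInt_add [Nontrivial E] (hΩ : Angular v Ω) (g₁ g₂ : testFun E) :
    pvInt Ω (g₁ + g₂ : E → ℂ) = pvInt Ω g₁ + pvInt Ω g₂ := by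
  ext x
  simp only [pvInt, pvReg_add, Pi.add_apply, mul_add]
  exact integral_add (hΩ.integrable_ker_mul_pvReg g₁.2.1 g₁.2.2 x)
    (hΩ.integrable_ker_mul_pvReg g₂.2.1 g₂.2.2 x)

/-- The principal value operator on test functions, as a linear map. -/
def pvLp [Nontrivial E] (hΩ : Angular v Ω) (p : ℝ≥0∞) [Fact (1 ≤ p)]
    (hmem : ∀ g : testFun E, MemLp (pvInt Ω g) p volume) :
    testFun E →ₗ[ℂ] Lp ℂ p (volume : Measure E) where
  toFun g := (hmem g).toLp _
  map_add' g₁ g₂ := by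
    have h : (pvInt Ω ((g₁ + g₂ : testFun E) : E → ℂ)) = pvInt Ω g₁ + pvInt Ω g₂ :=
      hΩ.pvInt_add g₁ g₂
    exact (MemLp.toLp_congr (hmem _) ((hmem g₁).add (hmem g₂)) (by rw [h])).trans
      (MemLp.toLp_add (hmem g₁) (hmem g₂))
  map_smul' c g := by
    have h : (pvInt Ω ((c • g : testFun E) : E → ℂ)) = c • pvInt Ω g := pvInt_smul Ω c g
    exact (MemLp.toLp_congr (hmem _) ((hmem g).const_smul c) (by rw [h])).trans
      (MemLp.toLp_const_smul c (hmem g))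

theorem exists_clm_eq_pvInt [Nontrivial E] (hΩ : Angular v Ω) {p : ℝ≥0∞} [Fact (1 ≤ p)]
    (hp : 1 < p) (hpt : p ≠ ⊤) :
    ∃ T : Lp ℂ p (volume : Measure E) →L[ℂ] Lp ℂ p (volume : Measure E),
      ∀ g : testFun E, T (testFunToLp p g) =ᵐ[volume] pvInt Ω g := by
  obtain ⟨C, hC, hle⟩ := hΩ.exists_eLpNorm_pvInt_le hp hpt
  have hmem : ∀ g : testFun E, MemLp (pvInt Ω g) p volume := fun g =>
    ⟨(hle g g.2.1 g.2.2).1.aestronglyMeasurable, (hle g g.2.1 g.2.2).2.trans_lt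
      (ENNReal.mul_lt_top hC.lt_top (memLp_testFun p g).2)⟩
  obtain ⟨S, hS⟩ : ∃ S : testFun E →ₗ[ℂ] Lp ℂ p (volume : Measure E),
      ∀ g, S g =ᵐ[volume] pvInt Ω g := ⟨pvLp hΩ p hmem, fun g => (hmem g).coeFn_toLp⟩
  have hbd : ∀ g, ‖S g‖ ≤ C.toReal * ‖testFunToLp p g‖ := by
    intro g
    rw [Lp.norm_def, Lp.norm_def, eLpNorm_congr_ae (hS g),
      eLpNorm_congr_ae (coeFn_testFunToLp p g), ← ENNReal.toReal_mul]
    exact ENNReal.toReal_mono (ENNReal.mul_ne_top hC (memLp_testFun p g).2.ne)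
      (hle g g.2.1 g.2.2).2
  obtain ⟨T, hT⟩ := exists_clm_extending (denseRange_testFunToLp (E := E) (p := p) hpt) hbd
  refine ⟨T, fun g => ?_⟩
  rw [hT g]
  exact hS g

end Angular

theorem truncatedIntegral_eq {n : ℕ} {Ω Ω' : EuclideanSpace ℝ (Fin n) → ℂ}
    (h : Ω =ᵐ[volume] Ω') (f : EuclideanSpace ℝ (Fin n) → ℂ) (ε : ℝ)
    (x : EuclideanSpace ℝ (Fin n)) :
    truncatedIntegral Ω f ε x =
      ∫ z in {z | ε < ‖z‖ ∧ ‖z‖ < 1 / ε}, ker Ω' z * f (x - z) := by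
  have hS : MeasurableSet {z : EuclideanSpace ℝ (Fin n) | ε < ‖z‖ ∧ ‖z‖ < 1 / ε} :=
    (measurableSet_lt measurable_const measurable_norm).inter
      (measurableSet_lt measurable_norm measurable_const)
  have hS' : MeasurableSet {y : EuclideanSpace ℝ (Fin n) | ε < ‖x - y‖ ∧ ‖x - y‖ < 1 / ε} :=
    hS.preimage (f := fun y => x - y) (by fun_prop)
  rw [truncatedIntegral, ← integral_indicator hS', ← integral_indicator hS,
    ← integral_sub_left_eq_self _ volume x]
  refine integral_congr_ae ?_
  filter_upwards [h] with z hz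
  simp only [Set.indicator, Set.mem_ofPred_eq, sub_sub_cancel, ker, finrank_euclideanSpace_fin, hz]

theorem hasPrincipalValue_pvInt {n : ℕ} (hn : 1 ≤ n) {Ω Ω' : EuclideanSpace ℝ (Fin n) → ℂ}
    (h : Ω =ᵐ[volume] Ω') {v : ℝ} (hΩ : Angular v Ω') (g : testFun (EuclideanSpace ℝ (Fin n)))
    (x : EuclideanSpace ℝ (Fin n)) : HasPrincipalValue Ω g x (pvInt Ω' g x) := by
  have : Nonempty (Fin n) := ⟨⟨0, hn⟩⟩
  have := hΩ.tendsto_setIntegral_ker g.2.1 g.2.2 x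
  rw [HasPrincipalValue]
  simp_rw [truncatedIntegral_eq h]
  exact this

/-- Limits are unique, so being given by principal values means agreeing with `pvInt` on test
functions. The representative `Ω'` can be used since the truncated integrals ignore null sets. -/
theorem isSingularIntegral_iff {n : ℕ} (hn : 1 ≤ n) {Ω Ω' : EuclideanSpace ℝ (Fin n) → ℂ}
    (h : Ω =ᵐ[volume] Ω') {v : ℝ} (hΩ : Angular v Ω') {s : ℝ≥0∞} [Fact (1 ≤ s)]
    (T : Lp ℂ s (volume : Measure (EuclideanSpace ℝ (Fin n))) →L[ℂ]
      Lp ℂ s (volume : Measure (EuclideanSpace ℝ (Fin n)))) :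
    IsSingularIntegral Ω s T ↔ ∀ g, T (testFunToLp s g) =ᵐ[volume] pvInt Ω' g := by
  constructor
  · intro hT g
    filter_upwards [hT g (testFunToLp s g) g.2.1 g.2.2 (coeFn_testFunToLp s g)] with x hx
    exact tendsto_nhds_unique hx (hasPrincipalValue_pvInt hn h hΩ g x)
  · intro hT g f hg hs hfg
    have hT' := hT ⟨g, hg, hs⟩
    rw [testFunToLp_eq (g := ⟨g, hg, hs⟩) hfg] at hT'
    filter_upwards [hT'] with x hx
    rw [hx]
    exact hasPrincipalValue_pvInt hn h hΩ ⟨g, hg, hs⟩ x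

end RoughCommutator

namespace RoughCommutator

variable {E : Type*} [NormedAddCommGroup E] [InnerProductSpace ℝ E] [FiniteDimensional ℝ E]
  [MeasurableSpace E] [BorelSpace E]

/-! ### Localized convolution estimates -/

theorem eLpNorm_const_mul_ennreal {q : ℝ≥0∞} (hq : q ≠ 0) (hqt : q ≠ ⊤) (a : ℝ≥0∞)
    {F : E → ℝ≥0∞} (hF : Measurable F) :
    eLpNorm (fun x => a * F x) q volume = a * eLpNorm F q volume := by
  have hq' := ENNReal.toReal_pos hq hqt
  rw [eLpNorm_eq_lintegral_rpow_enorm_toReal hq hqt, eLpNorm_eq_lintegral_rpow_enorm_toReal hq hqt]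
  simp only [enorm_eq_self]
  simp_rw [ENNReal.mul_rpow_of_nonneg _ _ hq'.le]
  rw [lintegral_const_mul _ (hF.pow_const _), ENNReal.mul_rpow_of_nonneg _ _ (by positivity),
    ← ENNReal.rpow_mul, mul_one_div_cancel hq'.ne', ENNReal.rpow_one]

theorem eLpNorm_mul_le_of_holder {r p q : ℝ≥0∞} [h : ENNReal.HolderTriple r p q] (hq : q ≠ 0)
    (hr : r ≠ ⊤) (hp : p ≠ ⊤) {c G : E → ℝ≥0∞} (hc : Measurable c) (hG : Measurable G) :
    eLpNorm (fun x => c x * G x) q volume ≤ eLpNorm c r volume * eLpNorm G p volume := by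
  have hqr : q ≤ r := (ENNReal.HolderTriple.le r p q)
  have hqp : q ≤ p := (ENNReal.HolderTriple.le p r q)
  have hqt : q ≠ ⊤ := (hqr.trans_lt hr.lt_top).ne
  have hr0 : r ≠ 0 := (pos_iff_ne_zero.2 hq).trans_le hqr |>.ne'
  have hp0 : p ≠ 0 := (pos_iff_ne_zero.2 hq).trans_le hqp |>.ne'
  have hq0' := ENNReal.toReal_pos hq hqt
  have hp0' := ENNReal.toReal_pos hp0 hp
  have hr0' := ENNReal.toReal_pos hr0 hr
  have hinv : 1 / q.toReal = 1 / r.toReal + 1 / p.toReal := by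
    have h1 := congrArg ENNReal.toReal h.inv_add_inv_eq_inv
    rw [ENNReal.toReal_add (by simpa using hr0) (by simpa using hp0), ENNReal.toReal_inv,
      ENNReal.toReal_inv, ENNReal.toReal_inv] at h1
    simp only [one_div]
    exact h1.symm
  have hlt : q.toReal < r.toReal := by
    rw [← one_div_lt_one_div hr0' hq0', hinv]
    have : 0 < 1 / p.toReal := by positivity
    linarith
  have := ENNReal.lintegral_Lp_mul_le_Lq_mul_Lr hq0' hlt hinv volume hc.aemeasurable
    hG.aemeasurable
  rw [eLpNorm_eq_lintegral_rpow_enorm_toReal hq hqt, eLpNorm_eq_lintegral_rpow_enorm_toReal hr0 hr,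
    eLpNorm_eq_lintegral_rpow_enorm_toReal hp0 hp]
  simpa using this

theorem eLpNorm_lconv_le {q : ℝ≥0∞} (hq : 1 ≤ q) (hqt : q ≠ ⊤) {κ G : E → ℝ≥0∞}
    (hκ : Measurable κ) (hG : Measurable G) :
    eLpNorm (fun x => ∫⁻ z, κ z * G (x - z)) q volume ≤
      (∫⁻ z, κ z) * eLpNorm G q volume := by
  refine eLpNorm_lintegral_mul_le (G := fun z x => G (x - z)) hq hqt hκ
    (hG.comp (measurable_snd.sub measurable_fst)) fun z => ?_
  exact (eLpNorm_comp_measurePreserving hG.aestronglyMeasurable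
    (measurePreserving_sub_right volume z)).le

theorem lconv_comm (κ G : E → ℝ≥0∞) (x : E) :
    ∫⁻ z, κ z * G (x - z) = ∫⁻ z, G z * κ (x - z) := by
  rw [← lintegral_sub_left_eq_self _ x]
  simp [mul_comm]

theorem measurable_lconv {κ G : E → ℝ≥0∞} (hκ : Measurable κ) (hG : Measurable G) :
    Measurable fun x => ∫⁻ z, κ z * G (x - z) := by
  have h : Measurable fun w : E × E => κ w.2 * G (w.1 - w.2) :=
    (hκ.comp measurable_snd).mul (hG.comp (measurable_fst.sub measurable_snd))
  exact h.lintegral_prod_right'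

theorem localized_lconv_eq {κ c G : E → ℝ≥0∞} (hκ : Measurable κ) (hG : Measurable G) (x : E) :
    ∫⁻ z, κ z * (c x + c (x - z)) * G (x - z) =
      c x * (∫⁻ z, κ z * G (x - z)) + ∫⁻ z, κ z * (c (x - z) * G (x - z)) := by
  have hm : Measurable fun z => κ z * G (x - z) := hκ.mul (hG.comp (by fun_prop))
  rw [← lintegral_const_mul _ hm, ← lintegral_add_left (hm.const_mul _)]
  refine lintegral_congr fun z => ?_
  ring

/-- Localized convolution with an integrable kernel. -/
theorem eLpNorm_localized_le_of_lintegral {r p q : ℝ≥0∞} [h : ENNReal.HolderTriple r p q]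
    (hq : 1 ≤ q) (hr : r ≠ ⊤) (hp : p ≠ ⊤) {κ c G : E → ℝ≥0∞} (hκ : Measurable κ)
    (hc : Measurable c) (hG : Measurable G) :
    eLpNorm (fun x => ∫⁻ z, κ z * (c x + c (x - z)) * G (x - z)) q volume ≤
      2 * (∫⁻ z, κ z) * eLpNorm c r volume * eLpNorm G p volume := by
  have hq0 : q ≠ 0 := (zero_lt_one.trans_le hq).ne'
  have hqt : q ≠ ⊤ := ((ENNReal.HolderTriple.le r p q).trans_lt hr.lt_top).ne
  simp_rw [localized_lconv_eq hκ hG]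
  refine (eLpNorm_add_le (f := fun x => c x * ∫⁻ z, κ z * G (x - z))
    (g := fun x => ∫⁻ z, κ z * (c (x - z) * G (x - z)))
    (hc.mul (measurable_lconv hκ hG)).aestronglyMeasurable
    (measurable_lconv hκ (G := fun x => c x * G x) (hc.mul hG)).aestronglyMeasurable hq).trans ?_
  rw [two_mul, add_mul, add_mul]
  -- With `c` outside the convolution, Hölder's inequality precedes Young's in `L^p`; with `c`
  -- inside, it is used within the bound of Young's inequality in `L^q`.
  refine add_le_add ?_ ?_
  · refine (eLpNorm_mul_le_of_holder hq0 hr hp hc (measurable_lconv hκ hG)).trans ?_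
    calc _ ≤ eLpNorm c r volume * ((∫⁻ z, κ z) * eLpNorm G p volume) := by
          gcongr
          exact eLpNorm_lconv_le (hq.trans (ENNReal.HolderTriple.le p r q)) hp hκ hG
      _ = _ := by ring
  · refine (eLpNorm_lconv_le (G := fun x => c x * G x) hq hqt hκ (hc.mul hG)).trans ?_
    rw [mul_assoc]
    gcongr
    exact eLpNorm_mul_le_of_holder hq0 hr hp hc hG

/-- Localized convolution with a kernel that decays at infinity. -/
theorem eLpNorm_localized_le_of_eLpNorm {p p' q : ℝ≥0∞} [h : ENNReal.HolderTriple p' p 1]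
    (hq : 1 ≤ q) (hqt : q ≠ ⊤) (hp' : p' ≠ ⊤) (hp : p ≠ ⊤) {κ c G : E → ℝ≥0∞} (hκ : Measurable κ)
    (hc : Measurable c) (hG : Measurable G) :
    eLpNorm (fun x => ∫⁻ z, κ z * (c x + c (x - z)) * G (x - z)) q volume ≤
      (eLpNorm c q volume * eLpNorm κ p' volume + eLpNorm c p' volume * eLpNorm κ q volume) *
        eLpNorm G p volume := by
  simp_rw [localized_lconv_eq hκ hG]
  refine (eLpNorm_add_le (f := fun x => c x * ∫⁻ z, κ z * G (x - z))
    (g := fun x => ∫⁻ z, κ z * (c (x - z) * G (x - z)))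
    (hc.mul (measurable_lconv hκ hG)).aestronglyMeasurable
    (measurable_lconv hκ (G := fun x => c x * G x) (hc.mul hG)).aestronglyMeasurable hq).trans ?_
  rw [add_mul]
  have hL1 : ∀ F : E → ℝ≥0∞, eLpNorm F 1 volume = ∫⁻ x, F x := fun F => by
    simp [eLpNorm_one_eq_lintegral_enorm]
  refine add_le_add ?_ ?_
  -- With `c` outside, the convolution is bounded by duality of `L^p'` and `L^p`, and `c` supplies
  -- the `L^q` norm.
  · have hsup : ∀ x, ∫⁻ z, κ z * G (x - z) ≤ eLpNorm κ p' volume * eLpNorm G p volume := by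
      intro x
      have hGx : Measurable fun z => G (x - z) := hG.comp (by fun_prop)
      have h1 := eLpNorm_mul_le_of_holder (q := 1) one_ne_zero hp' hp hκ hGx
      rw [hL1] at h1
      refine h1.trans_eq ?_
      congr 1
      exact eLpNorm_comp_measurePreserving hG.aestronglyMeasurable
        (Measure.measurePreserving_sub_left volume x)
    calc eLpNorm (fun x => c x * ∫⁻ z, κ z * G (x - z)) q volume
        ≤ eLpNorm (fun x => (eLpNorm κ p' volume * eLpNorm G p volume) * c x) q volume := by
          refine eLpNorm_mono_enorm fun x => ?_
          simp only [enorm_eq_self]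
          rw [mul_comm]
          gcongr
          exact hsup x
      _ = (eLpNorm κ p' volume * eLpNorm G p volume) * eLpNorm c q volume :=
          eLpNorm_const_mul_ennreal (zero_lt_one.trans_le hq).ne' hqt _ hc
      _ = _ := by ring
  -- With `c` inside, the roles are exchanged: `c G` is in `L^1`, and Young's inequality uses `κ` in
  -- `L^q`.
  · have e : (fun x => ∫⁻ z, κ z * (c (x - z) * G (x - z))) =
        fun x => ∫⁻ z, (c z * G z) * κ (x - z) := by
      ext x
      exact lconv_comm κ (fun x => c x * G x) x
    rw [e]
    refine (eLpNorm_lconv_le (κ := fun z => c z * G z) hq hqt (hc.mul hG) hκ).trans ?_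
    have h1 := eLpNorm_mul_le_of_holder (q := 1) one_ne_zero hp' hp hc hG
    rw [hL1] at h1
    calc _ ≤ (eLpNorm c p' volume * eLpNorm G p volume) * eLpNorm κ q volume := by gcongr
      _ = _ := by ring

end RoughCommutator

namespace RoughCommutator

variable {E : Type*} [NormedAddCommGroup E] [InnerProductSpace ℝ E] [FiniteDimensional ℝ E]
  [MeasurableSpace E] [BorelSpace E]

/-! ### Integral operators with continuous compactly supported kernels -/

/-- Each summand factors through `ℂ`. -/
theorem exists_finiteRank {X Y ι : Type*} [NormedAddCommGroup X] [NormedSpace ℂ X]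
    [NormedAddCommGroup Y] [NormedSpace ℂ Y] (s : Finset ι) (l : ι → X →L[ℂ] ℂ) (u : ι → Y) :
    ∃ S : X →L[ℂ] Y, IsCompactOperator S ∧ ∀ f, S f = ∑ i ∈ s, l i f • u i := by
  classical
  induction s using Finset.induction_on with
  | empty => exact ⟨0, isCompactOperator_zero, by simp⟩
  | insert i s hi ih =>
    obtain ⟨S, hS, hSf⟩ := ih
    have h1 : IsCompactOperator ((ContinuousLinearMap.smulRight (1 : ℂ →L[ℂ] ℂ) (u i)).comp
        (l i)) := (isCompactOperator_of_locallyCompactSpace_dom (l i)).clm_comp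
        (ContinuousLinearMap.smulRight (1 : ℂ →L[ℂ] ℂ) (u i))
    refine ⟨(ContinuousLinearMap.smulRight (1 : ℂ →L[ℂ] ℂ) (u i)).comp (l i) + S, h1.add hS,
      fun f => ?_⟩
    rw [Finset.sum_insert hi, ← hSf]
    simp

theorem exists_clm_integral_mul {p p' : ℝ≥0∞} [Fact (1 ≤ p)] [h : ENNReal.HolderTriple p' p 1]
    {k : E → ℂ} (hk : MemLp k p' volume) :
    ∃ l : Lp ℂ p (volume : Measure E) →L[ℂ] ℂ,
      ∀ g : testFun E, l (testFunToLp p g) = ∫ y, k y * (g : E → ℂ) y := by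
  have hp' : Fact (1 ≤ p') := ⟨ENNReal.HolderTriple.le p' p 1⟩
  refine ⟨(ContinuousLinearMap.mul ℂ ℂ).lpPairing volume p' p (hk.toLp k), fun g => ?_⟩
  rw [ContinuousLinearMap.lpPairing_eq_integral]
  refine integral_congr_ae ?_
  filter_upwards [hk.coeFn_toLp, coeFn_testFunToLp p g] with x h1 h2
  rw [h1, h2]
  rfl

theorem exists_simpleFunc_dist_lt {K : Set E} (hK : IsCompact K) {δ : ℝ} (hδ : 0 < δ) :
    ∃ s : SimpleFunc E E, ∀ x ∈ K, dist (s x) x < δ := by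
  obtain ⟨t, ht⟩ := hK.elim_finite_subcover (fun k : ℕ => Metric.ball (TopologicalSpace.denseSeq E k) δ)
    (fun k => Metric.isOpen_ball) (fun x _ => by
      obtain ⟨k, hk⟩ := (TopologicalSpace.denseRange_denseSeq E).exists_dist_lt x hδ
      exact Set.mem_iUnion.2 ⟨k, hk⟩)
  refine ⟨SimpleFunc.nearestPt (TopologicalSpace.denseSeq E) (t.sup id), fun x hx => ?_⟩
  obtain ⟨k, hk, hxk⟩ := Set.mem_iUnion₂.1 (ht hx)
  have h1 := SimpleFunc.edist_nearestPt_le (TopologicalSpace.denseSeq E) x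
    (Finset.le_sup (f := id) hk)
  rw [edist_dist, edist_dist, ENNReal.ofReal_le_ofReal_iff dist_nonneg] at h1
  rw [Metric.mem_ball, dist_comm] at hxk
  exact h1.trans_lt hxk

/-- An integral operator with a continuous compactly supported kernel is approximated in norm by
operators of finite rank. -/
theorem exists_isCompactOperator_kernel_approx {p p' q : ℝ≥0∞} [Fact (1 ≤ p)] [Fact (1 ≤ q)]
    [ENNReal.HolderTriple p' p 1] {H : E × E → ℂ}
    (hH : Continuous H) (hs : HasCompactSupport H) (hqt : q ≠ ⊤) {η : ℝ≥0∞}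
    (hη : η ≠ 0) :
    ∃ S : Lp ℂ p (volume : Measure E) →L[ℂ] Lp ℂ q (volume : Measure E), IsCompactOperator S ∧
      ∀ g : testFun E, eLpNorm (fun x => (∫ y, H (x, y) * (g : E → ℂ) y) -
        S (testFunToLp p g) x) q volume ≤ η * eLpNorm (g : E → ℂ) p volume := by
  obtain ⟨R, hR⟩ := hs.isCompact.isBounded.subset_closedBall (0 : E × E)
  set K : Set E := Metric.closedBall 0 R with hK
  have hKm : MeasurableSet K := Metric.isClosed_closedBall.measurableSet
  have hKt : volume K ≠ ⊤ := measure_closedBall_lt_top.ne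
  have hH0 : ∀ x y, (x ∉ K ∨ y ∉ K) → H (x, y) = 0 := by
    intro x y hxy
    refine image_eq_zero_of_notMem_tsupport fun hmem => ?_
    have h1 := hR hmem
    rw [mem_closedBall_zero_iff, Prod.norm_def, max_le_iff] at h1
    simp only [hK, mem_closedBall_zero_iff] at hxy
    tauto
  have hHx : ∀ x, Continuous fun y => H (x, y) := fun x => by fun_prop
  have hHc : ∀ x, HasCompactSupport fun y => H (x, y) := fun x =>
    HasCompactSupport.intro (isCompact_closedBall (0 : E) R) fun y hy => hH0 x y (Or.inr hy)
  have hk : ∀ x, MemLp (fun y => H (x, y)) p' volume := fun x =>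
    (hHx x).memLp_of_hasCompactSupport (hHc x)
  choose l hl using fun x => exists_clm_integral_mul (p := p) (hk x)
  set kp : ℝ≥0∞ := eLpNorm (K.indicator fun _ => (1 : ℂ)) p' volume with hkp
  set kq : ℝ≥0∞ := eLpNorm (K.indicator fun _ => (1 : ℂ)) q volume with hkq
  have hkpt : kp ≠ ⊤ := (memLp_indicator_const p' hKm (1 : ℂ) (Or.inr hKt)).2.ne
  have hkqt : kq ≠ ⊤ := (memLp_indicator_const q hKm (1 : ℂ) (Or.inr hKt)).2.ne
  -- A kernel of size at most `c` supported in `K × K` has norm at most `c * kq * kp` from `L^p` to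
  -- `L^q`.
  obtain ⟨c, hc0, hc⟩ : ∃ c : ℝ, 0 < c ∧ ENNReal.ofReal c * (kq * kp) ≤ η := by
    obtain ⟨c, hc0, hc⟩ := ENNReal.exists_nnreal_pos_mul_lt (ENNReal.mul_ne_top hkqt hkpt) hη
    exact ⟨c, hc0, by simpa using hc.le⟩
  obtain ⟨δ, hδ, hunif⟩ := Metric.uniformContinuous_iff.1
    (hs.uniformContinuous_of_continuous hH) c hc0
  -- Rounding the first variable to finitely many points makes the operator of finite rank, and
  -- uniform continuity keeps the change of the kernel below `c`.
  obtain ⟨s, hsd⟩ := exists_simpleFunc_dist_lt (isCompact_closedBall (0 : E) R) hδ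
  have hPm : ∀ a, MeasurableSet (K ∩ s ⁻¹' {a}) := fun a => hKm.inter (s.measurableSet_fiber a)
  have hPt : ∀ a, volume (K ∩ s ⁻¹' {a}) ≠ ⊤ := fun a =>
    ((measure_mono Set.inter_subset_left).trans_lt hKt.lt_top).ne
  obtain ⟨S, hS, hSf⟩ := exists_finiteRank s.range l
    (fun a => indicatorConstLp q (hPm a) (hPt a) (1 : ℂ))
  refine ⟨S, hS, fun g => ?_⟩
  have hSx : ∀ᵐ x, S (testFunToLp p g) x = K.indicator
      (fun x => ∫ y, H (s x, y) * (g : E → ℂ) y) x := by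
    rw [hSf]
    have h1 := Lp.coeFn_finsetSum s.range fun a => l a (testFunToLp p g) •
      indicatorConstLp q (hPm a) (hPt a) (1 : ℂ)
    have h2 : ∀ᵐ x, ∀ a ∈ s.range, (l a (testFunToLp p g) •
        indicatorConstLp q (hPm a) (hPt a) (1 : ℂ) : Lp ℂ q (volume : Measure E)) x =
        l a (testFunToLp p g) * (K ∩ s ⁻¹' {a}).indicator (fun _ => (1 : ℂ)) x := by
      rw [Finset.eventually_all]
      intro a _
      filter_upwards [Lp.coeFn_smul (l a (testFunToLp p g))
        (indicatorConstLp q (hPm a) (hPt a) (1 : ℂ)), indicatorConstLp_coeFn (p := q)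
          (hs := hPm a) (hμs := hPt a) (c := (1 : ℂ))] with x h3 h4
      rw [h3, Pi.smul_apply, h4, smul_eq_mul]
    filter_upwards [h1, h2] with x h3 h4
    rw [h3, Finset.sum_apply, Finset.sum_congr rfl h4]
    by_cases hx : x ∈ K
    · rw [Set.indicator_of_mem hx, Finset.sum_eq_single (s x)]
      · rw [Set.indicator_of_mem (by exact ⟨hx, rfl⟩), mul_one, hl]
      · intro a _ ha
        rw [Set.indicator_of_notMem (by exact fun h => ha h.2.symm), mul_zero]
      · intro h
        exact absurd (SimpleFunc.mem_range_self s x) h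
    · rw [Set.indicator_of_notMem hx]
      refine Finset.sum_eq_zero fun a _ => ?_
      rw [Set.indicator_of_notMem (by exact fun h => hx h.1), mul_zero]
  have hgi : ∫⁻ y in K, ‖(g : E → ℂ) y‖ₑ ≤ kp * eLpNorm (g : E → ℂ) p volume := by
    have h1 := eLpNorm_smul_le_mul_eLpNorm (p := p') (q := p) (r := 1)
      (μ := (volume : Measure E)) (memLp_testFun p g).1
      (memLp_indicator_const p' hKm (1 : ℂ) (Or.inr hKt)).1
    refine le_trans (le_of_eq ?_) h1
    rw [eLpNorm_one_eq_lintegral_enorm, ← lintegral_indicator hKm]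
    refine lintegral_congr fun y => ?_
    by_cases hy : y ∈ K <;> simp [hy]
  have hint : ∀ x, Integrable fun y => H (x, y) * (g : E → ℂ) y := fun x =>
    ((hHx x).mul g.2.1.continuous).integrable_of_hasCompactSupport ((hHc x).mul_right)
  calc eLpNorm (fun x => (∫ y, H (x, y) * (g : E → ℂ) y) - S (testFunToLp p g) x) q volume
      ≤ eLpNorm (fun x => ENNReal.ofReal c * (kp * eLpNorm (g : E → ℂ) p volume) *
          ‖K.indicator (fun _ => (1 : ℂ)) x‖ₑ) q volume := by
        refine eLpNorm_mono_enorm_ae ?_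
        filter_upwards [hSx] with x hx
        rw [hx, enorm_eq_self]
        by_cases hxK : x ∈ K
        · rw [Set.indicator_of_mem hxK, Set.indicator_of_mem hxK, enorm_one, mul_one,
            ← integral_sub (hint x) (hint (s x))]
          refine (enorm_integral_le_lintegral_enorm _).trans ?_
          calc ∫⁻ y, ‖H (x, y) * (g : E → ℂ) y - H (s x, y) * (g : E → ℂ) y‖ₑ
              ≤ ∫⁻ y, K.indicator (fun y => ENNReal.ofReal c * ‖(g : E → ℂ) y‖ₑ) y := by
                refine lintegral_mono fun y => ?_
                by_cases hy : y ∈ K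
                · rw [Set.indicator_of_mem hy, ← sub_mul, enorm_mul]
                  gcongr
                  rw [← ofReal_norm, ← dist_eq_norm]
                  refine ENNReal.ofReal_le_ofReal (hunif ?_).le
                  rw [dist_comm, Prod.dist_eq, dist_self]
                  exact max_lt (hsd x hxK) hδ
                · simp [hH0 x y (Or.inr hy), hH0 (s x) y (Or.inr hy)]
            _ = ENNReal.ofReal c * ∫⁻ y in K, ‖(g : E → ℂ) y‖ₑ := by
                rw [lintegral_indicator hKm,
                  lintegral_const_mul _ g.2.1.continuous.measurable.enorm]
            _ ≤ _ := by gcongr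
        · rw [Set.indicator_of_notMem hxK]
          have : ∀ y, H (x, y) * (g : E → ℂ) y = 0 := fun y => by rw [hH0 x y (Or.inl hxK), zero_mul]
          simp [this]
    _ ≤ ENNReal.ofReal c * (kp * eLpNorm (g : E → ℂ) p volume) * kq := by
        rw [eLpNorm_const_mul_ennreal (zero_lt_one.trans_le Fact.out).ne' hqt _
          (measurable_const.indicator hKm).enorm, eLpNorm_enorm]
    _ = ENNReal.ofReal c * (kq * kp) * eLpNorm (g : E → ℂ) p volume := by ring
    _ ≤ _ := by gcongr

end RoughCommutator

namespace RoughCommutator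

variable {E : Type*} [NormedAddCommGroup E] [InnerProductSpace ℝ E] [FiniteDimensional ℝ E]
  [MeasurableSpace E] [BorelSpace E]

/-! ### Approximation of the commutator with a smooth symbol -/

theorem tendsto_setLIntegral_zero_of_eventually_notMem {f : E → ℝ≥0∞} (hf : Measurable f)
    {B : Set E} (hfin : ∫⁻ z in B, f z ≠ ⊤) {A : ℕ → Set E}
    (hA : ∀ N, MeasurableSet (A N)) (hAB : ∀ N, A N ⊆ B)
    (hlim : ∀ᵐ z : E, ∀ᶠ N in atTop, z ∉ A N) :
    Tendsto (fun N => ∫⁻ z in A N, f z) atTop (𝓝 0) := by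
  have e : ∀ N, ∫⁻ z in A N, f z = ∫⁻ z in B, (A N).indicator f z := fun N => by
    rw [setLIntegral_indicator (hA N), Set.inter_eq_self_of_subset_left (hAB N)]
  simp_rw [e]
  have h0 : (0 : ℝ≥0∞) = ∫⁻ z in B, 0 := by simp
  rw [h0]
  refine tendsto_lintegral_of_dominated_convergence f (fun N => hf.indicator (hA N))
    (fun N => ae_of_all _ fun z => Set.indicator_le_self _ _ _) hfin ?_
  filter_upwards [ae_restrict_of_ae hlim] with z hz
  refine tendsto_const_nhds.congr' ?_
  filter_upwards [hz] with N hN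
  rw [Set.indicator_of_notMem hN]

theorem rpow_le_add_rpow {s v : ℝ} (hs : 1 ≤ s) (hv : s ≤ v) (x : ℝ≥0∞) : x ^ s ≤ x + x ^ v := by
  rcases le_total x 1 with hx | hx
  · refine le_trans ?_ le_self_add
    nth_rewrite 2 [← ENNReal.rpow_one x]
    exact ENNReal.rpow_le_rpow_of_exponent_ge hx hs
  · exact (ENNReal.rpow_le_rpow_of_exponent_le hx hv).trans le_add_self

theorem measurableSet_norm_gt (a : ℝ) : MeasurableSet {z : E | a < ‖z‖} :=
  measurableSet_lt measurable_const measurable_norm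

theorem measurableSet_norm_le (a : ℝ) : MeasurableSet {z : E | ‖z‖ ≤ a} :=
  measurableSet_le measurable_norm measurable_const

namespace Angular

variable {v : ℝ} {Ω : E → ℂ}

theorem lintegral_near_ne_top [Nontrivial E] (hΩ : Angular v Ω) :
    ∫⁻ z in {z : E | ‖z‖ ≤ 1}, ‖z‖ₑ * ‖ker Ω z‖ₑ ≠ ⊤ := by
  obtain ⟨A, hA, hle⟩ := hΩ.lintegral_ker_le
  set h : ℝ → ℝ≥0∞ := (Set.Iic (1 : ℝ)).indicator fun r => ENNReal.ofReal r with hh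
  have hhm : Measurable h := ENNReal.measurable_ofReal.indicator measurableSet_Iic
  refine ne_top_of_le_ne_top ?_ (calc
    ∫⁻ z in {z : E | ‖z‖ ≤ 1}, ‖z‖ₑ * ‖ker Ω z‖ₑ = ∫⁻ z, ‖ker Ω z‖ₑ * h ‖z‖ := by
        rw [← lintegral_indicator (measurableSet_norm_le 1)]
        refine lintegral_congr fun z => ?_
        by_cases hz : ‖z‖ ≤ 1
        · rw [Set.indicator_of_mem (by exact hz), hh, Set.indicator_of_mem (by exact hz),
            ofReal_norm, mul_comm]
        · rw [Set.indicator_of_notMem (by exact hz), hh, Set.indicator_of_notMem (by exact hz),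
            mul_zero]
    _ ≤ A * ∫⁻ r in Set.Ioi (0 : ℝ), ENNReal.ofReal r⁻¹ * h r := hle h hhm
    _ ≤ A * ∫⁻ r in Set.Ioi (0 : ℝ), (Set.Ioc (0 : ℝ) 1).indicator 1 r := by
        gcongr A * ?_
        refine setLIntegral_mono (measurable_one.indicator measurableSet_Ioc) fun r hr => ?_
        have hr0 : (0 : ℝ) < r := hr
        by_cases hr1 : r ≤ 1
        · rw [hh, Set.indicator_of_mem (by exact hr1),
            Set.indicator_of_mem (show r ∈ Set.Ioc (0 : ℝ) 1 from ⟨hr0, hr1⟩),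
            ← ENNReal.ofReal_mul (by positivity), inv_mul_cancel₀ hr0.ne']
          simp
        · rw [hh, Set.indicator_of_notMem (by exact hr1)]
          simp)
  refine ENNReal.mul_ne_top hA ((setLIntegral_le_lintegral _ _).trans_lt ?_).ne
  rw [lintegral_indicator measurableSet_Ioc]
  simp

/-- The radial integrand is `r^(d-1-ds)`, integrable at infinity because `s > 1`; the bound `s ≤ v`
controls the angular part. For `s = 1` the radial integral diverges, so the tail cannot be treated
in `L^1`. -/
theorem lintegral_far_ne_top [Nontrivial E] (hΩ : Angular v Ω) {s : ℝ} (hs : 1 < s)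
    (hsv : s ≤ v) : ∫⁻ z in {z : E | 1 < ‖z‖}, ‖ker Ω z‖ₑ ^ s ≠ ⊤ := by
  obtain ⟨A₁, hA₁, hle₁⟩ := hΩ.bound_one
  obtain ⟨A₂, hA₂, hle₂⟩ := hΩ.bound
  set d := Module.finrank ℝ E with hd
  have hd0 : 0 < d := Module.finrank_pos
  set h : ℝ → ℝ≥0∞ := (Set.Ioi (1 : ℝ)).indicator fun r => ENNReal.ofReal ((r ^ d)⁻¹) ^ s with hh
  have hhm : Measurable h := (by fun_prop : Measurable fun r : ℝ =>
    ENNReal.ofReal ((r ^ d)⁻¹) ^ s).indicator measurableSet_Ioi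
  have hrad : ∫⁻ r in Set.Ioi (0 : ℝ), ENNReal.ofReal (r ^ (d - 1)) * h r ≠ ⊤ := by
    have hlt : (d : ℝ) - 1 - d * s < -1 := by
      have : (1 : ℝ) ≤ d := by exact_mod_cast hd0
      nlinarith
    have hi : IntegrableOn (fun r : ℝ => r ^ ((d : ℝ) - 1 - d * s)) (Set.Ioi 1) :=
      integrableOn_Ioi_rpow_of_lt hlt zero_lt_one
    refine ne_top_of_le_ne_top hi.2.ne (le_of_eq ?_)
    rw [← lintegral_indicator measurableSet_Ioi, ← lintegral_indicator measurableSet_Ioi]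
    refine lintegral_congr fun r => ?_
    by_cases hr : 1 < r
    · have hr0 : 0 < r := zero_lt_one.trans hr
      rw [Set.indicator_of_mem (by exact hr0), Set.indicator_of_mem (by exact hr), hh,
        Set.indicator_of_mem (by exact hr), ENNReal.ofReal_rpow_of_pos (by positivity),
        ← ENNReal.ofReal_mul (by positivity), ← ofReal_norm,
        Real.norm_of_nonneg (by positivity)]
      congr 1
      rw [← Real.rpow_natCast, ← Real.rpow_natCast, ← Real.rpow_neg hr0.le, ← Real.rpow_mul hr0.le,
        ← Real.rpow_add hr0, Nat.cast_sub (by omega)]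
      congr 1
      push_cast
      ring
    · rw [Set.indicator_of_notMem (s := Set.Ioi (1 : ℝ)) (by exact hr)]
      by_cases hr0 : 0 < r
      · rw [Set.indicator_of_mem (by exact hr0), hh, Set.indicator_of_notMem (by exact hr),
          mul_zero]
      · rw [Set.indicator_of_notMem (by exact hr0)]
  have hm1 : Measurable fun z => ‖Ω z‖ₑ * h ‖z‖ :=
    hΩ.measurable.enorm.mul (hhm.comp measurable_norm)
  refine ne_top_of_le_ne_top (ENNReal.add_ne_top.2 ⟨ENNReal.mul_ne_top hA₁ hrad,
    ENNReal.mul_ne_top hA₂ hrad⟩) (calc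
      ∫⁻ z in {z : E | 1 < ‖z‖}, ‖ker Ω z‖ₑ ^ s
        ≤ ∫⁻ z, (‖Ω z‖ₑ * h ‖z‖ + ‖Ω z‖ₑ ^ v * h ‖z‖) := by
          rw [← lintegral_indicator (measurableSet_norm_gt 1)]
          refine lintegral_mono fun z => ?_
          by_cases hz : 1 < ‖z‖
          · rw [Set.indicator_of_mem (by exact hz), hh, Set.indicator_of_mem (by exact hz),
              enorm_ker, ENNReal.mul_rpow_of_nonneg _ _ (by linarith), ← add_mul]
            gcongr
            exact rpow_le_add_rpow hs.le hsv _
          · rw [Set.indicator_of_notMem (by exact hz)]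
            exact zero_le
      _ = (∫⁻ z, ‖Ω z‖ₑ * h ‖z‖) + ∫⁻ z, ‖Ω z‖ₑ ^ v * h ‖z‖ := lintegral_add_left hm1 _
      _ ≤ _ := add_le_add (hle₁ h hhm) (hle₂ h hhm))

theorem tendsto_lintegral_near [Nontrivial E] (hΩ : Angular v Ω) :
    Tendsto (fun N : ℕ => ∫⁻ z in {z : E | ‖z‖ ≤ 1 / ((N : ℝ) + 1)}, ‖z‖ₑ * ‖ker Ω z‖ₑ) atTop
      (𝓝 0) := by
  refine tendsto_setLIntegral_zero_of_eventually_notMem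
    (measurable_enorm.mul (measurable_ker hΩ.measurable).enorm)
    hΩ.lintegral_near_ne_top (fun N => measurableSet_norm_le _) (fun N z hz => ?_) ?_
  · have hz' : ‖z‖ ≤ 1 / ((N : ℝ) + 1) := hz
    refine hz'.trans ?_
    rw [div_le_one (by positivity)]
    linarith [(Nat.cast_nonneg N : (0 : ℝ) ≤ N)]
  · have hne : ∀ᵐ z : E, z ≠ 0 := by simp [ae_iff]
    filter_upwards [hne] with z hz
    have := (tendsto_one_div_add_atTop_nhds_zero_nat (𝕜 := ℝ)).eventually_lt_const
      (norm_pos_iff.2 hz)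
    filter_upwards [this] with N hN
    exact not_le.2 hN

theorem tendsto_lintegral_far [Nontrivial E] (hΩ : Angular v Ω) {s : ℝ} (hs : 1 < s)
    (hsv : s ≤ v) :
    Tendsto (fun N : ℕ => ∫⁻ z in {z : E | (N : ℝ) + 1 < ‖z‖}, ‖ker Ω z‖ₑ ^ s) atTop (𝓝 0) := by
  refine tendsto_setLIntegral_zero_of_eventually_notMem
    ((measurable_ker hΩ.measurable).enorm.pow_const s)
    (hΩ.lintegral_far_ne_top hs hsv) (fun N => measurableSet_norm_gt _) (fun N z hz => ?_) ?_
  · have hz' : (N : ℝ) + 1 < ‖z‖ := hz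
    change 1 < ‖z‖
    linarith [(Nat.cast_nonneg N : (0 : ℝ) ≤ N)]
  · refine ae_of_all _ fun z => ?_
    filter_upwards [(tendsto_natCast_atTop_atTop (R := ℝ)).eventually_ge_atTop ‖z‖] with N hN
    exact not_lt.2 (by linarith)

end Angular

end RoughCommutator

namespace RoughCommutator

variable {E : Type*} [NormedAddCommGroup E] [InnerProductSpace ℝ E] [FiniteDimensional ℝ E]
  [MeasurableSpace E] [BorelSpace E]

/-- Since `min κ 1 ≤ 1`, its power with exponent `t ≥ s` is at most `κ ^ s`. -/
theorem eLpNorm_min_indicator_le {κ : E → ℝ≥0∞} (hκ : Measurable κ) {A : Set E}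
    (hA : MeasurableSet A) (B : ℝ≥0∞) {s : ℝ} (hs : 0 ≤ s) {t : ℝ≥0∞} (ht0 : t ≠ 0) (htt : t ≠ ⊤)
    (hst : s ≤ t.toReal) :
    eLpNorm (fun z => B * A.indicator (fun z => min (κ z) 1) z) t volume ≤
      B * (∫⁻ z in A, κ z ^ s) ^ (1 / t.toReal) := by
  have ht : 0 < t.toReal := ENNReal.toReal_pos ht0 htt
  rw [eLpNorm_const_mul_ennreal ht0 htt B ((hκ.min measurable_const).indicator hA),
    eLpNorm_eq_lintegral_rpow_enorm_toReal ht0 htt, ← lintegral_indicator hA]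
  gcongr with z
  rw [enorm_eq_self]
  by_cases hz : z ∈ A
  · rw [Set.indicator_of_mem hz, Set.indicator_of_mem hz]
    exact (ENNReal.rpow_le_rpow_of_exponent_ge (min_le_right _ _) hst).trans
      (ENNReal.rpow_le_rpow (min_le_left _ _) hs)
  · rw [Set.indicator_of_notMem hz, ENNReal.zero_rpow_of_pos ht]
    exact zero_le

/-- Splits the tail of the kernel by size: large values are controlled by `κ ^ s` in `L^1`, while
`min κ 1` lies in every `L^t` with `t ≥ s`. -/
theorem le_rpow_add_min_one {s : ℝ} (hs : 1 ≤ s) (x : ℝ≥0∞) : x ≤ x ^ s + min x 1 := by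
  rcases le_total x 1 with hx | hx
  · rw [min_eq_left hx]
    exact le_add_self
  · refine le_trans ?_ le_self_add
    nth_rewrite 1 [← ENNReal.rpow_one x]
    exact ENNReal.rpow_le_rpow_of_exponent_le hx hs

/-- The singular kernel is the sum of a continuous compactly supported kernel and of an error which,
weighted by a Lipschitz modulus, is small in `L^1 + (L^t ∩ L^t')`. -/
theorem Angular.exists_kernel_decomposition {v : ℝ} {Ω : E → ℂ} [Nontrivial E] (hΩ : Angular v Ω)
    {t t' : ℝ≥0∞} (ht : 1 < t) (htt : t ≠ ⊤) (ht' : 1 < t') (htt' : t' ≠ ⊤) {L B : ℝ≥0∞}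
    (hL : L ≠ ⊤) (hB : B ≠ ⊤) {δ : ℝ≥0∞} (hδ : δ ≠ 0) :
    ∃ (k : E → ℂ) (κ₁ κ₂ : E → ℝ≥0∞), Continuous k ∧ HasCompactSupport k ∧ Measurable κ₁ ∧
      Measurable κ₂ ∧ (∀ z, ‖ker Ω z - k z‖ₑ * min (L * ‖z‖ₑ) B ≤ κ₁ z + κ₂ z) ∧
      ∫⁻ z, κ₁ z ≤ δ ∧ eLpNorm κ₂ t volume ≤ δ ∧ eLpNorm κ₂ t' volume ≤ δ := by
  have h1t : 1 < t.toReal := by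
    rwa [← ENNReal.toReal_one, ENNReal.toReal_lt_toReal ENNReal.one_ne_top htt]
  have h1t' : 1 < t'.toReal := by
    rwa [← ENNReal.toReal_one, ENNReal.toReal_lt_toReal ENNReal.one_ne_top htt']
  -- The tail is in `L^s` for `s ≤ v`, and its truncation by one is then in both target spaces
  -- because `s` exceeds neither exponent.
  set s : ℝ := min v (min t.toReal t'.toReal) with hs
  have hs1 : 1 < s := lt_min hΩ.one_lt (lt_min h1t h1t')
  have hsv : s ≤ v := min_le_left _ _
  have hst : s ≤ t.toReal := (min_le_right _ _).trans (min_le_left _ _)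
  have hst' : s ≤ t'.toReal := (min_le_right _ _).trans (min_le_right _ _)
  -- Three errors make up `κ₁`: the part near the origin, the approximation of the middle part, and
  -- the large values of the tail.
  have hδ3 : 0 < δ / 3 := ENNReal.div_pos hδ (by norm_num)
  have hkm : Measurable fun z => ‖ker Ω z‖ₑ := (measurable_ker hΩ.measurable).enorm
  have hnear := hΩ.tendsto_lintegral_near
  have hfar := hΩ.tendsto_lintegral_far hs1 hsv
  have hc : ∀ (a : ℝ≥0∞), a ≠ ⊤ → ∀ u : ℕ → ℝ≥0∞, Tendsto u atTop (𝓝 0) → ∀ e, 0 < e →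
      ∀ᶠ N in atTop, a * u N ≤ e := fun a ha u hu e he => by
    have := ENNReal.Tendsto.const_mul hu (Or.inr ha)
    rw [mul_zero] at this
    exact this.eventually_le_const he
  have hpow : ∀ τ : ℝ, 0 < τ → Tendsto (fun N : ℕ =>
      (∫⁻ z in {z : E | (N : ℝ) + 1 < ‖z‖}, ‖ker Ω z‖ₑ ^ s) ^ (1 / τ)) atTop (𝓝 0) := fun τ hτ => by
    have := hfar.ennrpow_const (1 / τ)
    rwa [ENNReal.zero_rpow_of_pos (by positivity)] at this
  obtain ⟨N, ⟨hN1, hN2⟩, hN3, hN4⟩ := (((hc L hL _ hnear _ hδ3).and (hc B hB _ hfar _ hδ3)).and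
    ((hc B hB _ (hpow t.toReal (by linarith)) _ (pos_iff_ne_zero.2 hδ)).and
      (hc B hB _ (hpow t'.toReal (by linarith)) _ (pos_iff_ne_zero.2 hδ)))).exists
  set An : Set E := {z : E | ‖z‖ ≤ 1 / ((N : ℝ) + 1)} with hAn
  set Af : Set E := {z : E | (N : ℝ) + 1 < ‖z‖} with hAf
  have hAnm : MeasurableSet An := measurableSet_norm_le _
  have hAfm : MeasurableSet Af := measurableSet_norm_gt _
  set m : E → ℂ := (An ∪ Af)ᶜ.indicator (ker Ω) with hm
  have hmm : Measurable m := (measurable_ker hΩ.measurable).indicator (hAnm.union hAfm).compl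
  have hmi : MemLp m 1 volume := by
    rw [memLp_one_iff_integrable, hm, integrable_indicator_iff (hAnm.union hAfm).compl]
    -- The radius `N + 2` leaves room: the middle region contains the sphere of radius `N + 1`,
    -- while the annulus is open.
    refine (hΩ.integrableOn_ker (a := 1 / ((N : ℝ) + 1)) (b := N + 2) (by positivity)).mono_set ?_
    intro z hz
    have h1 : ¬ ‖z‖ ≤ 1 / ((N : ℝ) + 1) := fun h => hz (Or.inl h)
    have h2 : ¬ (N : ℝ) + 1 < ‖z‖ := fun h => hz (Or.inr h)
    exact ⟨not_le.1 h1, by linarith⟩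
  obtain ⟨e, he0, hBe⟩ : ∃ e : ℝ≥0∞, e ≠ 0 ∧ B * e ≤ δ / 3 :=
    ⟨δ / 3 / (B + 1), (ENNReal.div_pos hδ3.ne' (by simp [hB])).ne', by
      calc B * (δ / 3 / (B + 1)) ≤ (B + 1) * (δ / 3 / (B + 1)) := by gcongr; exact le_self_add
        _ ≤ δ / 3 := ENNReal.mul_div_le⟩
  obtain ⟨k, hks, hke, hkc, -⟩ := hmi.exists_hasCompactSupport_eLpNorm_sub_le ENNReal.one_ne_top he0
  rw [eLpNorm_one_eq_lintegral_enorm] at hke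
  have hnm : Measurable (An.indicator fun z => ‖z‖ₑ * ‖ker Ω z‖ₑ) :=
    (measurable_enorm.mul hkm).indicator hAnm
  have hm1 : Measurable fun z => L * An.indicator (fun z => ‖z‖ₑ * ‖ker Ω z‖ₑ) z :=
    hnm.const_mul _
  have hm2 : Measurable fun z => B * ‖(m - k) z‖ₑ := (hmm.sub hkc.measurable).enorm.const_mul _
  have hm3 : Measurable fun z => B * Af.indicator (fun z => ‖ker Ω z‖ₑ ^ s) z :=
    ((hkm.pow_const s).indicator hAfm).const_mul _
  have hm4 : Measurable fun z => B * Af.indicator (fun z => min ‖ker Ω z‖ₑ 1) z :=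
    ((hkm.min measurable_const).indicator hAfm).const_mul _
  refine ⟨k, fun z => L * An.indicator (fun z => ‖z‖ₑ * ‖ker Ω z‖ₑ) z + B * ‖(m - k) z‖ₑ +
    B * Af.indicator (fun z => ‖ker Ω z‖ₑ ^ s) z,
    fun z => B * Af.indicator (fun z => min ‖ker Ω z‖ₑ 1) z, hkc, hks, (hm1.add hm2).add hm3, hm4,
    fun z => ?_, ?_, ?_, ?_⟩
  · have hle : ‖ker Ω z - k z‖ₑ ≤ ‖ker Ω z - m z‖ₑ + ‖(m - k) z‖ₑ := by
      rw [show ker Ω z - k z = (ker Ω z - m z) + (m - k) z by simp]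
      exact enorm_add_le _ _
    have hdiff : ‖ker Ω z - m z‖ₑ * min (L * ‖z‖ₑ) B ≤
        L * An.indicator (fun z => ‖z‖ₑ * ‖ker Ω z‖ₑ) z +
          (B * Af.indicator (fun z => ‖ker Ω z‖ₑ ^ s) z +
            B * Af.indicator (fun z => min ‖ker Ω z‖ₑ 1) z) := by
      by_cases hz : z ∈ An
      · rw [hm, Set.indicator_of_notMem (by simp [hz]), sub_zero, Set.indicator_of_mem hz]
        refine le_trans ?_ le_self_add
        calc ‖ker Ω z‖ₑ * min (L * ‖z‖ₑ) B ≤ ‖ker Ω z‖ₑ * (L * ‖z‖ₑ) := by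
              gcongr; exact min_le_left _ _
          _ = _ := by ring
      · by_cases hz' : z ∈ Af
        · rw [hm, Set.indicator_of_notMem (by simp [hz']), sub_zero, Set.indicator_of_mem hz',
            Set.indicator_of_mem hz', ← mul_add]
          refine le_trans ?_ le_add_self
          calc ‖ker Ω z‖ₑ * min (L * ‖z‖ₑ) B ≤ ‖ker Ω z‖ₑ * B := by
                gcongr; exact min_le_right _ _
            _ = B * ‖ker Ω z‖ₑ := mul_comm _ _
            _ ≤ _ := by gcongr; exact le_rpow_add_min_one hs1.le _
        · rw [hm, Set.indicator_of_mem (by simp [hz, hz']), sub_self, enorm_zero, zero_mul]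
          exact zero_le
    calc ‖ker Ω z - k z‖ₑ * min (L * ‖z‖ₑ) B
        ≤ ‖ker Ω z - m z‖ₑ * min (L * ‖z‖ₑ) B + ‖(m - k) z‖ₑ * B := by
          refine (mul_le_mul_left hle _).trans ?_
          rw [add_mul]
          gcongr
          exact min_le_right _ _
      _ ≤ _ := add_le_add_left hdiff _
      _ = _ := by ring
  · rw [lintegral_add_right _ hm3, lintegral_add_right _ hm2,
      lintegral_const_mul _ hnm,
      lintegral_const_mul _ (hmm.sub hkc.measurable).enorm,
      lintegral_const_mul _ ((hkm.pow_const s).indicator hAfm), lintegral_indicator hAnm,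
      lintegral_indicator hAfm]
    refine (add_le_add (add_le_add hN1 ((mul_le_mul_right hke B).trans hBe)) hN2).trans_eq ?_
    exact ENNReal.add_thirds δ
  · exact (eLpNorm_min_indicator_le hkm hAfm B (by linarith) (by positivity) htt hst).trans hN3
  · exact (eLpNorm_min_indicator_le hkm hAfm B (by linarith) (by positivity) htt' hst').trans hN4

end RoughCommutator

/-! ### The commutator with a smooth symbol as an integral operator. -/

namespace RoughCommutator

variable {E : Type*} [NormedAddCommGroup E] [InnerProductSpace ℝ E] [FiniteDimensional ℝ E]
  [MeasurableSpace E] [BorelSpace E]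

/-- The commutator of a singular integral with a smooth symbol, as an integral operator. -/
def commInt (Ω b g : E → ℂ) (x : E) : ℂ := ∫ z, ker Ω z * ((b x - b (x - z)) * g (x - z))

/-- The regularizing terms both equal `b x * g x` near the origin and cancel, so the commutator is
an absolutely convergent integral. -/
theorem mul_pvReg_sub_pvReg_mul (b g : E → ℂ) (x z : E) :
    b x * pvReg g x z - pvReg (b * g) x z = (b x - b (x - z)) * g (x - z) := by
  by_cases h : z ∈ Metric.closedBall (0 : E) 1
  · simp only [pvReg, Set.indicator_of_mem h, Pi.mul_apply]
    ring
  · simp only [pvReg, Set.indicator_of_notMem h, Pi.mul_apply]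
    ring

/-- The product of two test functions. -/
def testFunMul (b g : testFun E) : testFun E :=
  ⟨(b : E → ℂ) * (g : E → ℂ), b.2.1.mul g.2.1, b.2.2.mul_right⟩

theorem coe_testFunMul (b g : testFun E) :
    ((testFunMul b g : testFun E) : E → ℂ) = (b : E → ℂ) * (g : E → ℂ) := rfl

namespace Angular

variable {v : ℝ} {Ω : E → ℂ}

theorem integrable_comm [Nontrivial E] (hΩ : Angular v Ω) (b g : testFun E) (x : E) :
    Integrable fun z => ker Ω z * (((b : E → ℂ) x - (b : E → ℂ) (x - z)) * (g : E → ℂ) (x - z)) := by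
  have h1 := (hΩ.integrable_ker_mul_pvReg g.2.1 g.2.2 x).const_mul ((b : E → ℂ) x)
  have h2 := hΩ.integrable_ker_mul_pvReg (testFunMul b g).2.1 (testFunMul b g).2.2 x
  refine (h1.sub h2).congr (ae_of_all _ fun z => ?_)
  simp only [coe_testFunMul, Pi.sub_apply]
  rw [← mul_pvReg_sub_pvReg_mul]
  ring

theorem mul_pvInt_sub_pvInt_mul [Nontrivial E] (hΩ : Angular v Ω) (b g : testFun E) (x : E) :
    (b : E → ℂ) x * pvInt Ω g x - pvInt Ω (testFunMul b g) x = commInt Ω b g x := by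
  have h1 := (hΩ.integrable_ker_mul_pvReg g.2.1 g.2.2 x).const_mul ((b : E → ℂ) x)
  have h2 := hΩ.integrable_ker_mul_pvReg (testFunMul b g).2.1 (testFunMul b g).2.2 x
  rw [pvInt, pvInt, commInt, ← integral_const_mul, ← integral_sub h1 h2]
  congr 1
  ext z
  rw [← mul_pvReg_sub_pvReg_mul, coe_testFunMul]
  ring

end Angular

/-- The minimum tames the singularity at the origin, and the indicators confine the commutator to
the support of `b` in one of the two variables, which makes up for the slow decay of the kernel. -/
theorem exists_enorm_sub_le (b : testFun E) :
    ∃ L B : ℝ≥0∞, L ≠ ⊤ ∧ B ≠ ⊤ ∧ ∀ x z : E,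
      ‖(b : E → ℂ) x - (b : E → ℂ) (x - z)‖ₑ ≤ min (L * ‖z‖ₑ) B *
        ((tsupport (b : E → ℂ)).indicator 1 x + (tsupport (b : E → ℂ)).indicator 1 (x - z)) := by
  obtain ⟨K, hK⟩ := ContDiff.lipschitzWith_of_hasCompactSupport b.2.2 b.2.1 (by simp)
  obtain ⟨C, hC⟩ := b.2.2.exists_bound_of_continuous b.2.1.continuous
  have hC' : ∀ x, ‖(b : E → ℂ) x‖ₑ ≤ ENNReal.ofReal C := fun x => by
    rw [← ofReal_norm]
    exact ENNReal.ofReal_le_ofReal (hC x)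
  refine ⟨K, 2 * ENNReal.ofReal C, ENNReal.coe_ne_top,
    ENNReal.mul_ne_top (by norm_num) ENNReal.ofReal_ne_top, fun x z => ?_⟩
  have hle : ‖(b : E → ℂ) x - (b : E → ℂ) (x - z)‖ₑ ≤ min (K * ‖z‖ₑ) (2 * ENNReal.ofReal C) := by
    refine le_min ?_ ?_
    · have := hK x (x - z)
      rwa [edist_eq_enorm_sub, edist_eq_enorm_sub, sub_sub_cancel] at this
    · rw [two_mul]
      exact enorm_sub_le.trans (add_le_add (hC' _) (hC' _))
  by_cases h1 : x ∈ tsupport (b : E → ℂ)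
  · rw [Set.indicator_of_mem h1]
    refine hle.trans (le_mul_of_one_le_right' ?_)
    exact le_self_add
  · by_cases h2 : x - z ∈ tsupport (b : E → ℂ)
    · rw [Set.indicator_of_mem h2]
      refine hle.trans (le_mul_of_one_le_right' ?_)
      exact le_add_self
    · rw [image_eq_zero_of_notMem_tsupport h1, image_eq_zero_of_notMem_tsupport h2]
      simp

/-- One of the two variables lies in the support of `b`, and their difference in that of `k`, so the
other variable is confined as well. -/
theorem hasCompactSupport_comm_kernel {k b : E → ℂ} (hk : HasCompactSupport k)
    (hb : HasCompactSupport b) :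
    HasCompactSupport fun w : E × E => k (w.1 - w.2) * (b w.1 - b w.2) := by
  have hK := hk.isCompact.prod hb.isCompact
  refine HasCompactSupport.intro
    ((hK.image (f := fun w : E × E => (w.2, w.2 - w.1)) (by fun_prop)).union
      (hK.image (f := fun w : E × E => (w.2 + w.1, w.2)) (by fun_prop))) fun w hw => ?_
  by_contra hne
  obtain ⟨h1, h2⟩ := mul_ne_zero_iff.1 hne
  have hk1 : w.1 - w.2 ∈ tsupport k := subset_tsupport _ h1
  by_cases hb1 : b w.1 = 0
  · have hb2 : b w.2 ≠ 0 := fun h => h2 (by rw [hb1, h, sub_zero])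
    exact hw (Or.inr ⟨(w.1 - w.2, w.2), ⟨hk1, subset_tsupport _ hb2⟩, by simp⟩)
  · exact hw (Or.inl ⟨(w.1 - w.2, w.1), ⟨hk1, subset_tsupport _ hb1⟩, by simp⟩)

theorem eLpNorm_indicator_one_ne_top {K : Set E} (hK : IsCompact K) (p : ℝ≥0∞) :
    eLpNorm (K.indicator (1 : E → ℝ≥0∞)) p volume ≠ ⊤ := by
  have h : MemLp (K.indicator fun _ => (1 : ℝ)) p (volume : Measure E) :=
    memLp_indicator_const p hK.measurableSet 1 (Or.inr hK.measure_lt_top.ne)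
  refine ne_top_of_le_ne_top h.2.ne (eLpNorm_mono_enorm fun x => ?_)
  by_cases hx : x ∈ K
  · rw [Set.indicator_of_mem hx, Set.indicator_of_mem hx]
    simp
  · rw [Set.indicator_of_notMem hx]
    simp

theorem measurable_localized_lconv {κ c G : E → ℝ≥0∞} (hκ : Measurable κ) (hc : Measurable c)
    (hG : Measurable G) : Measurable fun x => ∫⁻ z, κ z * (c x + c (x - z)) * G (x - z) := by
  have h : Measurable fun w : E × E => κ w.2 * (c w.1 + c (w.1 - w.2)) * G (w.1 - w.2) := by
    fun_prop
  exact h.lintegral_prod_right'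

/-- The commutator with a smooth symbol is a norm limit of compact operators. -/
theorem Angular.exists_isCompactOperator_comm_approx [Nontrivial E] {v : ℝ} {Ω : E → ℂ}
    (hΩ : Angular v Ω) {r p p' q : ℝ≥0∞} [Fact (1 ≤ p)] [Fact (1 ≤ q)]
    [ENNReal.HolderTriple r p q] [ENNReal.HolderTriple p' p 1] (hq : 1 < q) (hr : r ≠ ⊤)
    (hpt : p ≠ ⊤) (hp' : 1 < p') (hpt' : p' ≠ ⊤) (b : testFun E) {η : ℝ≥0∞} (hη : η ≠ 0) :
    ∃ S : Lp ℂ p (volume : Measure E) →L[ℂ] Lp ℂ q (volume : Measure E), IsCompactOperator S ∧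
      ∀ g : testFun E, eLpNorm (fun x => commInt Ω b g x - S (testFunToLp p g) x) q volume ≤
        η * eLpNorm (g : E → ℂ) p volume := by
  have hqt : q ≠ ⊤ := ((ENNReal.HolderTriple.le r p q).trans_lt hr.lt_top).ne
  obtain ⟨L, B, hL, hB, hLB⟩ := exists_enorm_sub_le b
  set c : E → ℝ≥0∞ := (tsupport (b : E → ℂ)).indicator 1 with hc
  have hcm : Measurable c := measurable_one.indicator (isClosed_tsupport _).measurableSet
  have hcn : ∀ t, eLpNorm c t volume ≠ ⊤ := eLpNorm_indicator_one_ne_top b.2.2.isCompact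
  set D : ℝ≥0∞ := 2 * eLpNorm c r volume + (eLpNorm c q volume + eLpNorm c p' volume) with hD
  have hDt : D ≠ ⊤ := ENNReal.add_ne_top.2 ⟨ENNReal.mul_ne_top (by norm_num) (hcn r),
    ENNReal.add_ne_top.2 ⟨hcn q, hcn p'⟩⟩
  have hη2 : η / 2 ≠ 0 := (ENNReal.div_pos hη (by norm_num)).ne'
  obtain ⟨δ, hδ, hδD⟩ : ∃ δ : ℝ≥0∞, δ ≠ 0 ∧ D * δ ≤ η / 2 :=
    ⟨η / 2 / (D + 1), (ENNReal.div_pos hη2 (by simp [hDt])).ne', by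
      calc D * (η / 2 / (D + 1)) ≤ (D + 1) * (η / 2 / (D + 1)) := by gcongr; exact le_self_add
        _ ≤ η / 2 := ENNReal.mul_div_le⟩
  -- The exponents `p'` and `q` are those in which `eLpNorm_localized_le_of_eLpNorm` measures the
  -- tail.
  obtain ⟨k, κ₁, κ₂, hkc, hks, hκ₁, hκ₂, hκ, h1, h2, h3⟩ :=
    hΩ.exists_kernel_decomposition hp' hpt' hq hqt hL hB hδ
  have hHc : Continuous fun w : E × E => k (w.1 - w.2) * ((b : E → ℂ) w.1 - (b : E → ℂ) w.2) := by
    have := b.2.1.continuous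
    fun_prop
  obtain ⟨S, hS, hSg⟩ := exists_isCompactOperator_kernel_approx (p := p) (p' := p') (q := q) hHc
    (hasCompactSupport_comm_kernel hks b.2.2) hqt hη2
  refine ⟨S, hS, fun g => ?_⟩
  set G : E → ℝ≥0∞ := fun x => ‖(g : E → ℂ) x‖ₑ with hG
  have hGm : Measurable G := g.2.1.continuous.measurable.enorm
  set I : E → ℂ := fun x => ∫ y, k (x - y) * ((b : E → ℂ) x - (b : E → ℂ) y) * (g : E → ℂ) y with hI
  have hIeq : ∀ x, I x =
      ∫ z, k z * (((b : E → ℂ) x - (b : E → ℂ) (x - z)) * (g : E → ℂ) (x - z)) := fun x => by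
    rw [hI, ← integral_sub_left_eq_self _ _ x]
    simp [mul_assoc]
  have hIm : AEStronglyMeasurable I volume := by
    have hm : Continuous fun w : E × E =>
        k (w.1 - w.2) * ((b : E → ℂ) w.1 - (b : E → ℂ) w.2) * (g : E → ℂ) w.2 :=
      hHc.mul (g.2.1.continuous.comp continuous_snd)
    exact (hm.stronglyMeasurable.integral_prod_right' (ν := volume)).aestronglyMeasurable
  set F : (E → ℝ≥0∞) → E → ℝ≥0∞ := fun κ x => ∫⁻ z, κ z * (c x + c (x - z)) * G (x - z) with hF
  have hFm : ∀ κ, Measurable κ → Measurable (F κ) := fun κ hκ =>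
    measurable_localized_lconv hκ hcm hGm
  have hptw : ∀ x, ‖commInt Ω b g x - I x‖ₑ ≤ F κ₁ x + F κ₂ x := fun x => by
    have hki : Integrable fun z =>
        k z * (((b : E → ℂ) x - (b : E → ℂ) (x - z)) * (g : E → ℂ) (x - z)) := by
      have hb := b.2.1.continuous
      have hg := g.2.1.continuous
      exact Continuous.integrable_of_hasCompactSupport (by fun_prop) hks.mul_right
    rw [hIeq, commInt, ← integral_sub (hΩ.integrable_comm b g x) hki]
    refine (enorm_integral_le_lintegral_enorm _).trans ?_
    have hm1 : Measurable fun z => κ₁ z * (c x + c (x - z)) * G (x - z) := by fun_prop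
    rw [hF, ← lintegral_add_left hm1]
    refine lintegral_mono fun z => ?_
    rw [← sub_mul, enorm_mul, enorm_mul]
    calc _ ≤ ‖ker Ω z - k z‖ₑ * (min (L * ‖z‖ₑ) B * (c x + c (x - z)) * G (x - z)) := by
          gcongr
          exact hLB x z
      _ = (‖ker Ω z - k z‖ₑ * min (L * ‖z‖ₑ) B) * ((c x + c (x - z)) * G (x - z)) := by ring
      _ ≤ (κ₁ z + κ₂ z) * ((c x + c (x - z)) * G (x - z)) := by gcongr; exact hκ z
      _ = _ := by ring
  have hGn : eLpNorm G p volume = eLpNorm (g : E → ℂ) p volume := eLpNorm_enorm _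
  have hF1 : eLpNorm (F κ₁) q volume ≤ 2 * δ * eLpNorm c r volume * eLpNorm G p volume :=
    (eLpNorm_localized_le_of_lintegral hq.le hr hpt hκ₁ hcm hGm).trans (by gcongr)
  have hF2 : eLpNorm (F κ₂) q volume ≤
      (eLpNorm c q volume * δ + eLpNorm c p' volume * δ) * eLpNorm G p volume :=
    (eLpNorm_localized_le_of_eLpNorm (p' := p') hq.le hqt hpt' hpt hκ₂ hcm hGm).trans (by gcongr)
  have hRm : AEStronglyMeasurable (fun x => ‖I x - S (testFunToLp p g) x‖ₑ) volume :=
    (hIm.sub (Lp.aestronglyMeasurable _)).enorm.aestronglyMeasurable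
  calc eLpNorm (fun x => commInt Ω b g x - S (testFunToLp p g) x) q volume
      ≤ eLpNorm (F κ₁ + F κ₂ + fun x => ‖I x - S (testFunToLp p g) x‖ₑ) q volume := by
        refine eLpNorm_mono_enorm fun x => ?_
        rw [enorm_eq_self, show commInt Ω b g x - S (testFunToLp p g) x =
          (commInt Ω b g x - I x) + (I x - S (testFunToLp p g) x) by ring]
        exact (enorm_add_le _ _).trans (add_le_add_left (hptw x) _)
    _ ≤ eLpNorm (F κ₁) q volume + eLpNorm (F κ₂) q volume +
        eLpNorm (fun x => ‖I x - S (testFunToLp p g) x‖ₑ) q volume := by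
        refine (eLpNorm_add_le ((hFm _ hκ₁).add (hFm _ hκ₂)).aestronglyMeasurable hRm hq.le).trans ?_
        exact add_le_add_left (eLpNorm_add_le (hFm _ hκ₁).aestronglyMeasurable
          (hFm _ hκ₂).aestronglyMeasurable hq.le) _
    _ ≤ 2 * δ * eLpNorm c r volume * eLpNorm G p volume +
        (eLpNorm c q volume * δ + eLpNorm c p' volume * δ) * eLpNorm G p volume +
        η / 2 * eLpNorm G p volume := by
        refine add_le_add (add_le_add hF1 hF2) ?_
        rw [eLpNorm_enorm, hGn]
        exact hSg g
    _ = (D * δ + η / 2) * eLpNorm G p volume := by rw [hD]; ring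
    _ ≤ (η / 2 + η / 2) * eLpNorm G p volume := by gcongr
    _ = _ := by rw [ENNReal.add_halves, hGn]

end RoughCommutator

namespace RoughCommutator

variable {E : Type*} [NormedAddCommGroup E] [InnerProductSpace ℝ E] [FiniteDimensional ℝ E]
  [MeasurableSpace E] [BorelSpace E]

/-! ### Compactness of the commutator -/

theorem isCompactOperator_of_approx {D X Y : Type*} [NormedAddCommGroup X] [NormedSpace ℂ X]
    [NormedAddCommGroup Y] [NormedSpace ℂ Y] [CompleteSpace Y] {e : D → X} (he : DenseRange e)
    {C : X →L[ℂ] Y} (h : ∀ η : ℝ, 0 < η → ∃ S : X →L[ℂ] Y, IsCompactOperator S ∧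
      ∀ g, ‖C (e g) - S (e g)‖ ≤ η * ‖e g‖) : IsCompactOperator C := by
  have hcl := isClosed_setOfPred_isCompactOperator (σ₁₂ := RingHom.id ℂ) (M₁ := X) (M₂ := Y)
  have hmem : C ∈ closure {f : X →L[ℂ] Y | IsCompactOperator f} := by
    refine Metric.mem_closure_iff.2 fun ε hε => ?_
    obtain ⟨S, hS, hle⟩ := h (ε / 2) (by positivity)
    refine ⟨S, hS, ?_⟩
    rw [dist_eq_norm]
    refine (ContinuousLinearMap.opNorm_le_bound (C - S) (M := ε / 2) (by positivity)
      fun x => ?_).trans_lt (by linarith)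
    refine he.induction_on (p := fun x => ‖(C - S) x‖ ≤ ε / 2 * ‖x‖) x
      (isClosed_le (by fun_prop) (by fun_prop)) fun g => ?_
    simpa using hle g
  rw [hcl.closure_eq] at hmem
  exact hmem

/-- The commutator of the pair `(Tp, Tq)` with the value at `b` of a bounded family of multiplication
operators depends continuously on `b`; hence it is compact for all `b` as soon as it is for a dense
set of them. -/
theorem isCompactOperator_comp_sub_comp {D X Y Z : Type*} [NormedAddCommGroup X] [NormedSpace ℂ X]
    [NormedAddCommGroup Y] [NormedSpace ℂ Y] [CompleteSpace Y] [NormedAddCommGroup Z]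
    [NormedSpace ℂ Z] (M : Z →L[ℂ] X →L[ℂ] Y) (Tp : X →L[ℂ] X) (Tq : Y →L[ℂ] Y) {e : D → Z}
    (he : DenseRange e) (h : ∀ g, IsCompactOperator ((M (e g)).comp Tp - Tq.comp (M (e g)))) (b : Z) :
    IsCompactOperator ((M b).comp Tp - Tq.comp (M b)) := by
  have hcl := isClosed_setOfPred_isCompactOperator (σ₁₂ := RingHom.id ℂ) (M₁ := X) (M₂ := Y)
  have hc : Continuous fun b => (M b).comp Tp - Tq.comp (M b) := by fun_prop
  exact he.induction_on b (hcl.preimage hc) h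

/-- By density in `L^r` the symbol may be a test function, and by density in `L^p` the approximation
by compact operators need only be checked on test functions, where the commutator is `commInt`. -/
theorem Angular.isCompactOperator_comm [Nontrivial E] {v : ℝ} {Ω : E → ℂ} (hΩ : Angular v Ω)
    {r p q : ℝ≥0∞} [Fact (1 ≤ p)] [Fact (1 ≤ q)] [Fact (1 ≤ r)] [ENNReal.HolderTriple r p q]
    (hq : 1 < q) (hqp : q < p) (hpt : p ≠ ⊤)
    {Tp : Lp ℂ p (volume : Measure E) →L[ℂ] Lp ℂ p (volume : Measure E)}
    {Tq : Lp ℂ q (volume : Measure E) →L[ℂ] Lp ℂ q (volume : Measure E)}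
    (hTp : ∀ g : testFun E, Tp (testFunToLp p g) =ᵐ[volume] pvInt Ω g)
    (hTq : ∀ g : testFun E, Tq (testFunToLp q g) =ᵐ[volume] pvInt Ω g)
    (b : Lp ℂ r (volume : Measure E)) :
    IsCompactOperator
      (((ContinuousLinearMap.mul ℂ ℂ).holderL volume r p q b).comp Tp -
        Tq.comp ((ContinuousLinearMap.mul ℂ ℂ).holderL volume r p q b)) := by
  -- The exponent `r = ∞` would force `p = q`; finiteness gives density of test functions in `L^r`.
  have hr : r ≠ ⊤ := by
    rintro rfl
    have := ENNReal.HolderTriple.inv_add_inv_eq_inv ⊤ p q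
    rw [ENNReal.inv_top, zero_add, inv_inj] at this
    exact hqp.ne' this
  have hp1 : 1 < p := hq.trans hqp
  set p' : ℝ≥0∞ := (1 - p⁻¹)⁻¹ with hp'
  have hpinv : p⁻¹ < 1 := ENNReal.inv_lt_one.2 hp1
  have : ENNReal.HolderTriple p' p 1 := ENNReal.holderConjugate_iff.2 (by
    rw [hp', inv_inv, tsub_add_cancel_of_le hpinv.le])
  have hp'1 : 1 < p' := by
    rw [hp', ENNReal.one_lt_inv]
    exact ENNReal.sub_lt_self ENNReal.one_ne_top one_ne_zero (ENNReal.inv_ne_zero.2 hpt)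
  have hp't : p' ≠ ⊤ := ENNReal.inv_ne_top.2 (tsub_pos_of_lt hpinv).ne'
  refine isCompactOperator_comp_sub_comp _ Tp Tq (denseRange_testFunToLp hr) (fun β => ?_) b
  refine isCompactOperator_of_approx (denseRange_testFunToLp hpt) fun η hη => ?_
  obtain ⟨S, hS, hle⟩ := hΩ.exists_isCompactOperator_comm_approx (r := r) (p := p) (p' := p')
    (q := q) hq hr hpt hp'1 hp't β (η := ENNReal.ofReal η) (by simpa using hη)
  refine ⟨S, hS, fun g => ?_⟩
  set M := (ContinuousLinearMap.mul ℂ ℂ).holderL (volume : Measure E) r p q (testFunToLp r β)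
    with hM
  have hM' : ∀ f, M f =ᵐ[volume] fun x => (β : E → ℂ) x * f x := fun f => by
    filter_upwards [(ContinuousLinearMap.mul ℂ ℂ).coeFn_holder (r := q) (testFunToLp r β) f,
      coeFn_testFunToLp r β] with x h1 h2
    rw [← h2]
    exact h1
  have hprod : testFunToLp q (testFunMul β g) = M (testFunToLp p g) := testFunToLp_eq (by
    filter_upwards [hM' (testFunToLp p g), coeFn_testFunToLp p g] with x h1 h2
    rw [h1, h2, coe_testFunMul, Pi.mul_apply])
  have hcomm : (M.comp Tp - Tq.comp M) (testFunToLp p g) =ᵐ[volume] commInt Ω β g := by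
    rw [sub_apply, ContinuousLinearMap.comp_apply,
      ContinuousLinearMap.comp_apply, ← hprod]
    filter_upwards [Lp.coeFn_sub (M (Tp (testFunToLp p g))) (Tq (testFunToLp q (testFunMul β g))),
      hM' (Tp (testFunToLp p g)), hTp g, hTq (testFunMul β g)] with x h1 h2 h3 h4
    rw [h1, Pi.sub_apply, h2, h3, h4, hΩ.mul_pvInt_sub_pvInt_mul]
  have hn : eLpNorm ((M.comp Tp - Tq.comp M) (testFunToLp p g) - S (testFunToLp p g) :
      Lp ℂ q (volume : Measure E)) q volume ≤ ENNReal.ofReal η * eLpNorm (g : E → ℂ) p volume := by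
    refine (eLpNorm_congr_ae ?_).trans_le (hle g)
    filter_upwards [Lp.coeFn_sub ((M.comp Tp - Tq.comp M) (testFunToLp p g))
      (S (testFunToLp p g)), hcomm] with x h1 h2
    rw [h1, Pi.sub_apply, h2]
  rw [← eLpNorm_congr_ae (coeFn_testFunToLp p g)] at hn
  rw [Lp.norm_def, Lp.norm_def]
  have h2 := ENNReal.toReal_mono
    (ENNReal.mul_ne_top ENNReal.ofReal_ne_top (Lp.eLpNorm_ne_top (testFunToLp p g))) hn
  rwa [ENNReal.toReal_mul, ENNReal.toReal_ofReal hη.le] at h2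

theorem commutator_eq_comp_sub_comp {n : ℕ} {p q r : ℝ≥0∞} [Fact (1 ≤ p)] [Fact (1 ≤ q)]
    [Fact (1 ≤ r)] [ENNReal.HolderTriple r p q]
    (b : Lp ℂ r (volume : Measure (EuclideanSpace ℝ (Fin n))))
    (Tp : Lp ℂ p (volume : Measure (EuclideanSpace ℝ (Fin n))) →L[ℂ]
      Lp ℂ p (volume : Measure (EuclideanSpace ℝ (Fin n))))
    (Tq : Lp ℂ q (volume : Measure (EuclideanSpace ℝ (Fin n))) →L[ℂ]
      Lp ℂ q (volume : Measure (EuclideanSpace ℝ (Fin n)))) :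
    ⇑(commutator b Tp Tq) =
      ⇑(((ContinuousLinearMap.mul ℂ ℂ).holderL volume r p q b).comp Tp -
        Tq.comp ((ContinuousLinearMap.mul ℂ ℂ).holderL volume r p q b)) := rfl

end RoughCommutator

theorem theorem2p9 (n : ℕ) (hn : 1 ≤ n)
    (p q r v : ℝ≥0∞) [Fact (1 ≤ p)] [Fact (1 ≤ q)] [ENNReal.HolderTriple r p q]
    (hq : 1 < q) (hqp : q < p) (hp : p < ⊤) (hv : 1 < v)
    (b : Lp ℂ r (volume : Measure (EuclideanSpace ℝ (Fin n))))
    (Ω : EuclideanSpace ℝ (Fin n) → ℂ)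
    (hΩhom : ∀ t : ℝ, 0 < t → ∀ x : EuclideanSpace ℝ (Fin n), ‖x‖ = 1 → Ω (t • x) = Ω x)
    (hΩmean : ∫ x : Metric.sphere (0 : EuclideanSpace ℝ (Fin n)) 1,
      Ω x ∂(volume : Measure (EuclideanSpace ℝ (Fin n))).toSphere = 0)
    (hΩLv : MemLp (fun x : Metric.sphere (0 : EuclideanSpace ℝ (Fin n)) 1 => Ω x) v
      (volume : Measure (EuclideanSpace ℝ (Fin n))).toSphere) :
    (∃ Tp, RoughCommutator.IsSingularIntegral Ω p Tp) ∧
    (∃ Tq, RoughCommutator.IsSingularIntegral Ω q Tq) ∧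
    ∀ Tp Tq, RoughCommutator.IsSingularIntegral Ω p Tp →
      RoughCommutator.IsSingularIntegral Ω q Tq →
      IsCompactOperator (RoughCommutator.commutator b Tp Tq) := by
  have : Nonempty (Fin n) := ⟨⟨0, hn⟩⟩
  have : Fact (1 ≤ r) := ⟨hq.le.trans (ENNReal.HolderTriple.le r p q)⟩
  obtain ⟨w, Ω', hΩ', hae⟩ := RoughCommutator.exists_angular hv hΩhom hΩmean hΩLv
  refine ⟨?_, ?_, fun Tp Tq hTp hTq => ?_⟩
  · obtain ⟨T, hT⟩ := hΩ'.exists_clm_eq_pvInt (hq.trans hqp) hp.ne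
    exact ⟨T, (RoughCommutator.isSingularIntegral_iff hn hae hΩ' T).2 hT⟩
  · obtain ⟨T, hT⟩ := hΩ'.exists_clm_eq_pvInt hq (hqp.trans hp).ne
    exact ⟨T, (RoughCommutator.isSingularIntegral_iff hn hae hΩ' T).2 hT⟩
  · rw [RoughCommutator.commutator_eq_comp_sub_comp]
    exact hΩ'.isCompactOperator_comm hq hqp hp.ne
      ((RoughCommutator.isSingularIntegral_iff hn hae hΩ' Tp).1 hTp)
      ((RoughCommutator.isSingularIntegral_iff hn hae hΩ' Tq).1 hTq) b
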